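/- Let $V:\mathbb R\to\mathbb R$ be differentiable almost everywhere, with derivative $V'$, and consider $$i\partial_t u+\partial_x^2u-Vu=-|u|^4u,\qquad u(0)=u_0,\qquad (t,x)\in\mathbb R\times\mathbb R. \tag{NLS$_V$}$$ A solution on a time interval $I\ni 0$ is a function $u\in C(I;H^1(\mathbb R))$ that satisfies, for all $t\in I$, in the sense of tempered distributions, $$u(t)=e^{it\partial_x^2}u_0+i\int_0^t e^{i(t-s)\partial_x^2}\big(|u|^4u-Vu\big)(s)\,ds .$$ It is the maximal solution on $(T_{\min},T_{\max})$ if every solution with the same initial datum, on any time interval containing $0$, is a restriction of it. The mass and energy are $$M[f]=\|f\|_{L^2}^2,\qquad E_V[f]=\tfrac12\|\partial_xf\|_{L^2}^2+\tfrac12\int_{\mathbb R}V|f|^2\,dx-\tfrac16\|f\|_{L^6}^6 .$$ Fix an odd function $\zeta\in W^{3,\infty}(\mathbb R)$ with $\zeta(s)=2s$ for $|s|\le1$, $\zeta(s)=2[s-(s-1)^3]$ for $1\le s\le 1+1/\sqrt3$, $\zeta(s)=2[s-(s+1)^3]$ for $-1-1/\sqrt3\le s\le-1$, $\zeta'(s)<0$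 for $1+1/\sqrt3<|s|<2$, and $\zeta(s)=0$ for $|s|\ge2$; put $\mathscr X(x)=\int_0^x\zeta(s)\,ds$. Let $u_0\in H^1(\mathbb R)$ and assume: 1. (NLS$_V$) is locally well-posed in $H^1(\mathbb R)$: for every initial datum in $H^1(\mathbb R)$ there is a (necessarily unique) maximal solution $u$ on some $(T_{\min},T_{\max})$ with $-\infty\le T_{\min}<0<T_{\max}\le\infty$; it depends continuously on the initial datum in $C(J;H^1(\mathbb R))$ for each compact interval $J\subset(T_{\min},T_{\max})$; if $T_{\max}<\infty$ (resp. $T_{\min}>-\infty$), then $\|u(t)\|_{H^1}\to\infty$ as $t\nearrow T_{\max}$ (resp. $t\searrow T_{\min}$); and $M[u(t)]$ and $E_V[u(t)]$ are conserved, with $V|u(t)|^2\in L^1(\mathbb R)$. 2. For the maximal solution $u$ with initial datum $u_0$ and every $w(x)=\int_0^x\varphi(s)\,ds$ with $\varphi\in W^{3,\infty}(\mathbb R)$ real-valued and compactly supported, $w'V'|u(t)|^2$ is integrable for all $t\in(T_{\min},T_{\max})$, the function $t\mapsto\int_{\mathbb R} w|u(t,x)|^2dx$ is twice differentiable on $(T_{\min},T_{\max})$,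 and $$\frac{d^2}{dt^2}\int_{\mathbb R} w|u|^2dx=4\int_{\mathbb R} w''|\partial_xu|^2dx-\frac43\int_{\mathbb R} w''|u|^6dx-\int_{\mathbb R} w^{(4)}|u|^2dx-2\int_{\mathbb R} w'V'|u|^2dx .$$ 3. For every $R>0$ and almost every $x\in\mathbb R$, $$-R\,\mathscr X'\!\left(\frac xR\right)V'(x)-4V(x)\le0 .$$ If $E_V[u_0]<0$, then the maximal solution $u$ with initial datum $u_0$ blows up in finite time in both time directions: $T_{\min}>-\infty$, $T_{\max}<\infty$, and $\|u(t)\|_{H^1}\to\infty$ as $t\nearrow T_{\max}$ and as $t\searrow T_{\min}$. -/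

import Mathlib

open MeasureTheory Filter Topology Set
open scoped SchwartzMap ContDiff ENNReal

noncomputable section

namespace NLS

/-! ### Sobolev spaces on the line -/

/-- `g` is the weak (distributional) derivative of `f` on `ℝ`. -/
structure HasWeakDeriv {E : Type*} [NormedAddCommGroup E] [NormedSpace ℝ E]
    (f g : ℝ → E) : Prop where
  locallyIntegrable : LocallyIntegrable f
  locallyIntegrable_deriv : LocallyIntegrable g
  integral_eq : ∀ ψ : ℝ → ℝ, ContDiff ℝ ∞ ψ → HasCompactSupport ψ →
    ∫ x, deriv ψ x • f x = -∫ x, ψ x • g x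

open Classical in
/-- The weak derivative `∂ₓ f` of a complex-valued function (unique up to null sets when it exists;
`0` if there is none). -/
def weakDeriv (f : ℝ → ℂ) : ℝ → ℂ :=
  if h : ∃ g, HasWeakDeriv f g then h.choose else 0

/-- `f ∈ H¹(ℝ)`: `f` and its weak derivative are in `L²(ℝ)`. -/
def MemH1 (f : ℝ → ℂ) : Prop :=
  MemLp f 2 ∧ ∃ g, HasWeakDeriv f g ∧ MemLp g 2

/-- The `H¹(ℝ)` norm. -/
def h1Norm (f : ℝ → ℂ) : ℝ :=
  √((∫ x, ‖f x‖ ^ 2) + ∫ x, ‖weakDeriv f x‖ ^ 2)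

/-- `φ ∈ W^{3,∞}(ℝ)` with weak derivatives `φ' = φ₁`, `φ'' = φ₂`, `φ''' = φ₃`. -/
structure IsW3Inf (φ φ₁ φ₂ φ₃ : ℝ → ℝ) : Prop where
  memLp : MemLp φ ∞
  memLp₁ : MemLp φ₁ ∞
  memLp₂ : MemLp φ₂ ∞
  memLp₃ : MemLp φ₃ ∞
  deriv₁ : HasWeakDeriv φ φ₁
  deriv₂ : HasWeakDeriv φ₁ φ₂
  deriv₃ : HasWeakDeriv φ₂ φ₃

/-! ### The free Schrödinger group -/

/-- The symbol of `e^{iτ∂ₓ²}` for the Fourier transform `∫ e^{-2πixξ} f(x) dx`. -/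
def freeSymbol (τ : ℝ) (ξ : ℝ) : ℂ :=
  Complex.exp (((-(4 * Real.pi ^ 2 * τ) * ξ ^ 2 : ℝ) : ℂ) * Complex.I)

theorem hasTemperateGrowth_exp_mul_I :
    (fun x : ℝ => Complex.exp ((x : ℂ) * Complex.I)).HasTemperateGrowth := by
  have key : ∀ n : ℕ, iteratedDeriv n (fun x : ℝ => Complex.exp ((x : ℂ) * Complex.I)) =
      fun x : ℝ => Complex.I ^ n * Complex.exp ((x : ℂ) * Complex.I) := by
    intro n
    induction n with
    | zero => ext x; simp
    | succ n ih =>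
      rw [iteratedDeriv_succ, ih]
      ext x
      have h : HasDerivAt (fun x : ℝ => Complex.exp ((x : ℂ) * Complex.I))
          (Complex.exp ((x : ℂ) * Complex.I) * (1 * Complex.I)) x :=
        ((Complex.ofRealCLM.hasDerivAt (x := x)).mul_const Complex.I).cexp
      rw [(h.const_mul (Complex.I ^ n)).deriv]
      ring
  refine ⟨(Complex.ofRealCLM.contDiff.mul contDiff_const).cexp, fun n => ⟨0, 1, fun x => ?_⟩⟩
  rw [norm_iteratedFDeriv_eq_norm_iteratedDeriv, key]
  simp [Complex.norm_exp_ofReal_mul_I]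

/-- The symbol is an admissible Fourier multiplier on Schwartz functions. -/
theorem hasTemperateGrowth_freeSymbol (τ : ℝ) : (freeSymbol τ).HasTemperateGrowth := by
  have h : (fun ξ : ℝ => -(4 * Real.pi ^ 2 * τ) * ξ ^ 2).HasTemperateGrowth :=
    (Function.HasTemperateGrowth.const _).mul (Function.HasTemperateGrowth.id'.pow 2)
  exact hasTemperateGrowth_exp_mul_I.comp h

/-- The free Schrödinger group `e^{iτ∂ₓ²}` on Schwartz functions. -/
def freeGroup (τ : ℝ) : 𝓢(ℝ, ℂ) →L[ℂ] 𝓢(ℝ, ℂ) :=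
  SchwartzMap.fourierMultiplierCLM ℂ (freeSymbol τ)

/-! ### Solutions of `i∂ₜu + ∂ₓ²u - Vu = -|u|⁴u` -/

/-- The term `|f|⁴f - Vf`. -/
def forcing (V : ℝ → ℝ) (f : ℝ → ℂ) (x : ℝ) : ℂ :=
  (‖f x‖ : ℂ) ^ 4 * f x - (V x : ℂ) * f x

/-- `u` is a solution on the time interval `I ∋ 0` with initial datum `u₀`: `u ∈ C(I; H¹(ℝ))`
(hence `u` is also bounded in `H¹` on compact subintervals), and
`u(t) = e^{it∂ₓ²}u₀ + i∫₀ᵗ e^{i(t-s)∂ₓ²}(|u|⁴u - Vu)(s) ds` for all `t ∈ I`. The formula is an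
identity of tempered distributions, in which `e^{iτ∂ₓ²}` acts on distributions by
`⟨e^{iτ∂ₓ²}F, ψ⟩ = ⟨F, e^{iτ∂ₓ²}ψ⟩`. -/
structure IsSolution (V : ℝ → ℝ) (u₀ : ℝ → ℂ) (I : Set ℝ) (u : ℝ → ℝ → ℂ) : Prop where
  ordConnected : I.OrdConnected
  zero_mem : (0 : ℝ) ∈ I
  memH1 : ∀ t ∈ I, MemH1 (u t)
  continuous : ∀ t₀ ∈ I,
    Tendsto (fun t => h1Norm (fun x => u t x - u t₀ x)) (𝓝[I] t₀) (𝓝 0)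
  integrable_forcing : ∀ s ∈ I, ∀ ψ : 𝓢(ℝ, ℂ), Integrable (fun x => forcing V (u s) x * ψ x)
  intervalIntegrable_forcing : ∀ t ∈ I, ∀ ψ : 𝓢(ℝ, ℂ),
    IntervalIntegrable (fun s => ∫ x, forcing V (u s) x * freeGroup (t - s) ψ x) volume 0 t
  duhamel : ∀ t ∈ I, ∀ ψ : 𝓢(ℝ, ℂ),
    ∫ x, u t x * ψ x =
      (∫ x, u₀ x * freeGroup t ψ x) +
        Complex.I * ∫ s in (0 : ℝ)..t, ∫ x, forcing V (u s) x * freeGroup (t - s) ψ x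

/-- The open time interval `(Tmin, Tmax)` with possibly infinite end points. -/
def timeInterval (Tmin Tmax : EReal) : Set ℝ :=
  {t | Tmin < (t : EReal) ∧ (t : EReal) < Tmax}

/-- `u`, defined on `(Tmin, Tmax)`, is the maximal solution with initial datum `u₀`: it is a
solution, and every solution with initial datum `u₀`, on any time interval, is a restriction
of it. -/
structure IsMaximalSolution (V : ℝ → ℝ) (u₀ : ℝ → ℂ) (Tmin Tmax : EReal) (u : ℝ → ℝ → ℂ) :
    Prop where
  isSolution : IsSolution V u₀ (timeInterval Tmin Tmax) u
  unique : ∀ (J : Set ℝ) (v : ℝ → ℝ → ℂ), IsSolution V u₀ J v →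
    J ⊆ timeInterval Tmin Tmax ∧ ∀ t ∈ J, v t =ᵐ[volume] u t

/-- The `H¹` norm tends to infinity as `t ↗ Tmax`. -/
def NormBlowsUpAtMax (Tmax : EReal) (u : ℝ → ℝ → ℂ) : Prop :=
  Tendsto (fun t => h1Norm (u t)) (𝓝[<] Tmax.toReal) atTop

/-- The `H¹` norm tends to infinity as `t ↘ Tmin`. -/
def NormBlowsUpAtMin (Tmin : EReal) (u : ℝ → ℝ → ℂ) : Prop :=
  Tendsto (fun t => h1Norm (u t)) (𝓝[>] Tmin.toReal) atTop

/-- The mass `M[f] = ‖f‖²_{L²}`. -/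
def mass (f : ℝ → ℂ) : ℝ := ∫ x, ‖f x‖ ^ 2

/-- The energy `E_V[f] = ½‖∂ₓf‖²_{L²} + ½∫ V|f|² - ⅙‖f‖⁶_{L⁶}`. -/
def energy (V : ℝ → ℝ) (f : ℝ → ℂ) : ℝ :=
  1 / 2 * (∫ x, ‖weakDeriv f x‖ ^ 2) + 1 / 2 * (∫ x, V x * ‖f x‖ ^ 2)
    - 1 / 6 * ∫ x, ‖f x‖ ^ 6

/-- Local well-posedness of the equation in `H¹(ℝ)`: for every `u₀ ∈ H¹(ℝ)` there is a unique
maximal solution, which depends continuously on the initial datum on compact time intervals,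
satisfies the blow-up alternative, and conserves mass and energy (whose potential term is
finite). -/
def LocallyWellPosed (V : ℝ → ℝ) : Prop :=
  ∀ u₀ : ℝ → ℂ, MemH1 u₀ → ∃ (Tmin Tmax : EReal) (u : ℝ → ℝ → ℂ),
    IsMaximalSolution V u₀ Tmin Tmax u ∧
    (∀ a b : ℝ, Icc a b ⊆ timeInterval Tmin Tmax → ∀ ε > 0, ∃ δ > 0, ∀ v₀ : ℝ → ℂ, MemH1 v₀ →
      h1Norm (fun x => v₀ x - u₀ x) < δ → ∀ (Smin Smax : EReal) (v : ℝ → ℝ → ℂ),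
        IsMaximalSolution V v₀ Smin Smax v →
          Icc a b ⊆ timeInterval Smin Smax ∧
            ∀ t ∈ Icc a b, h1Norm (fun x => v t x - u t x) < ε) ∧
    (Tmin ≠ ⊥ → NormBlowsUpAtMin Tmin u) ∧
    (Tmax ≠ ⊤ → NormBlowsUpAtMax Tmax u) ∧
    ∀ t ∈ timeInterval Tmin Tmax,
      mass (u t) = mass u₀ ∧
      Integrable (fun x => V x * ‖u t x‖ ^ 2) ∧
      energy V (u t) = energy V u₀

/-- The solution blows up: it exists only for finite time, in both time directions, and its `H¹`
norm tends to infinity at both ends of its life span. -/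
def BlowsUp (Tmin Tmax : EReal) (u : ℝ → ℝ → ℂ) : Prop :=
  (Tmin ≠ ⊥ ∧ NormBlowsUpAtMin Tmin u) ∧ (Tmax ≠ ⊤ ∧ NormBlowsUpAtMax Tmax u)

/-! ### The localized virial identity -/

/-- The localized virial quantity `I_w(t) = ∫ w |u(t)|² dx` with `w(x) = ∫₀ˣ φ`. -/
def virial (φ : ℝ → ℝ) (u : ℝ → ℝ → ℂ) (t : ℝ) : ℝ :=
  ∫ x, (∫ s in (0 : ℝ)..x, φ s) * ‖u t x‖ ^ 2

/-- The localized virial identity for `u` on the open time interval `I`, for all weights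
`w(x) = ∫₀ˣ φ` with `φ ∈ W^{3,∞}(ℝ)` compactly supported; here `w' = φ`, `w'' = φ₁` and
`w⁗ = φ₃`. It includes that `I_w` is twice differentiable and that the term with `V'` is
integrable. -/
def LocalizedVirialIdentity (V : ℝ → ℝ) (I : Set ℝ) (u : ℝ → ℝ → ℂ) : Prop :=
  ∀ φ φ₁ φ₂ φ₃ : ℝ → ℝ, IsW3Inf φ φ₁ φ₂ φ₃ → HasCompactSupport φ → ∀ t ∈ I,
    Integrable (fun x => φ x * deriv V x * ‖u t x‖ ^ 2) ∧
    DifferentiableAt ℝ (virial φ u) t ∧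
    HasDerivAt (deriv (virial φ u))
      (4 * (∫ x, φ₁ x * ‖weakDeriv (u t) x‖ ^ 2)
        - 4 / 3 * (∫ x, φ₁ x * ‖u t x‖ ^ 6)
        - (∫ x, φ₃ x * ‖u t x‖ ^ 2)
        - 2 * ∫ x, φ x * deriv V x * ‖u t x‖ ^ 2) t

/-! ### The cut-off weight -/

/-- `ζ ∈ W^{3,∞}(ℝ)` is one of the odd cut-offs of the identity used to build the weight `𝒳`. -/
structure IsCutoffProfile (ζ : ℝ → ℝ) : Prop where
  memW3Inf : ∃ ζ₁ ζ₂ ζ₃ : ℝ → ℝ, IsW3Inf ζ ζ₁ ζ₂ ζ₃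
  odd : ∀ s, ζ (-s) = -ζ s
  eq_linear : ∀ s, |s| ≤ 1 → ζ s = 2 * s
  eq_pos : ∀ s, 1 ≤ s → s ≤ 1 + 1 / √3 → ζ s = 2 * (s - (s - 1) ^ 3)
  eq_neg : ∀ s, -1 - 1 / √3 ≤ s → s ≤ -1 → ζ s = 2 * (s - (s + 1) ^ 3)
  deriv_neg : ∀ s, 1 + 1 / √3 < |s| → |s| < 2 → deriv ζ s < 0
  eq_zero : ∀ s, 2 ≤ |s| → ζ s = 0

/-- The weight `𝒳(x) = ∫₀ˣ ζ(s) ds`. -/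
def cutoffWeight (ζ : ℝ → ℝ) (x : ℝ) : ℝ := ∫ s in (0 : ℝ)..x, ζ s

end NLS

end

/-! The argument is a localized virial argument in the style of Ogawa and Tsutsumi. Put `I(t) = ∫ w
|u(t)|²` with `w(x) = R² 𝒳(x/R)`. If `w` were `x²` and `V` zero, `I'' = 16 E` would hold, and a
nonnegative function cannot be uniformly concave on a half-line. The cut-off keeps `I` finite for
`H¹` data, at the price of error terms in `|x| ≥ R`.

Write `w'' = 2 - ρ`. The profile is such that `ρ` vanishes for `|x| < R` and is comparable with the
square of a Lipschitz function, `ramp (x/R)`. The error `4/3 ∫ ρ |u|⁶` is then controlled by a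
weighted Gagliardo–Nirenberg inequality (`integral_mul_norm_pow_six_le`): when the mass in `|x| ≥ R`
is at most `a²` with `a` small, it is absorbed by `-4 ∫ ρ |∂ₓu|²` up to `O(R⁻²)`. The sign condition
turns `-2 ∫ w' V' |u|²` into at most `8 ∫ V |u|²`, the potential part of `16 E`. Hence `I'' ≤ 16 E +
O(R⁻²)` (`virial_rhs_le`) as long as the outer mass is small.

That restriction is removed by a continuity argument. Since `𝒳 ≥ 1` outside the unit ball, `I(t) ≤
a² R²` forces outer mass at most `a²`; and with `I'' ≤ -c` in this regime, `I` stays below the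
maximum `I(0) + I'(0)²/(2c)` of a parabola. Dominated convergence gives `I(0) = o(R²)` and `I'(0) =
o(R)`, so for large `R` this maximum is below `a² R²` and the regime is never left
(`exists_concave_virial`, `false_of_deriv_deriv_le`). An infinite life span in either time direction
is therefore impossible, and the blow-up alternative gives the growth of the norm.

The virial hypothesis provides `I''` but no formula for `I'`. The value `I'(0) = 2 Im ∫ w' ∂ₓu ū`
has to be derived from Duhamel's formula in the sense of distributions, with no regularity of `V`
beyond integrability of `V (1 + x²)⁻²`. This is `hasDerivAt_localMass`: the weak equation is
differentiated against smooth functions, extended by density to compactly supported `H¹` functions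
with uniform bounds, and tested against `w ū`. -/

namespace NLS

set_option linter.unusedSectionVars false

/-! ### Absolutely continuous functions as primitives -/

section Primitive

variable {E F : Type*} [NormedAddCommGroup E] [NormedSpace ℝ E] [CompleteSpace E]
  [NormedAddCommGroup F] [NormedSpace ℝ F] [CompleteSpace F]

/-- `f` is a (continuous) primitive of the locally integrable function `g`. -/
structure IsPrimitive {E : Type*} [NormedAddCommGroup E] [NormedSpace ℝ E]
    (f g : ℝ → E) : Prop where
  locallyIntegrable : LocallyIntegrable g
  sub_eq : ∀ x y, f y - f x = ∫ t in x..y, g t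

theorem intervalIntegrable_of_locallyIntegrable {E : Type*} [NormedAddCommGroup E] {g : ℝ → E}
    (hg : LocallyIntegrable g) (a b : ℝ) : IntervalIntegrable g volume a b :=
  intervalIntegrable_iff.mpr
    ((hg.integrableOn_isCompact isCompact_uIcc).mono_set uIoc_subset_uIcc)

theorem isPrimitive_intervalIntegral {g : ℝ → E} (hg : LocallyIntegrable g) (a : ℝ) :
    IsPrimitive (fun x => ∫ t in a..x, g t) g :=
  ⟨hg, fun _ _ => intervalIntegral.integral_interval_sub_left
    (intervalIntegrable_of_locallyIntegrable hg _ _)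
    (intervalIntegrable_of_locallyIntegrable hg _ _)⟩

theorem IsPrimitive.intervalIntegrable {f g : ℝ → E} (h : IsPrimitive f g) (a b : ℝ) :
    IntervalIntegrable g volume a b :=
  intervalIntegrable_of_locallyIntegrable h.locallyIntegrable a b

theorem IsPrimitive.eq_add {f g : ℝ → E} (h : IsPrimitive f g) (a x : ℝ) :
    f x = f a + ∫ t in a..x, g t := by
  rw [← h.sub_eq]; abel

theorem IsPrimitive.continuous {f g : ℝ → E} (h : IsPrimitive f g) : Continuous f := by
  have : f = fun x => f 0 + ∫ t in (0 : ℝ)..x, g t := funext fun x => h.eq_add 0 x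
  rw [this]
  exact continuous_const.add
    (intervalIntegral.continuous_primitive (fun a b => h.intervalIntegrable a b) 0)

/-- Increments of `f` are dominated by those of the real-valued primitive of `‖g‖`, from which
absolute continuity is inherited by squeezing. -/
theorem IsPrimitive.absolutelyContinuousOnInterval {f g : ℝ → E} (h : IsPrimitive f g)
    (a b : ℝ) : AbsolutelyContinuousOnInterval f a b := by
  have hn : LocallyIntegrable (fun x => ‖g x‖) := fun x => by
    obtain ⟨s, hs, hi⟩ := h.locallyIntegrable x
    exact ⟨s, hs, hi.norm⟩
  have hG := (intervalIntegrable_of_locallyIntegrable hn a b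
    ).absolutelyContinuousOnInterval_intervalIntegral (c := a) left_mem_uIcc
  refine squeeze_zero (fun _ => Finset.sum_nonneg fun _ _ => dist_nonneg) (fun D => ?_) hG
  refine Finset.sum_le_sum fun i _ => ?_
  rw [dist_comm, dist_eq_norm, h.sub_eq, dist_comm, Real.dist_eq,
    (isPrimitive_intervalIntegral hn a).sub_eq]
  exact intervalIntegral.norm_integral_le_abs_integral_norm

theorem IsPrimitive.ae_hasDerivAt {f g : ℝ → E} (h : IsPrimitive f g) :
    ∀ᵐ x, HasDerivAt f (g x) x := by
  have : f = fun x => f 0 + ∫ t in (0 : ℝ)..x, g t := funext fun x => h.eq_add 0 x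
  filter_upwards [LocallyIntegrable.ae_hasDerivAt_integral h.locallyIntegrable] with x hx
  rw [this]
  exact (hx 0).const_add _

/-- The difference between `f` and the integral of `g` is absolutely continuous with zero derivative
almost everywhere, hence constant. The product rule is obtained this way. -/
theorem isPrimitive_of_absolutelyContinuous {f g : ℝ → E} (hg : LocallyIntegrable g)
    (hf : ∀ a b, AbsolutelyContinuousOnInterval f a b) (hd : ∀ᵐ x, HasDerivAt f (g x) x) :
    IsPrimitive f g := by
  refine ⟨hg, fun a b => ?_⟩
  have hG := isPrimitive_intervalIntegral hg a
  have hac := (hf a b).fun_sub (hG.absolutelyContinuousOnInterval a b)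
  obtain ⟨C, hC⟩ := hac.const_of_ae_hasDerivAt_zero (by
    filter_upwards [hd, hG.ae_hasDerivAt] with x h1 h2 _
    have := h1.sub h2
    rwa [sub_self] at this)
  have h1 := hC a left_mem_uIcc
  have h2 := hC b right_mem_uIcc
  simp only [intervalIntegral.integral_same, sub_zero] at h1
  rw [h1, ← h2]; abel

theorem IsPrimitive.clm_comp {f g : ℝ → E} (h : IsPrimitive f g) (L : E →L[ℝ] F) :
    IsPrimitive (fun x => L (f x)) (fun x => L (g x)) := by
  refine ⟨fun x => ?_, fun x y => ?_⟩
  · obtain ⟨s, hs, hi⟩ := h.locallyIntegrable x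
    exact ⟨s, hs, L.integrable_comp hi⟩
  · rw [← map_sub, h.sub_eq, L.intervalIntegral_comp_comm (h.intervalIntegrable x y)]

theorem IsPrimitive.sub {f g h k : ℝ → E} (hf : IsPrimitive f g) (hh : IsPrimitive h k) :
    IsPrimitive (fun x => f x - h x) (fun x => g x - k x) := by
  refine ⟨hf.locallyIntegrable.sub hh.locallyIntegrable, fun x y => ?_⟩
  rw [intervalIntegral.integral_sub (hf.intervalIntegrable x y) (hh.intervalIntegrable x y),
    ← hf.sub_eq, ← hh.sub_eq]
  abel

theorem isPrimitive_of_hasDerivAt {f g : ℝ → E} (hd : ∀ x, HasDerivAt f (g x) x)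
    (hg : Continuous g) : IsPrimitive f g :=
  ⟨hg.locallyIntegrable, fun x y => (intervalIntegral.integral_eq_sub_of_hasDerivAt
    (fun t _ => hd t) (hg.intervalIntegrable x y)).symm⟩

/-- The product rule. -/
theorem IsPrimitive.smul {𝕂 : Type*} [RCLike 𝕂] [NormedSpace 𝕂 E] [IsScalarTower ℝ 𝕂 E]
    {f g : ℝ → 𝕂} {h k : ℝ → E}
    (hf : IsPrimitive f g) (hh : IsPrimitive h k) :
    IsPrimitive (fun x => f x • h x) (fun x => f x • k x + g x • h x) := by
  refine isPrimitive_of_absolutelyContinuous ?_ (fun a b =>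
    (hf.absolutelyContinuousOnInterval a b).fun_smul (hh.absolutelyContinuousOnInterval a b)) ?_
  · rw [← locallyIntegrableOn_univ]
    exact (hh.locallyIntegrable.locallyIntegrableOn _ |>.continuousOn_smul
        isOpen_univ.isLocallyClosed hf.continuous.continuousOn).add
      (hf.locallyIntegrable.locallyIntegrableOn _ |>.smul_continuousOn
        isOpen_univ.isLocallyClosed hh.continuous.continuousOn)
  · filter_upwards [hf.ae_hasDerivAt, hh.ae_hasDerivAt] with x h1 h2
    exact h1.smul h2

theorem IsPrimitive.conj {f g : ℝ → ℂ} (h : IsPrimitive f g) :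
    IsPrimitive (fun x => starRingEnd ℂ (f x)) (fun x => starRingEnd ℂ (g x)) :=
  h.clm_comp Complex.conjCLE.toContinuousLinearMap

theorem IsPrimitive.ofReal {f g : ℝ → ℝ} (h : IsPrimitive f g) :
    IsPrimitive (fun x => (f x : ℂ)) (fun x => (g x : ℂ)) :=
  h.clm_comp Complex.ofRealCLM

theorem IsPrimitive.mul {f g h k : ℝ → ℂ} (hf : IsPrimitive f g) (hh : IsPrimitive h k) :
    IsPrimitive (fun x => f x * h x) (fun x => f x * k x + g x * h x) :=
  hf.smul hh

theorem IsPrimitive.norm_sq {f g : ℝ → ℂ} (h : IsPrimitive f g) :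
    IsPrimitive (fun x => ‖f x‖ ^ 2) (fun x => 2 * (g x * starRingEnd ℂ (f x)).re) := by
  have := (h.mul h.conj).clm_comp Complex.reCLM
  convert! this using 2 with x
  · simp [Complex.mul_conj, Complex.normSq_eq_norm_sq]
    norm_cast
  · simp; ring

theorem integral_eq_intervalIntegral {g : ℝ → E} {a : ℝ} (ha : 0 ≤ a)
    (h : ∀ x, a < |x| → g x = 0) : ∫ x, g x = ∫ x in (-a)..a, g x := by
  rw [intervalIntegral.integral_of_le (by linarith), ← integral_Icc_eq_integral_Ioc,
    setIntegral_eq_integral_of_forall_compl_eq_zero]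
  intro x hx
  refine h x ?_
  by_contra! hc
  exact hx (abs_le.mp hc)

theorem exists_bound_of_hasCompactSupport {g : ℝ → E} (h : HasCompactSupport g) :
    ∃ a, 0 < a ∧ ∀ x, a ≤ |x| → g x = 0 := by
  obtain ⟨a, ha⟩ := h.isBounded.subset_closedBall 0
  refine ⟨max a 0 + 1, by positivity, fun x hx => image_eq_zero_of_notMem_tsupport fun hx' => ?_⟩
  have := ha hx'
  simp only [Metric.mem_closedBall, dist_zero_right, Real.norm_eq_abs] at this
  linarith [le_max_left a 0]

theorem IsPrimitive.integral_eq_zero {f g : ℝ → E} (h : IsPrimitive f g) {a : ℝ} (ha : 0 ≤ a)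
    (hf : ∀ x, a ≤ |x| → f x = 0) (hg : ∀ x, a < |x| → g x = 0) : ∫ x, g x = 0 := by
  rw [integral_eq_intervalIntegral ha hg, ← h.sub_eq, hf, hf, sub_zero]
  · simp [le_abs_self]
  · exact le_abs_self a

theorem isPrimitive_deriv {ψ : ℝ → E} (hψ : ContDiff ℝ ∞ ψ) : IsPrimitive ψ (deriv ψ) :=
  isPrimitive_of_hasDerivAt
    (fun x => (hψ.differentiable (by simp) x).hasDerivAt) (hψ.continuous_deriv (by simp))

theorem deriv_eq_zero_of_abs_gt {ψ : ℝ → E} {a : ℝ} (h : ∀ x, a ≤ |x| → ψ x = 0) {x : ℝ}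
    (hx : a < |x|) : deriv ψ x = 0 := by
  have : ψ =ᶠ[𝓝 x] fun _ => 0 := by
    filter_upwards [(isOpen_lt continuous_const continuous_abs).mem_nhds hx] with y hy
    exact h y (le_of_lt hy)
  rw [this.deriv_eq]; simp

/-- A primitive is a weak antiderivative. -/
theorem IsPrimitive.hasWeakDeriv {f g : ℝ → E} (h : IsPrimitive f g) : HasWeakDeriv f g := by
  refine ⟨h.continuous.locallyIntegrable, h.locallyIntegrable, fun ψ hψ hc => ?_⟩
  obtain ⟨a, ha, h0⟩ := exists_bound_of_hasCompactSupport hc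
  have hp := ((isPrimitive_deriv hψ).smul h).integral_eq_zero ha.le (fun x hx => by simp [h0 x hx])
    (fun x hx => by simp [h0 x hx.le, deriv_eq_zero_of_abs_gt h0 hx])
  rw [integral_add] at hp
  · rw [eq_neg_iff_add_eq_zero, add_comm]; exact hp
  · exact h.locallyIntegrable.integrable_smul_left_of_hasCompactSupport hψ.continuous hc
  · exact h.continuous.locallyIntegrable.integrable_smul_left_of_hasCompactSupport
      (hψ.continuous_deriv (by simp)) hc.deriv

/-! ### Weak derivatives -/

theorem HasWeakDeriv.ae_unique {f g g' : ℝ → E} (h : HasWeakDeriv f g) (h' : HasWeakDeriv f g') :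
    g =ᵐ[volume] g' :=
  ae_eq_of_integral_contDiff_smul_eq h.locallyIntegrable_deriv h'.locallyIntegrable_deriv
    fun ψ h1 h2 => by rw [← neg_inj, ← h.integral_eq ψ h1 h2, h'.integral_eq ψ h1 h2]

theorem locallyIntegrable_congr {f f' : ℝ → E} (h : LocallyIntegrable f)
    (hf : f =ᵐ[volume] f') : LocallyIntegrable f' := fun x => by
  obtain ⟨s, hs, hi⟩ := h x
  exact ⟨s, hs, hi.congr (ae_restrict_of_ae hf)⟩

theorem HasWeakDeriv.congr {f f' g g' : ℝ → E} (h : HasWeakDeriv f g) (hf : f =ᵐ[volume] f')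
    (hg : g =ᵐ[volume] g') : HasWeakDeriv f' g' := by
  refine ⟨locallyIntegrable_congr h.1 hf, locallyIntegrable_congr h.2 hg, fun ψ h1 h2 => ?_⟩
  rw [integral_congr_ae (g := fun x => deriv ψ x • f x) (hf.mono fun x hx => by simp [hx]),
    h.integral_eq ψ h1 h2,
    integral_congr_ae (g := fun x => ψ x • g' x) (hg.mono fun x hx => by simp [hx])]

theorem HasWeakDeriv.sub {f g h k : ℝ → E} (hf : HasWeakDeriv f g) (hh : HasWeakDeriv h k) :
    HasWeakDeriv (fun x => f x - h x) (fun x => g x - k x) := by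
  refine ⟨hf.1.sub hh.1, hf.2.sub hh.2, fun ψ h1 h2 => ?_⟩
  have i1 := h1.continuous_deriv (by simp)
  simp only [smul_sub]
  rw [integral_sub (hf.1.integrable_smul_left_of_hasCompactSupport i1 h2.deriv)
      (hh.1.integrable_smul_left_of_hasCompactSupport i1 h2.deriv),
    integral_sub (hf.2.integrable_smul_left_of_hasCompactSupport h1.continuous h2)
      (hh.2.integrable_smul_left_of_hasCompactSupport h1.continuous h2),
    hf.integral_eq ψ h1 h2, hh.integral_eq ψ h1 h2]
  abel

theorem exists_contDiff_integral_eq_one : ∃ η : ℝ → ℝ, ContDiff ℝ ∞ η ∧ HasCompactSupport η ∧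
    (∀ x, 1 ≤ |x| → η x = 0) ∧ ∫ x, η x = 1 := by
  let b : ContDiffBump (0 : ℝ) := ⟨1 / 2, 1, by norm_num, by norm_num⟩
  refine ⟨b.normed volume, b.contDiff_normed, b.hasCompactSupport_normed, fun x hx => ?_,
    b.integral_normed⟩
  rw [ContDiffBump.normed_def, b.zero_of_le_dist (by simpa using hx), zero_div]

/-- Integrating from `-A`, the primitive vanishes on the left trivially and on the right because the
total integral is zero. -/
theorem exists_contDiff_primitive {p : ℝ → E} {A : ℝ} (hA : 0 < A) (hp : ContDiff ℝ ∞ p)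
    (h0 : ∀ x, A ≤ |x| → p x = 0) (hi : ∫ x, p x = 0) :
    ∃ ψ : ℝ → E, ContDiff ℝ ∞ ψ ∧ (∀ x, A ≤ |x| → ψ x = 0) ∧ ∀ x, HasDerivAt ψ (p x) x := by
  have hd : ∀ x, HasDerivAt (fun x => ∫ t in (-A)..x, p t) (p x) x := fun x =>
    intervalIntegral.integral_hasDerivAt_right (hp.continuous.intervalIntegrable _ _)
      hp.continuous.stronglyMeasurable.stronglyMeasurableAtFilter hp.continuous.continuousAt
  refine ⟨fun x => ∫ t in (-A)..x, p t, ?_, fun x hx => ?_, hd⟩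
  · rw [contDiff_infty_iff_deriv, funext fun x => (hd x).deriv]
    exact ⟨fun x => (hd x).differentiableAt, hp⟩
  · rcases le_abs.mp hx with h1 | h1
    · have h2 := integral_eq_intervalIntegral hA.le (fun y hy => h0 y (le_of_lt hy))
      rw [hi] at h2
      dsimp only
      rw [← intervalIntegral.integral_add_adjacent_intervals
        (hp.continuous.intervalIntegrable (-A) A) (hp.continuous.intervalIntegrable A x), ← h2,
        zero_add, intervalIntegral.integral_congr (g := fun _ => 0), intervalIntegral.integral_zero]
      intro y hy
      rw [uIcc_of_le h1] at hy
      exact h0 y (hy.1.trans (le_abs_self y))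
    · dsimp only
      rw [intervalIntegral.integral_congr (g := fun _ => 0), intervalIntegral.integral_zero]
      intro y hy
      rw [uIcc_of_ge (by linarith)] at hy
      exact h0 y (by rw [le_abs]; right; linarith [hy.2])

/-- A function with vanishing weak derivative is constant. -/
theorem HasWeakDeriv.ae_eq_const {f : ℝ → E} (h : HasWeakDeriv f 0) :
    ∃ c, f =ᵐ[volume] fun _ => c := by
  obtain ⟨η, hη, hηc, -, hη1⟩ := exists_contDiff_integral_eq_one
  refine ⟨∫ x, η x • f x, ae_eq_of_integral_contDiff_smul_eq h.1
    continuous_const.locallyIntegrable fun ψ hψ hψc => ?_⟩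
  set m := ∫ x, ψ x with hm
  -- Removing the mean of `ψ` with a multiple of the fixed bump makes it the derivative of a test
  -- function, against which `f` integrates to zero.
  set θ : ℝ → ℝ := fun x => ψ x - m * η x with hθ
  have hθs : ContDiff ℝ ∞ θ := hψ.sub (contDiff_const.mul hη)
  obtain ⟨a, ha, ha0⟩ := exists_bound_of_hasCompactSupport hψc
  obtain ⟨b, hb, hb0⟩ := exists_bound_of_hasCompactSupport hηc
  set A := max a b
  have hA : ∀ x, A ≤ |x| → θ x = 0 := fun x hx => by
    simp [hθ, ha0 x ((le_max_left a b).trans hx), hb0 x ((le_max_right a b).trans hx)]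
  have hApos : 0 < A := lt_max_of_lt_left ha
  have hi1 : Integrable ψ := hψ.continuous.integrable_of_hasCompactSupport hψc
  have hi2 : Integrable η := hη.continuous.integrable_of_hasCompactSupport hηc
  have hθ0 : ∫ x, θ x = 0 := by
    rw [hθ, integral_sub hi1 (hi2.const_mul m), integral_const_mul, hη1]; simp [hm]
  obtain ⟨Θ, hΘs, hΘ0, hΘd⟩ := exists_contDiff_primitive hApos hθs hA hθ0
  have hΘderiv : deriv Θ = θ := funext fun x => (hΘd x).deriv
  have hΘc : HasCompactSupport Θ :=
    HasCompactSupport.intro (isCompact_Icc (a := -A) (b := A)) fun x hx =>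
      hΘ0 x (by by_contra! hc; exact hx (abs_le.mp hc.le))
  have key := h.integral_eq Θ hΘs hΘc
  rw [hΘderiv] at key
  simp only [Pi.zero_apply, smul_zero, integral_zero, neg_zero, hθ, sub_smul, mul_smul] at key
  have j1 := h.1.integrable_smul_left_of_hasCompactSupport hψ.continuous hψc
  have j2 := h.1.integrable_smul_left_of_hasCompactSupport hη.continuous hηc
  rw [integral_sub j1 (g := fun x => m • η x • f x) (j2.smul m), integral_smul,
    sub_eq_zero] at key
  rw [key, integral_smul_const]

/-- Subtracting the integral of `g` leaves a function with zero weak derivative, which is almost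
everywhere constant. -/
theorem HasWeakDeriv.exists_isPrimitive {f g : ℝ → E} (h : HasWeakDeriv f g) :
    ∃ F, IsPrimitive F g ∧ f =ᵐ[volume] F := by
  have hG := isPrimitive_intervalIntegral h.locallyIntegrable_deriv 0
  have h0 := h.sub hG.hasWeakDeriv
  simp only [sub_self] at h0
  obtain ⟨c, hc⟩ := HasWeakDeriv.ae_eq_const h0
  refine ⟨fun x => c + ∫ t in (0 : ℝ)..x, g t, ⟨hG.1, fun x y => ?_⟩, ?_⟩
  · rw [← hG.sub_eq x y]; abel
  · filter_upwards [hc] with x hx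
    rw [← hx]; abel

end Primitive

/-! ### The space `H¹(ℝ)` -/

theorem weakDeriv_hasWeakDeriv {f g : ℝ → ℂ} (h : HasWeakDeriv f g) :
    HasWeakDeriv f (weakDeriv f) := by
  have h' : ∃ g, HasWeakDeriv f g := ⟨g, h⟩
  rw [weakDeriv, dif_pos h']
  exact h'.choose_spec

theorem HasWeakDeriv.weakDeriv_ae_eq {f g : ℝ → ℂ} (h : HasWeakDeriv f g) :
    weakDeriv f =ᵐ[volume] g :=
  (weakDeriv_hasWeakDeriv h).ae_unique h

theorem weakDeriv_congr {f f' : ℝ → ℂ} (h : f =ᵐ[volume] f') :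
    weakDeriv f =ᵐ[volume] weakDeriv f' := by
  by_cases hf : ∃ g, HasWeakDeriv f g
  · obtain ⟨g, hg⟩ := hf
    exact hg.weakDeriv_ae_eq.trans
      (hg.congr h (ae_eq_refl g)).weakDeriv_ae_eq.symm
  · have hf' : ¬∃ g, HasWeakDeriv f' g := fun ⟨g, hg⟩ => hf ⟨g, hg.congr h.symm (ae_eq_refl g)⟩
    rw [weakDeriv, weakDeriv, dif_neg hf, dif_neg hf']

theorem h1Norm_congr {f f' : ℝ → ℂ} (h : f =ᵐ[volume] f') : h1Norm f = h1Norm f' := by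
  rw [h1Norm, h1Norm]
  congr 2
  · exact integral_congr_ae (h.mono fun x hx => by simp [hx])
  · exact integral_congr_ae ((weakDeriv_congr h).mono fun x hx => by simp [hx])

/-- `f` is the continuous representative of a function in `H¹(ℝ)` with derivative `g`. -/
structure IsH1Pair (f g : ℝ → ℂ) : Prop where
  prim : IsPrimitive f g
  memLp : MemLp f 2
  memLp_deriv : MemLp g 2

theorem MemH1.exists_isH1Pair {f : ℝ → ℂ} (h : MemH1 f) :
    ∃ F, IsH1Pair F (weakDeriv f) ∧ f =ᵐ[volume] F := by
  obtain ⟨h1, g, hg, hg2⟩ := h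
  obtain ⟨F, hF, hfF⟩ := (weakDeriv_hasWeakDeriv hg).exists_isPrimitive
  exact ⟨F, ⟨hF, (memLp_congr_ae hfF).mp h1, (memLp_congr_ae hg.weakDeriv_ae_eq).mpr hg2⟩, hfF⟩

theorem IsH1Pair.memH1 {f g : ℝ → ℂ} (h : IsH1Pair f g) : MemH1 f :=
  ⟨h.memLp, g, h.prim.hasWeakDeriv, h.memLp_deriv⟩

theorem IsH1Pair.sub {f g h k : ℝ → ℂ} (hf : IsH1Pair f g) (hh : IsH1Pair h k) :
    IsH1Pair (fun x => f x - h x) (fun x => g x - k x) :=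
  ⟨hf.prim.sub hh.prim, hf.memLp.sub hh.memLp, hf.memLp_deriv.sub hh.memLp_deriv⟩

theorem integrable_norm_sq {f : ℝ → ℂ} (h : MemLp f 2) : Integrable (fun x => ‖f x‖ ^ 2) :=
  h.integrable_norm_pow two_ne_zero

theorem IsH1Pair.h1Norm_sq {f g : ℝ → ℂ} (h : IsH1Pair f g) :
    h1Norm f ^ 2 = (∫ x, ‖f x‖ ^ 2) + ∫ x, ‖g x‖ ^ 2 := by
  rw [h1Norm, Real.sq_sqrt (add_nonneg (integral_nonneg fun _ => by positivity)
    (integral_nonneg fun _ => by positivity))]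
  congr 1
  exact integral_congr_ae (h.prim.hasWeakDeriv.weakDeriv_ae_eq.mono fun x hx => by simp [hx])

theorem h1Norm_nonneg (f : ℝ → ℂ) : 0 ≤ h1Norm f := Real.sqrt_nonneg _

/-- Sobolev embedding by averaging: `|f|²` varies on `[x, x + 1]` by at most `∫ 2|f||g| ≤ ∫ (|f|² +
|g|²)`, and its mean over that interval is at most `∫ |f|²`. -/
theorem IsH1Pair.norm_sq_le {f g : ℝ → ℂ} (h : IsH1Pair f g) (x : ℝ) :
    ‖f x‖ ^ 2 ≤ 2 * ((∫ y, ‖f y‖ ^ 2) + ∫ y, ‖g y‖ ^ 2) := by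
  have i1 := integrable_norm_sq h.memLp
  have i2 := integrable_norm_sq h.memLp_deriv
  have hb : ∀ y ∈ Icc x (x + 1), ‖f x‖ ^ 2 ≤
      ‖f y‖ ^ 2 + ((∫ y, ‖f y‖ ^ 2) + ∫ y, ‖g y‖ ^ 2) := by
    intro y hy
    have h1 := h.prim.norm_sq.sub_eq x y
    have h2 : ‖∫ t in x..y, 2 * (g t * starRingEnd ℂ (f t)).re‖ ≤
        ∫ t in x..y, (‖f t‖ ^ 2 + ‖g t‖ ^ 2) := by
      refine intervalIntegral.norm_integral_le_of_norm_le hy.1 ?_ (i1.add i2).intervalIntegrable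
      refine Eventually.of_forall fun t _ => ?_
      have h3 := Complex.abs_re_le_norm (g t * starRingEnd ℂ (f t))
      rw [norm_mul, RCLike.norm_conj] at h3
      rw [Real.norm_eq_abs, abs_mul, abs_two]
      nlinarith [sq_nonneg (‖f t‖ - ‖g t‖)]
    have h4 : ∫ t in x..y, (‖f t‖ ^ 2 + ‖g t‖ ^ 2) ≤ (∫ y, ‖f y‖ ^ 2) + ∫ y, ‖g y‖ ^ 2 := by
      rw [← integral_add i1 i2, intervalIntegral.integral_of_le hy.1]
      exact setIntegral_le_integral (i1.add i2) (Eventually.of_forall fun t => by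
        simp only [Pi.zero_apply]; positivity)
    rw [← h1, Real.norm_eq_abs] at h2
    have := (abs_le.mp (h2.trans h4)).1
    linarith
  have h5 : ∫ y in x..(x + 1), ‖f x‖ ^ 2 ≤
      ∫ y in x..(x + 1), (‖f y‖ ^ 2 + ((∫ y, ‖f y‖ ^ 2) + ∫ y, ‖g y‖ ^ 2)) :=
    intervalIntegral.integral_mono_on (by linarith) intervalIntegrable_const
      (i1.intervalIntegrable.add intervalIntegrable_const) hb
  rw [intervalIntegral.integral_add i1.intervalIntegrable intervalIntegrable_const] at h5
  simp only [intervalIntegral.integral_const, add_sub_cancel_left, smul_eq_mul, one_mul] at h5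
  have h6 : ∫ y in x..(x + 1), ‖f y‖ ^ 2 ≤ ∫ y, ‖f y‖ ^ 2 := by
    rw [intervalIntegral.integral_of_le (by linarith)]
    exact setIntegral_le_integral i1 (Eventually.of_forall fun t => by
      simp only [Pi.zero_apply]; positivity)
  have h7 : 0 ≤ ∫ y, ‖g y‖ ^ 2 := integral_nonneg fun _ => by positivity
  linarith

theorem IsH1Pair.norm_le {f g : ℝ → ℂ} (h : IsH1Pair f g) (x : ℝ) :
    ‖f x‖ ≤ 2 * h1Norm f := by
  have := h.norm_sq_le x
  rw [← h.h1Norm_sq] at this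
  refine abs_le_of_sq_le_sq' ?_ (by linarith [h1Norm_nonneg f]) |>.2
  nlinarith [sq_nonneg (h1Norm f)]

/-! ### The free Schrödinger group on Schwartz functions -/

open FourierTransform LineDeriv

/-- The derivative of a Schwartz function on the line. -/
noncomputable abbrev schwartzDeriv (ψ : 𝓢(ℝ, ℂ)) : 𝓢(ℝ, ℂ) := SchwartzMap.derivCLM ℂ ℂ ψ

theorem freeGroup_apply_eq (τ : ℝ) (ψ : 𝓢(ℝ, ℂ)) :
    freeGroup τ ψ = 𝓕⁻ (SchwartzMap.smulLeftCLM ℂ (freeSymbol τ) (𝓕 ψ)) := rfl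

theorem freeGroup_zero (ψ : 𝓢(ℝ, ℂ)) : freeGroup 0 ψ = ψ := by
  have : freeSymbol 0 = fun _ => (1 : ℂ) := by ext ξ; simp [freeSymbol]
  rw [freeGroup, this]
  simp

theorem freeGroup_freeGroup (s τ : ℝ) (ψ : 𝓢(ℝ, ℂ)) :
    freeGroup s (freeGroup τ ψ) = freeGroup (s + τ) ψ := by
  rw [freeGroup, freeGroup, SchwartzMap.fourierMultiplierCLM_fourierMultiplierCLM_apply
    (hasTemperateGrowth_freeSymbol s) (hasTemperateGrowth_freeSymbol τ)]
  have : freeSymbol s * freeSymbol τ = freeSymbol (s + τ) := by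
    ext ξ
    simp only [Pi.mul_apply, freeSymbol, ← Complex.exp_add]
    congr 1; push_cast; ring
  rw [this, freeGroup]

theorem norm_freeSymbol (τ ξ : ℝ) : ‖freeSymbol τ ξ‖ = 1 := by
  rw [freeSymbol, Complex.norm_exp_ofReal_mul_I]

theorem freeGroup_apply (τ : ℝ) (ψ : 𝓢(ℝ, ℂ)) (x : ℝ) :
    freeGroup τ ψ x = ∫ ξ, Complex.exp (((2 * Real.pi * (ξ * x) : ℝ) : ℂ) * Complex.I) *
      (freeSymbol τ ξ * (𝓕 ψ) ξ) := by
  rw [freeGroup_apply_eq, SchwartzMap.fourierInv_coe, Real.fourierInv_eq']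
  refine integral_congr_ae (Eventually.of_forall fun ξ => ?_)
  simp only [smul_eq_mul]
  rw [SchwartzMap.smulLeftCLM_apply_apply (hasTemperateGrowth_freeSymbol τ), smul_eq_mul]
  congr 4
  simp [mul_comm]

theorem fourier_schwartzDeriv (ψ : 𝓢(ℝ, ℂ)) (ξ : ℝ) :
    (𝓕 (schwartzDeriv ψ)) ξ = 2 * Real.pi * Complex.I * ξ * (𝓕 ψ) ξ := by
  have : schwartzDeriv ψ = ∂_{(1 : ℝ)} ψ := by
    ext x
    rw [SchwartzMap.lineDerivOp_apply_eq_fderiv]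
    simp [schwartzDeriv]
  rw [this, SchwartzMap.fourier_lineDerivOp_eq]
  rw [_root_.smul_apply, SchwartzMap.smulLeftCLM_apply_apply (by fun_prop)]
  simp; ring

/-- Differentiation under the integral: the exponentials are unimodular, so `‖k‖` dominates the
derivative for all times. In the application `k` is the Fourier transform of a second derivative. -/
theorem hasDerivAt_integral_freeSymbol {f k : ℝ → ℂ} (hf : Continuous f) (hk : Continuous k)
    (hfi : Integrable f) (hki : Integrable k)
    (hfk : ∀ ξ : ℝ, k ξ = -(4 * Real.pi ^ 2 * ξ ^ 2) * f ξ) (x τ : ℝ) :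
    HasDerivAt (fun τ => ∫ ξ, Complex.exp (((2 * Real.pi * (ξ * x) : ℝ) : ℂ) * Complex.I) *
      (freeSymbol τ ξ * f ξ))
      (Complex.I * ∫ ξ, Complex.exp (((2 * Real.pi * (ξ * x) : ℝ) : ℂ) * Complex.I) *
        (freeSymbol τ ξ * k ξ)) τ := by
  have hm {f : ℝ → ℂ} (hf : Continuous f) (τ : ℝ) : AEStronglyMeasurable (fun ξ : ℝ =>
      Complex.exp (((2 * Real.pi * (ξ * x) : ℝ) : ℂ) * Complex.I) * (freeSymbol τ ξ * f ξ)) := by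
    have := (hasTemperateGrowth_freeSymbol τ).1.continuous
    exact Continuous.aestronglyMeasurable (by fun_prop)
  have hn (f : ℝ → ℂ) (τ ξ : ℝ) : ‖Complex.exp (((2 * Real.pi * (ξ * x) : ℝ) : ℂ) * Complex.I) *
      (freeSymbol τ ξ * f ξ)‖ = ‖f ξ‖ := by
    rw [norm_mul, norm_mul, norm_freeSymbol, Complex.norm_exp_ofReal_mul_I]; simp
  rw [← integral_const_mul]
  refine (hasDerivAt_integral_of_dominated_loc_of_deriv_le (μ := volume) (𝕜 := ℝ)
    (F' := fun τ ξ => Complex.I * (Complex.exp (((2 * Real.pi * (ξ * x) : ℝ) : ℂ) * Complex.I) *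
      (freeSymbol τ ξ * k ξ)))
    (bound := fun ξ => ‖k ξ‖) univ_mem (Eventually.of_forall fun τ => hm hf τ) ?_
    ((hm hk τ).const_mul _) ?_ hki.norm ?_).2
  · exact hfi.norm.mono' (hm hf τ) (Eventually.of_forall fun ξ => (hn f τ ξ).le)
  · refine Eventually.of_forall fun ξ τ _ => ?_
    rw [norm_mul, hn, Complex.norm_I, one_mul]
  · refine Eventually.of_forall fun ξ τ _ => ?_
    have h1 : HasDerivAt (fun τ : ℝ => (((-(4 * Real.pi ^ 2 * τ) * ξ ^ 2 : ℝ) : ℂ) * Complex.I))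
        (((-(4 * Real.pi ^ 2 * 1) * ξ ^ 2 : ℝ) : ℂ) * Complex.I) τ := by
      refine HasDerivAt.mul_const ?_ _
      exact ((((hasDerivAt_id τ).const_mul (4 * Real.pi ^ 2)).neg).mul_const _).ofReal_comp
    have h2 := ((h1.cexp).mul_const (f ξ)).const_mul
      (Complex.exp (((2 * Real.pi * (ξ * x) : ℝ) : ℂ) * Complex.I))
    convert! h2 using 1
    rw [hfk, freeSymbol]
    push_cast
    ring

theorem hasDerivAt_freeGroup (ψ : 𝓢(ℝ, ℂ)) (x τ : ℝ) :
    HasDerivAt (fun τ => freeGroup τ ψ x)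
      (Complex.I * freeGroup τ (schwartzDeriv (schwartzDeriv ψ)) x) τ := by
  simp only [freeGroup_apply]
  refine hasDerivAt_integral_freeSymbol (𝓕 ψ).continuous
    (𝓕 (schwartzDeriv (schwartzDeriv ψ))).continuous (𝓕 ψ).integrable
    (𝓕 (schwartzDeriv (schwartzDeriv ψ))).integrable (fun ξ => ?_) x τ
  rw [fourier_schwartzDeriv, fourier_schwartzDeriv]
  linear_combination (4 * Real.pi ^ 2 * ξ ^ 2 * (𝓕 ψ) ξ) * Complex.I_sq

/-- Multiplication of a Schwartz function by the coordinate. -/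
noncomputable abbrev schwartzMulX (ψ : 𝓢(ℝ, ℂ)) : 𝓢(ℝ, ℂ) :=
  SchwartzMap.smulLeftCLM ℂ (fun x : ℝ => inner ℝ x (1 : ℝ)) ψ

/-- The commutation `x e^{iτ∂ₓ²} = e^{iτ∂ₓ²}(x - 2iτ∂ₓ)`. On the Fourier side multiplication by `x`
is a derivative in `ξ`; the part falling on the symbol produces the term linear in `τ`. It trades
powers of `x` for operations on `ψ`, so decay is uniform for bounded `τ`. -/
theorem mul_freeGroup (ψ : 𝓢(ℝ, ℂ)) (τ x : ℝ) :
    x * freeGroup τ ψ x =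
      freeGroup τ (schwartzMulX ψ) x - 2 * Complex.I * τ * freeGroup τ (schwartzDeriv ψ) x := by
  set h : 𝓢(ℝ, ℂ) := SchwartzMap.smulLeftCLM ℂ (freeSymbol τ) (𝓕 ψ) with hh
  have h1 : ∂_{(1 : ℝ)} h = -(4 * Real.pi * τ : ℂ) •
      SchwartzMap.smulLeftCLM ℂ (freeSymbol τ) (𝓕 (schwartzDeriv ψ)) +
      -(2 * Real.pi * Complex.I) •
        SchwartzMap.smulLeftCLM ℂ (freeSymbol τ) (𝓕 (schwartzMulX ψ)) := by
    ext ξ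
    have e1 : 𝓕 (schwartzMulX ψ) = 𝓕 (SchwartzMap.smulLeftCLM ℂ (inner ℝ · (1 : ℝ)) ψ) := rfl
    have e2 := congrArg (fun f : 𝓢(ℝ, ℂ) => f ξ) (SchwartzMap.lineDerivOp_fourier_eq ψ (1 : ℝ))
    rw [FourierTransform.fourier_smul] at e2
    simp only [_root_.smul_apply, smul_eq_mul,
      SchwartzMap.lineDerivOp_apply_eq_fderiv] at e2
    rw [fderiv_apply_one_eq_deriv] at e2
    have e3 := (𝓕 ψ : 𝓢(ℝ, ℂ)).hasDerivAt ξ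
    have e4 : HasDerivAt (freeSymbol τ) (Complex.exp (((-(4 * Real.pi ^ 2 * τ) * ξ ^ 2 : ℝ) : ℂ) *
        Complex.I) * (((-(4 * Real.pi ^ 2 * τ) * (2 * ξ) : ℝ) : ℂ) * Complex.I)) ξ := by
      refine HasDerivAt.cexp (HasDerivAt.mul_const ?_ _)
      have := ((hasDerivAt_pow 2 ξ).const_mul (-(4 * Real.pi ^ 2 * τ))).ofReal_comp
      simpa using this
    have e5 : (h : ℝ → ℂ) = fun ξ => freeSymbol τ ξ * (𝓕 ψ) ξ := by
      ext ξ
      rw [hh, SchwartzMap.smulLeftCLM_apply_apply (hasTemperateGrowth_freeSymbol τ), smul_eq_mul]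
    rw [SchwartzMap.lineDerivOp_apply_eq_fderiv, fderiv_apply_one_eq_deriv, e5,
      (e4.fun_mul e3).deriv, e2]
    simp only [_root_.add_apply, _root_.smul_apply, smul_eq_mul,
      SchwartzMap.smulLeftCLM_apply_apply (hasTemperateGrowth_freeSymbol τ), fourier_schwartzDeriv,
      e1]
    rw [freeSymbol]
    push_cast
    ring
  have h2 := SchwartzMap.fourierInv_lineDerivOp_eq h (1 : ℝ)
  rw [h1, FourierTransform.fourierInv_add, FourierTransform.fourierInv_smul,
    FourierTransform.fourierInv_smul, ← freeGroup_apply_eq, ← freeGroup_apply_eq, hh,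
    ← freeGroup_apply_eq] at h2
  have h3 := congrArg (fun f : 𝓢(ℝ, ℂ) => f x) h2
  simp only [_root_.add_apply, _root_.smul_apply, smul_eq_mul] at h3
  rw [SchwartzMap.smulLeftCLM_apply_apply (by fun_prop)] at h3
  simp only [RCLike.inner_apply, conj_trivial, one_mul, Complex.real_smul] at h3
  have hpi : (2 * Real.pi * Complex.I : ℂ) ≠ 0 := by
    simp [Real.pi_ne_zero]
  apply mul_left_cancel₀ hpi
  linear_combination h3 + 4 * Real.pi * τ * freeGroup τ (schwartzDeriv ψ) x * Complex.I_sq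

theorem exists_pow_mul_freeGroup_le (k : ℕ) (ψ : 𝓢(ℝ, ℂ)) :
    ∃ C, ∀ τ x : ℝ, |τ| ≤ 1 → |x| ^ k * ‖freeGroup τ ψ x‖ ≤ C := by
  induction k generalizing ψ with
  -- Without weight, the `L¹` norm of the Fourier transform bounds the function for every `τ`.
  | zero =>
    refine ⟨∫ ξ, ‖(𝓕 ψ) ξ‖, fun τ x _ => ?_⟩
    rw [pow_zero, one_mul, freeGroup_apply]
    refine (norm_integral_le_integral_norm _).trans_eq (integral_congr_ae
      (Eventually.of_forall fun ξ => ?_))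
    dsimp only
    rw [norm_mul, norm_mul, norm_freeSymbol, Complex.norm_exp_ofReal_mul_I]; simp
  | succ k ih =>
    obtain ⟨C₁, h₁⟩ := ih (schwartzMulX ψ)
    obtain ⟨C₂, h₂⟩ := ih (schwartzDeriv ψ)
    refine ⟨C₁ + 2 * C₂, fun τ x hτ => ?_⟩
    have hn : |x| * ‖freeGroup τ ψ x‖ ≤ ‖freeGroup τ (schwartzMulX ψ) x‖ +
        2 * ‖freeGroup τ (schwartzDeriv ψ) x‖ := by
      have := congrArg norm (mul_freeGroup ψ τ x)
      rw [norm_mul, Complex.norm_real, Real.norm_eq_abs] at this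
      rw [this]
      refine (norm_sub_le _ _).trans ?_
      simp only [norm_mul, Complex.norm_I, Complex.norm_real, Real.norm_eq_abs, mul_one,
        Complex.norm_ofNat]
      nlinarith [norm_nonneg (freeGroup τ (schwartzDeriv ψ) x)]
    calc |x| ^ (k + 1) * ‖freeGroup τ ψ x‖ = |x| ^ k * (|x| * ‖freeGroup τ ψ x‖) := by ring
      _ ≤ |x| ^ k * (‖freeGroup τ (schwartzMulX ψ) x‖ +
        2 * ‖freeGroup τ (schwartzDeriv ψ) x‖) := by gcongr
      _ = |x| ^ k * ‖freeGroup τ (schwartzMulX ψ) x‖ +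
        2 * (|x| ^ k * ‖freeGroup τ (schwartzDeriv ψ) x‖) := by ring
      _ ≤ _ := by linarith [h₁ τ x hτ, h₂ τ x hτ]

/-- The decay weight used to dominate evolved Schwartz functions. -/
noncomputable def decay (x : ℝ) : ℝ := ((1 + x ^ 2) ^ 2)⁻¹

theorem decay_pos (x : ℝ) : 0 < decay x := by unfold decay; positivity

theorem exists_norm_freeGroup_le (ψ : 𝓢(ℝ, ℂ)) :
    ∃ C, 0 ≤ C ∧ ∀ τ x : ℝ, |τ| ≤ 1 → ‖freeGroup τ ψ x‖ ≤ C * decay x := by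
  obtain ⟨C₀, h₀⟩ := exists_pow_mul_freeGroup_le 0 ψ
  obtain ⟨C₄, h₄⟩ := exists_pow_mul_freeGroup_le 4 ψ
  -- The constant comes from `(1 + x²)² ≤ 2 + 2x⁴`.
  have hb : ∀ τ x : ℝ, |τ| ≤ 1 → ‖freeGroup τ ψ x‖ ≤ (2 * C₀ + 2 * C₄) * decay x := by
    intro τ x hτ
    have a₀ := h₀ τ x hτ
    have a₄ := h₄ τ x hτ
    rw [decay, ← div_eq_mul_inv, le_div_iff₀ (by positivity)]
    have e : |x| ^ 4 = x ^ 4 := by rw [Even.pow_abs (by decide)]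
    rw [e] at a₄
    nlinarith [norm_nonneg (freeGroup τ ψ x), sq_nonneg (1 - x ^ 2),
      mul_nonneg (norm_nonneg (freeGroup τ ψ x)) (sq_nonneg (1 - x ^ 2))]
  refine ⟨2 * C₀ + 2 * C₄, ?_, hb⟩
  have := (norm_nonneg _).trans (hb 0 0 (by simp))
  simpa [decay] using this

theorem exists_norm_freeGroup_sub_le (ψ : 𝓢(ℝ, ℂ)) :
    ∃ C, 0 ≤ C ∧ ∀ τ x : ℝ, |τ| ≤ 1 → ‖freeGroup τ ψ x - ψ x‖ ≤ C * |τ| * decay x := by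
  obtain ⟨C, hC, h⟩ := exists_norm_freeGroup_le (schwartzDeriv (schwartzDeriv ψ))
  refine ⟨C, hC, fun τ x hτ => ?_⟩
  have := (convex_Icc (-1 : ℝ) 1).norm_image_sub_le_of_norm_hasDerivWithin_le (C := C * decay x)
    (fun t _ => (hasDerivAt_freeGroup ψ x t).hasDerivWithinAt)
    (fun t ht => by
      rw [norm_mul, Complex.norm_I, one_mul]; exact h t x (abs_le.mpr ht))
    (show (0 : ℝ) ∈ Icc (-1) 1 by simp) (abs_le.mp hτ)
  rw [freeGroup_zero, sub_zero, Real.norm_eq_abs] at this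
  linarith

/-- Mean value inequality for the Taylor remainder: its time derivative is `i(e^{it∂ₓ²}ψ'' - ψ'')`,
which the first-order estimate bounds by a multiple of `|t|`. -/
theorem exists_norm_freeGroup_sub_sub_le (ψ : 𝓢(ℝ, ℂ)) :
    ∃ C, 0 ≤ C ∧ ∀ τ x : ℝ, |τ| ≤ 1 →
      ‖freeGroup τ ψ x - ψ x - τ * (Complex.I * schwartzDeriv (schwartzDeriv ψ) x)‖ ≤
        C * |τ| ^ 2 * decay x := by
  obtain ⟨C, hC, h⟩ := exists_norm_freeGroup_sub_le (schwartzDeriv (schwartzDeriv ψ))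
  refine ⟨C, hC, fun τ x hτ => ?_⟩
  have hd (t : ℝ) : HasDerivAt (fun t : ℝ => freeGroup t ψ x -
      t * (Complex.I * schwartzDeriv (schwartzDeriv ψ) x))
      (Complex.I * (freeGroup t (schwartzDeriv (schwartzDeriv ψ)) x -
        schwartzDeriv (schwartzDeriv ψ) x)) t := by
    have := (hasDerivAt_freeGroup ψ x t).sub ((hasDerivAt_id t).ofReal_comp.mul_const
      (Complex.I * schwartzDeriv (schwartzDeriv ψ) x))
    convert! this using 1
    simp; ring
  have := (convex_Icc (-|τ|) |τ|).norm_image_sub_le_of_norm_hasDerivWithin_le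
    (C := C * |τ| * decay x) (fun t _ => (hd t).hasDerivWithinAt)
    (fun t ht => by
      rw [norm_mul, Complex.norm_I, one_mul]
      have ht' : |t| ≤ |τ| := abs_le.mpr ht
      refine (h t x (ht'.trans hτ)).trans ?_
      have := (decay_pos x).le
      gcongr)
    (show (0 : ℝ) ∈ Icc (-|τ|) |τ| by simp) (⟨neg_abs_le τ, le_abs_self τ⟩)
  rw [freeGroup_zero, sub_zero, Real.norm_eq_abs] at this
  calc _ = _ := by congr 1; simp; ring
    _ ≤ _ := this
    _ = _ := by ring

/-! ### The cut-off profile -/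

/-- If the values differed at `x`, they would differ on a one-sided interval, which has positive
measure. Continuity from one side suffices. This identifies `ζ` pointwise with its continuous
representative. -/
theorem eq_of_ae_eq_of_continuousWithinAt {f F : ℝ → ℝ} (hF : Continuous F)
    (h : f =ᵐ[volume] F) {x : ℝ}
    (hf : ContinuousWithinAt f (Ioi x) x ∨ ContinuousWithinAt f (Iio x) x) : f x = F x := by
  by_contra hne
  have hnull : volume {y | f y ≠ F y} = 0 := h
  rcases hf with hf | hf
  · have h1 : ∀ᶠ y in 𝓝[>] x, f y ≠ F y :=
      ((hf.tendsto.sub hF.continuousWithinAt.tendsto).eventually_ne (sub_ne_zero.mpr hne)).mono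
        fun y hy => sub_ne_zero.mp hy
    obtain ⟨u, hu, hs⟩ := mem_nhdsGT_iff_exists_Ioo_subset.mp h1
    have := measure_mono_null hs hnull
    rw [Real.volume_Ioo, ENNReal.ofReal_eq_zero] at this
    linarith [mem_Ioi.mp hu]
  · have h1 : ∀ᶠ y in 𝓝[<] x, f y ≠ F y :=
      ((hf.tendsto.sub hF.continuousWithinAt.tendsto).eventually_ne (sub_ne_zero.mpr hne)).mono
        fun y hy => sub_ne_zero.mp hy
    obtain ⟨u, hu, hs⟩ := mem_nhdsLT_iff_exists_Ioo_subset.mp h1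
    have := measure_mono_null hs hnull
    rw [Real.volume_Ioo, ENNReal.ofReal_eq_zero] at this
    linarith [mem_Iio.mp hu]

theorem inv_sqrt_three_pos : 0 < 1 / √3 := by positivity

theorem inv_sqrt_three_lt_one : 1 / √3 < 1 := by
  rw [div_lt_one (by positivity)]
  exact Real.lt_sqrt_of_sq_lt (by norm_num)

theorem inv_sqrt_three_sq : (1 / √3) ^ 2 = 1 / 3 := by
  rw [div_pow, Real.sq_sqrt (by norm_num)]; norm_num

section Cutoff

variable {ζ : ℝ → ℝ}

theorem IsCutoffProfile.eq_of_ae_eq_of_nonneg (hζ : IsCutoffProfile ζ) {F : ℝ → ℝ}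
    (hF : Continuous F) (h : ζ =ᵐ[volume] F) {x : ℝ} (hx : 0 ≤ x) : ζ x = F x := by
  refine eq_of_ae_eq_of_continuousWithinAt hF h ?_
  have h3 := inv_sqrt_three_pos
  have h3' := inv_sqrt_three_lt_one
  rcases lt_or_ge x 1 with h1 | h1
  · left
    have : ContinuousWithinAt (fun y : ℝ => 2 * y) (Ioi x) x := by fun_prop
    refine this.congr_of_eventuallyEq ?_ (hζ.eq_linear x (by rw [abs_of_nonneg hx]; exact h1.le))
    filter_upwards [Ioo_mem_nhdsGT h1] with y hy
    exact hζ.eq_linear y (by rw [abs_of_nonneg (hx.trans hy.1.le)]; exact hy.2.le)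
  rcases lt_or_ge x (1 + 1 / √3) with h2 | h2
  · left
    have : ContinuousWithinAt (fun y : ℝ => 2 * (y - (y - 1) ^ 3)) (Ioi x) x := by fun_prop
    refine this.congr_of_eventuallyEq ?_ (hζ.eq_pos x h1 h2.le)
    filter_upwards [Ioo_mem_nhdsGT h2] with y hy
    exact hζ.eq_pos y (h1.trans hy.1.le) hy.2.le
  rcases h2.eq_or_lt with h2 | h2
  -- At `1 + 1/√3` the explicit formula is available only from the left.
  · right
    have : ContinuousWithinAt (fun y : ℝ => 2 * (y - (y - 1) ^ 3)) (Iio x) x := by fun_prop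
    refine this.congr_of_eventuallyEq ?_ (hζ.eq_pos x h1 h2.ge)
    filter_upwards [Ioo_mem_nhdsLT (show 1 < x by linarith)] with y hy
    exact hζ.eq_pos y hy.1.le (by linarith [hy.2])
  rcases lt_or_ge x 2 with h4 | h4
  · left
    -- A negative `deriv` is not the default value `0`, so `ζ` is differentiable, hence continuous,
    -- at `x`.
    have := hζ.deriv_neg x (by rwa [abs_of_nonneg hx]) (by rwa [abs_of_nonneg hx])
    exact (differentiableAt_of_deriv_ne_zero this.ne).continuousAt.continuousWithinAt
  · left
    have : ContinuousWithinAt (fun _ : ℝ => (0 : ℝ)) (Ioi x) x := by fun_prop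
    refine this.congr_of_eventuallyEq ?_ (hζ.eq_zero x (by rwa [abs_of_nonneg hx]))
    filter_upwards [self_mem_nhdsWithin] with y hy
    exact hζ.eq_zero y (h4.trans ((mem_Ioi.mp hy).le.trans (le_abs_self y)))

theorem quasiMeasurePreserving_of_volume_preimage {φ : ℝ → ℝ} (hφ : Measurable φ)
    (h : ∀ s : Set ℝ, volume s = 0 → volume (φ ⁻¹' s) = 0) :
    Measure.QuasiMeasurePreserving φ volume volume :=
  ⟨hφ, Measure.AbsolutelyContinuous.mk fun s hs h0 => by rw [Measure.map_apply hφ hs]; exact h s h0⟩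

theorem IsCutoffProfile.eq_of_ae_eq (hζ : IsCutoffProfile ζ) {F : ℝ → ℝ}
    (hF : Continuous F) (h : ζ =ᵐ[volume] F) : ζ = F := by
  ext x
  rcases le_or_gt 0 x with hx | hx
  · exact hζ.eq_of_ae_eq_of_nonneg hF h hx
  · have h' : ζ =ᵐ[volume] fun y => -F (-y) := by
      have := (Measure.measurePreserving_neg (volume : Measure ℝ)).quasiMeasurePreserving.ae_eq h
      filter_upwards [this] with y hy
      simp only [Function.comp_apply] at hy
      rw [← hy, hζ.odd, neg_neg]
    have := hζ.eq_of_ae_eq_of_nonneg (F := fun y => -F (-y)) (by fun_prop) h'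
      (show 0 ≤ -x by linarith)
    rw [hζ.odd, neg_neg, neg_inj] at this
    exact this

theorem IsCutoffProfile.isPrimitive (hζ : IsCutoffProfile ζ) {ζ₁ : ℝ → ℝ}
    (h : HasWeakDeriv ζ ζ₁) : IsPrimitive ζ ζ₁ := by
  obtain ⟨F, hF, hae⟩ := h.exists_isPrimitive
  rwa [hζ.eq_of_ae_eq hF.continuous hae]

theorem IsCutoffProfile.continuous (hζ : IsCutoffProfile ζ) : Continuous ζ := by
  obtain ⟨ζ₁, ζ₂, ζ₃, h⟩ := hζ.memW3Inf
  exact (hζ.isPrimitive h.deriv₁).continuous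

theorem IsCutoffProfile.nonneg (hζ : IsCutoffProfile ζ) {s : ℝ} (hs : 0 ≤ s) : 0 ≤ ζ s := by
  have h3 := inv_sqrt_three_pos
  have h3' := inv_sqrt_three_lt_one
  rcases le_or_gt s 1 with h1 | h1
  · rw [hζ.eq_linear s (by rwa [abs_of_nonneg hs])]; linarith
  rcases le_or_gt s (1 + 1 / √3) with h2 | h2
  · rw [hζ.eq_pos s h1.le h2]
    have : (s - 1) ^ 3 ≤ 1 := pow_le_one₀ (by linarith) (by linarith)
    linarith
  rcases le_or_gt 2 s with h4 | h4
  · rw [hζ.eq_zero s (by rwa [abs_of_nonneg hs])]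
  -- On the last piece `ζ` decreases to `ζ 2 = 0`, so it is positive before.
  · have hanti : StrictAntiOn ζ (Icc (1 + 1 / √3) 2) := by
      refine strictAntiOn_of_deriv_neg (convex_Icc _ _) hζ.continuous.continuousOn fun x hx => ?_
      rw [interior_Icc] at hx
      have hx0 : 0 ≤ x := by linarith [hx.1]
      exact hζ.deriv_neg x (by rw [abs_of_nonneg hx0]; exact hx.1)
        (by rw [abs_of_nonneg hx0]; exact hx.2)
    have := hanti ⟨h2.le, h4.le⟩ (right_mem_Icc.mpr (by linarith)) h4
    rw [hζ.eq_zero 2 (by norm_num)] at this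
    exact this.le

/-- The Lipschitz function comparable with `√(2 - ζ')`. -/
noncomputable def ramp (s : ℝ) : ℝ := min (max (|s| - 1) 0) 1

theorem ramp_nonneg (s : ℝ) : 0 ≤ ramp s := le_min (le_max_right _ _) zero_le_one

theorem ramp_le_one (s : ℝ) : ramp s ≤ 1 := min_le_right _ _

theorem ramp_eq_zero {s : ℝ} (h : |s| ≤ 1) : ramp s = 0 := by
  rw [ramp, max_eq_right (by linarith), min_eq_left zero_le_one]

theorem lipschitzWith_ramp : LipschitzWith 1 ramp := by
  have h1 : LipschitzWith 1 (fun s : ℝ => |s| - 1) := by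
    refine LipschitzWith.of_dist_le_mul fun x y => ?_
    rw [Real.dist_eq, Real.dist_eq, NNReal.coe_one, one_mul, sub_sub_sub_cancel_right]
    exact abs_abs_sub_abs_le x y
  exact (h1.max_const 0).min_const 1

theorem ramp_sq_le_of_hasDerivAt (hζ : IsCutoffProfile ζ) {s d K : ℝ} (hK : 0 ≤ K) (hd : -K ≤ d)
    (h : HasDerivAt ζ d s) (hs : 0 ≤ s) (h1 : s ≠ 1) (h2 : s ≠ 1 + 1 / √3) (h4 : s ≠ 2) :
    ramp s ^ 2 ≤ 2 - d ∧ 2 - d ≤ (6 + 3 * K) * ramp s ^ 2 := by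
  have h3 := inv_sqrt_three_pos
  have h3' := inv_sqrt_three_lt_one
  have h3s := inv_sqrt_three_sq
  rcases h1.lt_or_gt with h1 | h1
  · have : d = 2 := by
      refine h.unique ?_
      have h5 : HasDerivAt (fun y : ℝ => 2 * y) 2 s := by
        simpa using (hasDerivAt_id s).const_mul 2
      refine h5.congr_of_eventuallyEq ?_
      filter_upwards [Ioo_mem_nhds (show -1 < s by linarith) h1] with y hy
      exact hζ.eq_linear y (abs_le.mpr ⟨hy.1.le, hy.2.le⟩)
    rw [this, ramp_eq_zero (by rw [abs_of_nonneg hs]; exact h1.le)]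
    norm_num
  rcases h2.lt_or_gt with h2 | h2
  · have : d = 2 * (1 - 3 * (s - 1) ^ 2) := by
      refine h.unique ?_
      have h5 : HasDerivAt (fun y : ℝ => 2 * (y - (y - 1) ^ 3)) (2 * (1 - 3 * (s - 1) ^ 2)) s := by
        have := ((hasDerivAt_id s).sub (((hasDerivAt_id s).sub_const 1).pow 3)).const_mul 2
        convert! this using 1
        simp
      refine h5.congr_of_eventuallyEq ?_
      filter_upwards [Ioo_mem_nhds h1 h2] with y hy
      exact hζ.eq_pos y hy.1.le hy.2.le
    have hr : ramp s = s - 1 := by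
      rw [ramp, abs_of_nonneg hs, max_eq_left (by linarith), min_eq_left (by linarith)]
    rw [this, hr]
    constructor <;> nlinarith [sq_nonneg (s - 1), mul_nonneg hK (sq_nonneg (s - 1))]
  · have hd0 : d ≤ 0 := by
      rcases h4.lt_or_gt with h4 | h4
      · rw [← h.deriv]
        exact (hζ.deriv_neg s (by rwa [abs_of_nonneg hs]) (by rwa [abs_of_nonneg hs])).le
      · refine (h.unique ?_).le
        refine (hasDerivAt_const s (0 : ℝ)).congr_of_eventuallyEq ?_
        filter_upwards [Ioi_mem_nhds h4] with y hy
        exact hζ.eq_zero y ((mem_Ioi.mp hy).le.trans (le_abs_self y))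
    have hr : 1 / √3 ≤ ramp s := by
      rw [ramp, abs_of_nonneg hs]
      exact le_min (le_max_of_le_left (by linarith)) h3'.le
    have hr2 : 1 / 3 ≤ ramp s ^ 2 := by rw [← h3s]; gcongr
    have hr1 : ramp s ^ 2 ≤ 1 := pow_le_one₀ (ramp_nonneg s) (ramp_le_one s)
    constructor
    · linarith
    · nlinarith

theorem IsCutoffProfile.exists_ramp_sq_le (hζ : IsCutoffProfile ζ) {ζ₁ : ℝ → ℝ}
    (h : HasWeakDeriv ζ ζ₁) (hb : MemLp ζ₁ ∞) :
    ∃ B, 0 < B ∧ ∀ᵐ s, ramp s ^ 2 ≤ 2 - ζ₁ s ∧ 2 - ζ₁ s ≤ B * ramp s ^ 2 := by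
  obtain ⟨K, hK⟩ : ∃ K : ℝ, ∀ᵐ s, ‖ζ₁ s‖ ≤ K := by
    refine ⟨(eLpNormEssSup ζ₁ volume).toReal, ?_⟩
    filter_upwards [enorm_ae_le_eLpNormEssSup ζ₁ volume] with s hs
    rw [← toReal_enorm]
    exact ENNReal.toReal_mono (by
      have := hb.eLpNorm_ne_top; rwa [eLpNorm_exponent_top] at this) hs
  refine ⟨6 + 3 * |K|, by positivity, ?_⟩
  have hne : ∀ a : ℝ, ∀ᵐ s : ℝ, s ≠ a := fun a => by
    simp [ae_iff, measure_singleton]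
  filter_upwards [hK, (hζ.isPrimitive h).ae_hasDerivAt, hne 1, hne (1 + 1 / √3), hne 2, hne (-1),
    hne (-(1 + 1 / √3)), hne (-2)] with s hs hd h1 h2 h3 h4 h5 h6
  have hd' : -|K| ≤ ζ₁ s := by
    rw [Real.norm_eq_abs] at hs
    linarith [neg_abs_le (ζ₁ s), le_abs_self K]
  rcases le_or_gt 0 s with h0 | h0
  · exact ramp_sq_le_of_hasDerivAt hζ (abs_nonneg K) hd' hd h0 h1 h2 h3
  · have hd2 : HasDerivAt ζ (ζ₁ s) (-s) := by
      have h7 : HasDerivAt (fun y => ζ (-y)) (ζ₁ s * -1) (-s) :=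
        HasDerivAt.comp (-s) (by rwa [neg_neg]) (hasDerivAt_neg (-s))
      have h8 := h7.neg
      convert! h8 using 1
      · ext y; simp [hζ.odd]
      · ring
    have := ramp_sq_le_of_hasDerivAt hζ (abs_nonneg K) hd' hd2 (by linarith)
      (fun h => h4 (by linarith)) (fun h => h5 (by linarith)) (fun h => h6 (by linarith))
    have e : ramp (-s) = ramp s := by rw [ramp, abs_neg, ramp]
    rwa [e] at this

theorem IsCutoffProfile.hasDerivAt_cutoffWeight (hζ : IsCutoffProfile ζ) (x : ℝ) :
    HasDerivAt (cutoffWeight ζ) (ζ x) x :=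
  intervalIntegral.integral_hasDerivAt_right (hζ.continuous.intervalIntegrable _ _)
    hζ.continuous.stronglyMeasurable.stronglyMeasurableAtFilter hζ.continuous.continuousAt

theorem IsCutoffProfile.cutoffWeight_neg (hζ : IsCutoffProfile ζ) (x : ℝ) :
    cutoffWeight ζ (-x) = cutoffWeight ζ x := by
  have := intervalIntegral.integral_comp_neg (a := 0) (b := x) ζ
  simp only [hζ.odd, intervalIntegral.integral_neg, neg_zero] at this
  rw [cutoffWeight, cutoffWeight, intervalIntegral.integral_symm, ← this, neg_neg]

theorem IsCutoffProfile.cutoffWeight_abs (hζ : IsCutoffProfile ζ) (x : ℝ) :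
    cutoffWeight ζ |x| = cutoffWeight ζ x := by
  rcases abs_choice x with h | h <;> rw [h]
  exact hζ.cutoffWeight_neg x

theorem IsCutoffProfile.cutoffWeight_monotoneOn (hζ : IsCutoffProfile ζ) :
    MonotoneOn (cutoffWeight ζ) (Ici 0) := by
  refine monotoneOn_of_deriv_nonneg (convex_Ici 0)
    (fun x _ => (hζ.hasDerivAt_cutoffWeight x).continuousAt.continuousWithinAt)
    (fun x _ => (hζ.hasDerivAt_cutoffWeight x).differentiableAt.differentiableWithinAt)
    fun x hx => ?_
  rw [interior_Ici] at hx
  rw [(hζ.hasDerivAt_cutoffWeight x).deriv]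
  exact hζ.nonneg (le_of_lt hx)

theorem cutoffWeight_zero (ζ : ℝ → ℝ) : cutoffWeight ζ 0 = 0 := by simp [cutoffWeight]

theorem IsCutoffProfile.cutoffWeight_nonneg (hζ : IsCutoffProfile ζ) (x : ℝ) :
    0 ≤ cutoffWeight ζ x := by
  rw [← hζ.cutoffWeight_abs, ← cutoffWeight_zero ζ]
  exact hζ.cutoffWeight_monotoneOn self_mem_Ici (abs_nonneg x) (abs_nonneg x)

theorem IsCutoffProfile.one_le_cutoffWeight (hζ : IsCutoffProfile ζ) {x : ℝ} (hx : 1 ≤ |x|) :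
    1 ≤ cutoffWeight ζ x := by
  have h1 : cutoffWeight ζ 1 = 1 := by
    rw [cutoffWeight, intervalIntegral.integral_congr (g := fun s => 2 * s)]
    · rw [intervalIntegral.integral_const_mul, integral_id]; norm_num
    · intro s hs
      rw [uIcc_of_le zero_le_one] at hs
      exact hζ.eq_linear s (by rw [abs_of_nonneg hs.1]; exact hs.2)
  rw [← hζ.cutoffWeight_abs, ← h1]
  exact hζ.cutoffWeight_monotoneOn (mem_Ici.mpr zero_le_one) (abs_nonneg x) hx

theorem IsCutoffProfile.cutoffWeight_eq (hζ : IsCutoffProfile ζ) {x : ℝ} (hx : 2 ≤ |x|) :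
    cutoffWeight ζ x = cutoffWeight ζ 2 := by
  rw [← hζ.cutoffWeight_abs x, cutoffWeight, cutoffWeight,
    ← intervalIntegral.integral_add_adjacent_intervals (b := 2)
    (hζ.continuous.intervalIntegrable _ _) (hζ.continuous.intervalIntegrable _ _),
    intervalIntegral.integral_congr (a := 2) (g := fun _ => 0), intervalIntegral.integral_zero,
    add_zero]
  intro s hs
  rw [uIcc_of_le hx] at hs
  exact hζ.eq_zero s (hs.1.trans (le_abs_self s))

theorem IsCutoffProfile.cutoffWeight_le (hζ : IsCutoffProfile ζ) (x : ℝ) :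
    cutoffWeight ζ x ≤ cutoffWeight ζ 2 := by
  rcases le_total 2 |x| with h | h
  · exact (hζ.cutoffWeight_eq h).le
  · rw [← hζ.cutoffWeight_abs]
    exact hζ.cutoffWeight_monotoneOn (abs_nonneg x) (mem_Ici.mpr zero_le_two) h

theorem IsCutoffProfile.exists_norm_le (hζ : IsCutoffProfile ζ) : ∃ C, ∀ x, ‖ζ x‖ ≤ C := by
  obtain ⟨C, hC⟩ := isCompact_Icc (a := (-2 : ℝ)) (b := 2) |>.exists_bound_of_continuousOn
    hζ.continuous.continuousOn
  refine ⟨C, fun x => ?_⟩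
  rcases le_total 2 |x| with h | h
  · rw [hζ.eq_zero x h, norm_zero]
    exact (norm_nonneg _).trans (hC 0 (by simp))
  · exact hC x (abs_le.mp h)

end Cutoff

/-! ### Rescaling -/

theorem quasiMeasurePreserving_div {R : ℝ} (hR : R ≠ 0) :
    Measure.QuasiMeasurePreserving (fun x : ℝ => x / R) volume volume :=
  quasiMeasurePreserving_of_volume_preimage (by fun_prop) fun s h0 => by
    have : (fun x : ℝ => x / R) ⁻¹' s = (fun x : ℝ => x * R⁻¹) ⁻¹' s := by
      simp [div_eq_mul_inv]
    rw [this, Real.volume_preimage_mul_right (inv_ne_zero hR), h0, mul_zero]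

theorem HasWeakDeriv.comp_div {f g : ℝ → ℝ} (h : HasWeakDeriv f g) {R : ℝ} (hR : R ≠ 0) (c : ℝ) :
    HasWeakDeriv (fun x => c * f (x / R)) (fun x => c / R * g (x / R)) := by
  obtain ⟨F, hF, hae⟩ := h.exists_isPrimitive
  have hp : IsPrimitive (fun x => c * F (x / R)) (fun x => c / R * g (x / R)) := by
    refine ⟨fun x => ?_, fun x y => ?_⟩
    · have h1 := hF.intervalIntegrable ((x - 1) / R) ((x + 1) / R)
      have h2 : IntervalIntegrable (fun y => g (y / R)) volume (x - 1) (x + 1) := by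
        have := h1.comp_mul_left (c := R⁻¹)
        simp only [div_inv_eq_mul, div_mul_cancel₀ _ hR] at this
        simpa [div_eq_inv_mul] using this
      refine ⟨Icc (x - 1) (x + 1), Icc_mem_nhds (by linarith) (by linarith), ?_⟩
      rw [integrableOn_Icc_iff_integrableOn_Ioc]
      exact ((intervalIntegrable_iff_integrableOn_Ioc_of_le (by linarith)).mp h2).const_mul _
    · rw [intervalIntegral.integral_const_mul, intervalIntegral.integral_comp_div _ hR,
        ← hF.sub_eq, smul_eq_mul, ← mul_assoc, div_mul_cancel₀ _ hR, mul_sub]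
  refine hp.hasWeakDeriv.congr ?_ (ae_eq_refl _)
  filter_upwards [(quasiMeasurePreserving_div hR).ae_eq hae] with x hx
  simp only [Function.comp_apply] at hx
  rw [hx]

theorem memLp_top_comp_div {f : ℝ → ℝ} (h : MemLp f ∞) {R : ℝ} (hR : R ≠ 0) (c : ℝ) :
    MemLp (fun x => c * f (x / R)) ∞ := by
  have hq := quasiMeasurePreserving_div hR
  have h1 : MemLp (fun x => f (x / R)) ∞ := by
    refine memLp_top_of_bound (h.1.comp_quasiMeasurePreserving hq)
      (eLpNormEssSup f volume).toReal ?_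
    filter_upwards [hq.ae (enorm_ae_le_eLpNormEssSup f volume)] with s hs
    rw [← toReal_enorm]
    exact ENNReal.toReal_mono (by
      have := h.eLpNorm_ne_top; rwa [eLpNorm_exponent_top] at this) hs
  exact h1.const_mul c

theorem IsW3Inf.comp_div {φ φ₁ φ₂ φ₃ : ℝ → ℝ} (h : IsW3Inf φ φ₁ φ₂ φ₃) {R : ℝ} (hR : R ≠ 0) :
    IsW3Inf (fun x => R * φ (x / R)) (fun x => φ₁ (x / R)) (fun x => R⁻¹ * φ₂ (x / R))
      (fun x => (R ^ 2)⁻¹ * φ₃ (x / R)) where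
  memLp := memLp_top_comp_div h.memLp hR R
  memLp₁ := by simpa using memLp_top_comp_div h.memLp₁ hR 1
  memLp₂ := memLp_top_comp_div h.memLp₂ hR _
  memLp₃ := memLp_top_comp_div h.memLp₃ hR _
  deriv₁ := by simpa [hR] using h.deriv₁.comp_div hR R
  deriv₂ := by simpa using h.deriv₂.comp_div hR 1
  deriv₃ := by
    have := h.deriv₃.comp_div hR R⁻¹
    convert! this using 3
    field_simp

/-! ### The weak form of the equation -/

/-- The Cauchy–Schwarz inequality. -/
theorem integral_norm_mul_norm_le {f g : ℝ → ℂ} (hf : MemLp f 2) (hg : MemLp g 2) {A B : ℝ}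
    (hA : 0 ≤ A) (hB : 0 ≤ B) (h1 : ∫ x, ‖f x‖ ^ 2 ≤ A ^ 2) (h2 : ∫ x, ‖g x‖ ^ 2 ≤ B ^ 2) :
    ∫ x, ‖f x‖ * ‖g x‖ ≤ A * B := by
  have h := integral_mul_norm_le_Lp_mul_Lq (μ := volume) (f := f) (g := g) (p := 2) (q := 2)
    Real.HolderConjugate.two_two (by simpa using hf) (by simpa using hg)
  simp only [Real.rpow_ofNat, ← Real.sqrt_eq_rpow] at h
  refine h.trans (mul_le_mul ?_ ?_ (Real.sqrt_nonneg _) hA)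
  · exact Real.sqrt_le_iff.mpr ⟨hA, h1⟩
  · exact Real.sqrt_le_iff.mpr ⟨hB, h2⟩

theorem integrable_mul_of_memLp_two {f g : ℝ → ℂ} (hf : MemLp f 2) (hg : MemLp g 2) :
    Integrable (fun x => f x * g x) :=
  hf.integrable_mul hg

theorem norm_integral_mul_le {f g : ℝ → ℂ} (hf : MemLp f 2) (hg : MemLp g 2) {A B : ℝ}
    (hA : 0 ≤ A) (hB : 0 ≤ B) (h1 : ∫ x, ‖f x‖ ^ 2 ≤ A ^ 2) (h2 : ∫ x, ‖g x‖ ^ 2 ≤ B ^ 2) :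
    ‖∫ x, f x * g x‖ ≤ A * B := by
  refine (norm_integral_le_integral_norm _).trans ?_
  simp only [norm_mul]
  exact integral_norm_mul_norm_le hf hg hA hB h1 h2

theorem norm_forcing_le {V : ℝ → ℝ} {f : ℝ → ℂ} {M x : ℝ} (hf : ‖f x‖ ≤ M) :
    ‖forcing V f x‖ ≤ (M ^ 5 + M) * (1 + |V x|) := by
  have hM : 0 ≤ M := (norm_nonneg _).trans hf
  rw [forcing]
  refine (norm_sub_le _ _).trans ?_
  simp only [norm_mul, norm_pow, Complex.norm_real, Real.norm_eq_abs, abs_norm]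
  have h1 : ‖f x‖ ^ 4 * ‖f x‖ ≤ M ^ 5 := by
    rw [← pow_succ]; gcongr
  have h2 : |V x| * ‖f x‖ ≤ |V x| * M := by gcongr
  have h3 : 0 ≤ M ^ 5 := by positivity
  nlinarith [abs_nonneg (V x), mul_nonneg h3 (abs_nonneg (V x))]

theorem norm_forcing_sub_le {V : ℝ → ℝ} {f g : ℝ → ℂ} {M d x : ℝ} (hf : ‖f x‖ ≤ M)
    (hg : ‖g x‖ ≤ M) (hd : ‖f x - g x‖ ≤ d) :
    ‖forcing V f x - forcing V g x‖ ≤ (5 * M ^ 4 + 1) * d * (1 + |V x|) := by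
  have hM : 0 ≤ M := (norm_nonneg _).trans hf
  have hd0 : 0 ≤ d := (norm_nonneg _).trans hd
  -- Telescoping `|f|⁴f - |g|⁴g` and factoring `|f|⁴ - |g|⁴` gives `1 + 4 = 5` copies of `M⁴ d`.
  have e : forcing V f x - forcing V g x = (‖f x‖ : ℂ) ^ 4 * (f x - g x) +
      (((‖f x‖ - ‖g x‖) * ((‖f x‖ + ‖g x‖) * (‖f x‖ ^ 2 + ‖g x‖ ^ 2)) : ℝ) : ℂ) * g x -
      (V x : ℂ) * (f x - g x) := by
    rw [forcing, forcing]; push_cast; ring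
  rw [e]
  refine (norm_sub_le _ _).trans ((add_le_add_left (norm_add_le _ _) _).trans ?_)
  simp only [norm_mul, norm_pow, Complex.norm_real, Real.norm_eq_abs, abs_norm]
  have h0 : |‖f x‖ - ‖g x‖| ≤ d := (abs_norm_sub_norm_le _ _).trans hd
  have h1 : ‖f x‖ ^ 4 * ‖f x - g x‖ ≤ M ^ 4 * d := by gcongr
  have h2 : |‖f x‖ - ‖g x‖| * (|‖f x‖ + ‖g x‖| * |‖f x‖ ^ 2 + ‖g x‖ ^ 2|) * ‖g x‖ ≤
      d * ((M + M) * (M ^ 2 + M ^ 2)) * M := by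
    rw [abs_of_nonneg (by positivity : 0 ≤ ‖f x‖ + ‖g x‖),
      abs_of_nonneg (by positivity : 0 ≤ ‖f x‖ ^ 2 + ‖g x‖ ^ 2)]
    gcongr
  have h3 : |V x| * ‖f x - g x‖ ≤ |V x| * d := by gcongr
  have h4 : 0 ≤ M ^ 4 * d := by positivity
  nlinarith [mul_nonneg h4 (abs_nonneg (V x))]

/-- A trajectory of `H¹` functions satisfying Duhamel's formula, in terms of its continuous
representatives `U t` with derivatives `G t`. -/
structure IsWeakFlow (V : ℝ → ℝ) (J : Set ℝ) (U G : ℝ → ℝ → ℂ) : Prop where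
  isOpen : IsOpen J
  ordConnected : J.OrdConnected
  zero_mem : (0 : ℝ) ∈ J
  pair : ∀ t ∈ J, IsH1Pair (U t) (G t)
  tendsto : ∀ t₀ ∈ J, Tendsto (fun t => h1Norm (fun x => U t x - U t₀ x)) (𝓝 t₀) (𝓝 0)
  weight : Integrable (fun x => V x * decay x)
  intervalIntegrable_forcing : ∀ t ∈ J, ∀ ψ : 𝓢(ℝ, ℂ),
    IntervalIntegrable (fun s => ∫ x, forcing V (U s) x * freeGroup (t - s) ψ x) volume 0 t
  duhamel : ∀ t ∈ J, ∀ ψ : 𝓢(ℝ, ℂ),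
    ∫ x, U t x * ψ x =
      (∫ x, U 0 x * freeGroup t ψ x) +
        Complex.I * ∫ s in (0 : ℝ)..t, ∫ x, forcing V (U s) x * freeGroup (t - s) ψ x

/-! ### Time derivatives of pairings with smooth test functions -/

theorem continuous_decay : Continuous decay := by
  unfold decay
  exact Continuous.inv₀ (by fun_prop) fun x => by positivity

theorem decay_le (x : ℝ) : decay x ≤ (1 + x ^ 2)⁻¹ := by
  unfold decay
  have : 1 ≤ 1 + x ^ 2 := by nlinarith [sq_nonneg x]
  gcongr
  nlinarith

theorem integrable_decay : Integrable decay :=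
  integrable_inv_one_add_sq.mono' continuous_decay.aestronglyMeasurable
    (Eventually.of_forall fun x => by
      rw [Real.norm_of_nonneg (decay_pos x).le]; exact decay_le x)

/-- Lets compactly supported test functions use the same dominating weight as Schwartz functions. -/
theorem le_mul_decay {a B x r : ℝ} (hr : r ≤ B) (hB : 0 ≤ B) (hx : |x| ≤ a) :
    r ≤ B * (1 + a ^ 2) ^ 2 * decay x := by
  have h1 : x ^ 2 ≤ a ^ 2 := sq_le_sq' (by linarith [neg_abs_le x]) (by linarith [le_abs_self x])
  have h2 : 1 ≤ (1 + a ^ 2) ^ 2 * decay x := by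
    rw [decay, ← div_eq_mul_inv, one_le_div (by positivity)]
    gcongr
  nlinarith

namespace IsWeakFlow

variable {V : ℝ → ℝ} {J : Set ℝ} {U G : ℝ → ℝ → ℂ}

theorem aestronglyMeasurable (h : IsWeakFlow V J U G) : AEStronglyMeasurable V := by
  have h1 := h.weight.1.mul
    (continuous_decay.inv₀ fun x => (decay_pos x).ne').aestronglyMeasurable
  refine h1.congr (Eventually.of_forall fun x => ?_)
  simp [(decay_pos x).ne']

theorem integrable_weight (h : IsWeakFlow V J U G) :
    Integrable (fun x => (1 + |V x|) * decay x) := by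
  have := integrable_decay.add h.weight.abs
  refine this.congr (Eventually.of_forall fun x => ?_)
  simp only [Pi.add_apply, abs_mul, abs_of_pos (decay_pos x)]
  ring

theorem weight_nonneg (V : ℝ → ℝ) : 0 ≤ ∫ x, (1 + |V x|) * decay x :=
  integral_nonneg fun x => mul_nonneg (by positivity) (decay_pos x).le

theorem aestronglyMeasurable_forcing (h : IsWeakFlow V J U G) {s : ℝ} (hs : s ∈ J) :
    AEStronglyMeasurable (forcing V (U s)) := by
  have h1 := (h.pair s hs).prim.continuous
  have h2 : AEStronglyMeasurable (fun x => (V x : ℂ)) :=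
    Complex.continuous_ofReal.comp_aestronglyMeasurable h.aestronglyMeasurable
  exact (Continuous.aestronglyMeasurable (by fun_prop)).sub (h2.mul h1.aestronglyMeasurable)

theorem integrable_forcing_mul (h : IsWeakFlow V J U G) {s C : ℝ} (hs : s ∈ J) {k : ℝ → ℂ}
    (hk : AEStronglyMeasurable k) (hkb : ∀ x, ‖k x‖ ≤ C * decay x) :
    Integrable (fun x => forcing V (U s) x * k x) := by
  set M := 2 * h1Norm (U s) with hM
  refine (h.integrable_weight.const_mul ((M ^ 5 + M) * C)).mono'
    ((h.aestronglyMeasurable_forcing hs).mul hk) (Eventually.of_forall fun x => ?_)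
  rw [norm_mul]
  have h1 := norm_forcing_le (V := V) ((h.pair s hs).norm_le x)
  have hM0 : 0 ≤ M := by have := h1Norm_nonneg (U s); positivity
  calc _ ≤ (M ^ 5 + M) * (1 + |V x|) * (C * decay x) :=
        mul_le_mul h1 (hkb x) (norm_nonneg _) (by positivity)
    _ = _ := by ring

theorem norm_sub_le (h : IsWeakFlow V J U G) {s t : ℝ} (hs : s ∈ J) (ht : t ∈ J) (x : ℝ) :
    ‖U s x - U t x‖ ≤ 2 * h1Norm (fun x => U s x - U t x) :=
  ((h.pair s hs).sub (h.pair t ht)).norm_le x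

theorem eventually_close (h : IsWeakFlow V J U G) {t₀ : ℝ} (ht₀ : t₀ ∈ J) {ε : ℝ} (hε : 0 < ε) :
    ∃ δ > 0, ∀ s, |s - t₀| < δ → s ∈ J ∧ h1Norm (fun x => U s x - U t₀ x) ≤ ε := by
  have h1 := (h.isOpen.mem_nhds ht₀)
  have h2 := (h.tendsto t₀ ht₀).eventually (Iic_mem_nhds hε)
  obtain ⟨δ, hδ, hb⟩ := Metric.eventually_nhds_iff.mp (h2.and h1)
  exact ⟨δ, hδ, fun s hs => ⟨(hb hs).2, (hb hs).1⟩⟩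

theorem norm_le_add_one (h : IsWeakFlow V J U G) {s t : ℝ} (hs : s ∈ J) (ht : t ∈ J)
    (hd : h1Norm (fun x => U s x - U t x) ≤ 1 / 2) (x : ℝ) :
    ‖U s x‖ ≤ 2 * h1Norm (U t) + 1 := by
  have h1 := h.norm_sub_le hs ht x
  have h2 := (h.pair t ht).norm_le x
  have h3 := norm_sub_norm_le (U s x) (U t x)
  linarith

/-- The error splits into moving `ψ` by the group and moving `U s` to `U t₀`; each part is small
times the integrable weight `(1 + |V|) decay`. The times `s` and `τ` are independent, so that `τ = t
- s` may be taken in Duhamel's integral. -/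
theorem tendsto_forcing (h : IsWeakFlow V J U G) {t₀ : ℝ} (ht₀ : t₀ ∈ J) (ψ : 𝓢(ℝ, ℂ)) {ε : ℝ}
    (hε : 0 < ε) : ∃ δ > 0, ∀ s, |s - t₀| < δ → s ∈ J ∧ ∀ τ, |τ| < δ →
      ‖(∫ x, forcing V (U s) x * freeGroup τ ψ x) - ∫ x, forcing V (U t₀) x * ψ x‖ ≤ ε := by
  obtain ⟨C₁, hC₁, h₁⟩ := exists_norm_freeGroup_sub_le ψ
  obtain ⟨C₀, hC₀, h₀⟩ := exists_norm_freeGroup_le ψ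
  set M := 2 * h1Norm (U t₀) + 1 with hM
  have hM0 : 0 ≤ M := by have := h1Norm_nonneg (U t₀); positivity
  set W := ∫ x, (1 + |V x|) * decay x with hW
  have hW0 : 0 ≤ W := weight_nonneg V
  set K₁ := (M ^ 5 + M) * C₁ * W with hK₁
  set K₂ := (5 * M ^ 4 + 1) * 2 * C₀ * W with hK₂
  have hK₁0 : 0 ≤ K₁ := by positivity
  have hK₂0 : 0 ≤ K₂ := by positivity
  -- The bound `1/2` makes the sup distance at most `1`, so that `M` bounds `U s` as well.
  obtain ⟨δ, hδ, hc⟩ := h.eventually_close ht₀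
    (show 0 < min (1 / 2) (ε / (2 * (K₂ + 1))) by positivity)
  refine ⟨min δ (min 1 (ε / (2 * (K₁ + 1)))), by positivity, fun s hs => ?_⟩
  obtain ⟨hsJ, hsd⟩ := hc s (hs.trans_le (min_le_left _ _))
  refine ⟨hsJ, fun τ hτ => ?_⟩
  have hτ1 : |τ| ≤ 1 := hτ.le.trans ((min_le_right _ _).trans (min_le_left _ _))
  have hτ2 : |τ| ≤ ε / (2 * (K₁ + 1)) := hτ.le.trans ((min_le_right _ _).trans (min_le_right _ _))
  set d := h1Norm (fun x => U s x - U t₀ x) with hd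
  have hd1 : d ≤ 1 / 2 := hsd.trans (min_le_left _ _)
  have hd2 : d ≤ ε / (2 * (K₂ + 1)) := hsd.trans (min_le_right _ _)
  have hψ : ∀ x, ‖ψ x‖ ≤ C₀ * decay x := fun x => by
    have := h₀ 0 x (by simp); rwa [freeGroup_zero] at this
  have hi1 : Integrable (fun x => forcing V (U s) x * (freeGroup τ ψ x - ψ x)) :=
    h.integrable_forcing_mul hsJ
      ((freeGroup τ ψ).continuous.sub ψ.continuous).aestronglyMeasurable (fun x => h₁ τ x hτ1)
  have hi2 : Integrable (fun x => forcing V (U s) x * ψ x) :=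
    h.integrable_forcing_mul hsJ ψ.continuous.aestronglyMeasurable hψ
  have hi3 : Integrable (fun x => forcing V (U t₀) x * ψ x) :=
    h.integrable_forcing_mul ht₀ ψ.continuous.aestronglyMeasurable hψ
  have e : (∫ x, forcing V (U s) x * freeGroup τ ψ x) - ∫ x, forcing V (U t₀) x * ψ x =
      (∫ x, forcing V (U s) x * (freeGroup τ ψ x - ψ x)) +
        ∫ x, (forcing V (U s) x - forcing V (U t₀) x) * ψ x := by
    simp only [sub_mul]
    rw [integral_sub hi2 hi3, ← add_sub_assoc, ← integral_add hi1 hi2]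
    simp only [mul_sub, sub_add_cancel]
  rw [e]
  refine (norm_add_le _ _).trans ?_
  have b1 : ‖∫ x, forcing V (U s) x * (freeGroup τ ψ x - ψ x)‖ ≤ K₁ * |τ| := by
    refine (norm_integral_le_of_norm_le (h.integrable_weight.const_mul ((M ^ 5 + M) * C₁ * |τ|))
      (Eventually.of_forall fun x => ?_)).trans_eq ?_
    · rw [norm_mul]
      calc _ ≤ (M ^ 5 + M) * (1 + |V x|) * (C₁ * |τ| * decay x) :=
            mul_le_mul (norm_forcing_le (h.norm_le_add_one hsJ ht₀ hd1 x)) (h₁ τ x hτ1)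
              (norm_nonneg _) (by positivity)
        _ = _ := by ring
    · rw [integral_const_mul]; ring
  have b2 : ‖∫ x, (forcing V (U s) x - forcing V (U t₀) x) * ψ x‖ ≤ K₂ * d := by
    refine (norm_integral_le_of_norm_le (h.integrable_weight.const_mul
      ((5 * M ^ 4 + 1) * (2 * d) * C₀)) (Eventually.of_forall fun x => ?_)).trans_eq ?_
    · rw [norm_mul]
      have hd0 : 0 ≤ d := h1Norm_nonneg _
      calc _ ≤ (5 * M ^ 4 + 1) * (2 * d) * (1 + |V x|) * (C₀ * decay x) :=
            mul_le_mul (norm_forcing_sub_le (h.norm_le_add_one hsJ ht₀ hd1 x)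
              (by linarith [(h.pair t₀ ht₀).norm_le x]) (h.norm_sub_le hsJ ht₀ x)) (hψ x)
              (norm_nonneg _) (by positivity)
        _ = _ := by ring
    · rw [integral_const_mul]; ring
  have c1 : K₁ * |τ| ≤ ε / 2 := by
    calc K₁ * |τ| ≤ (K₁ + 1) * (ε / (2 * (K₁ + 1))) := by gcongr; linarith
      _ = ε / 2 := by field_simp
  have c2 : K₂ * d ≤ ε / 2 := by
    have hd0 : 0 ≤ d := h1Norm_nonneg _
    calc K₂ * d ≤ (K₂ + 1) * (ε / (2 * (K₂ + 1))) := by gcongr; linarith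
      _ = ε / 2 := by field_simp
  linarith

/-- The formula restarts at `t₀` by the group property: Duhamel at `t₀` is applied to
`e^{i(t-t₀)∂ₓ²}ψ` and subtracted from Duhamel at `t`. -/
theorem duhamel_sub (h : IsWeakFlow V J U G) {t₀ t : ℝ} (ht₀ : t₀ ∈ J) (ht : t ∈ J)
    (ψ : 𝓢(ℝ, ℂ)) :
    IntervalIntegrable (fun s => ∫ x, forcing V (U s) x * freeGroup (t - s) ψ x) volume t₀ t ∧
    (∫ x, U t x * ψ x) - (∫ x, U t₀ x * freeGroup (t - t₀) ψ x) =
      Complex.I * ∫ s in t₀..t, ∫ x, forcing V (U s) x * freeGroup (t - s) ψ x := by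
  have h1 := h.duhamel t ht ψ
  have h2 := h.duhamel t₀ ht₀ (freeGroup (t - t₀) ψ)
  have i1 := h.intervalIntegrable_forcing t ht ψ
  have i2 := h.intervalIntegrable_forcing t₀ ht₀ (freeGroup (t - t₀) ψ)
  simp only [freeGroup_freeGroup] at h2 i2
  have e1 : ∀ s, t₀ - s + (t - t₀) = t - s := fun s => by ring
  simp only [e1] at h2 i2
  rw [show t₀ + (t - t₀) = t by ring] at h2
  refine ⟨i2.symm.trans i1, ?_⟩
  rw [h1, h2, ← intervalIntegral.integral_interval_sub_left i1 i2]
  ring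

theorem integral_mul_deriv_deriv (h : IsWeakFlow V J U G) {t : ℝ} (ht : t ∈ J) {ψ : ℝ → ℂ}
    (hψ : ContDiff ℝ ∞ ψ) (hc : HasCompactSupport ψ) :
    ∫ x, U t x * deriv (deriv ψ) x = -∫ x, G t x * deriv ψ x := by
  have hψ' : ContDiff ℝ ∞ (deriv ψ) := (contDiff_infty_iff_deriv.mp hψ).2
  obtain ⟨a, ha, h0⟩ := exists_bound_of_hasCompactSupport hc.deriv
  have hp := (h.pair t ht).prim.mul (isPrimitive_deriv hψ')
  have hz := hp.integral_eq_zero ha.le (fun x hx => by simp [h0 x hx])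
    (fun x hx => by simp [h0 x hx.le, deriv_eq_zero_of_abs_gt h0 hx])
  rw [integral_add] at hz
  · exact eq_neg_of_add_eq_zero_left hz
  · exact ((h.pair t ht).prim.continuous.mul (hψ'.continuous_deriv (by simp))
      ).integrable_of_hasCompactSupport hc.deriv.deriv.mul_left
  · exact integrable_mul_of_memLp_two (h.pair t ht).memLp_deriv
      (hψ'.continuous.memLp_of_hasCompactSupport hc.deriv)

theorem hasDerivAt_schwartz (h : IsWeakFlow V J U G) {t₀ : ℝ} (ht₀ : t₀ ∈ J) (ψ : 𝓢(ℝ, ℂ)) :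
    HasDerivAt (fun t => ∫ x, U t x * ψ x)
      (Complex.I * ((∫ x, U t₀ x * schwartzDeriv (schwartzDeriv ψ) x) +
        ∫ x, forcing V (U t₀) x * ψ x)) t₀ := by
  obtain ⟨C₂, hC₂, h₂⟩ := exists_norm_freeGroup_sub_sub_le ψ
  rw [hasDerivAt_iff_isLittleO, Asymptotics.isLittleO_iff]
  intro ε hε
  obtain ⟨δ, hδ, hF⟩ := h.tendsto_forcing ht₀ ψ (show 0 < ε / 2 by positivity)
  set M := 2 * h1Norm (U t₀) with hM
  have hM0 : 0 ≤ M := by have := h1Norm_nonneg (U t₀); positivity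
  have hD0 : 0 ≤ ∫ x, decay x := integral_nonneg fun x => (decay_pos x).le
  set K := M * C₂ * ∫ x, decay x with hK
  have hK0 : 0 ≤ K := by positivity
  have hb : 0 < min δ (min 1 (ε / (2 * (K + 1)))) := by positivity
  filter_upwards [Metric.ball_mem_nhds t₀ hb] with t ht
  rw [Metric.mem_ball, Real.dist_eq] at ht
  have ht1 : |t - t₀| < δ := ht.trans_le (min_le_left _ _)
  have ht2 : |t - t₀| ≤ 1 := ht.le.trans ((min_le_right _ _).trans (min_le_left _ _))
  have ht3 : |t - t₀| ≤ ε / (2 * (K + 1)) :=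
    ht.le.trans ((min_le_right _ _).trans (min_le_right _ _))
  have htJ := (hF t ht1).1
  obtain ⟨hint, hduh⟩ := h.duhamel_sub ht₀ htJ ψ
  set L := ∫ x, forcing V (U t₀) x * ψ x with hL
  have hU := (h.pair t₀ ht₀).memLp
  have i1 := integrable_mul_of_memLp_two hU ((freeGroup (t - t₀) ψ).memLp 2)
  have i2 := integrable_mul_of_memLp_two hU (ψ.memLp 2)
  have i3 := integrable_mul_of_memLp_two hU ((schwartzDeriv (schwartzDeriv ψ)).memLp 2)
  -- The remainder is the second-order Taylor error of the group, which is `O((t - t₀)²)`, plus the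
  -- oscillation of the forcing about its value at `t₀`, which is `o(t - t₀)`.
  have e : (∫ x, U t x * ψ x) - (∫ x, U t₀ x * ψ x) - (t - t₀) •
      (Complex.I * ((∫ x, U t₀ x * schwartzDeriv (schwartzDeriv ψ) x) + L)) =
      (∫ x, U t₀ x * (freeGroup (t - t₀) ψ x - ψ x - (t - t₀ : ℝ) *
        (Complex.I * schwartzDeriv (schwartzDeriv ψ) x))) +
      Complex.I * ∫ s in t₀..t, ((∫ x, forcing V (U s) x * freeGroup (t - s) ψ x) - L) := by
    rw [intervalIntegral.integral_sub hint intervalIntegrable_const, mul_sub, ← hduh,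
      intervalIntegral.integral_const]
    have e2 : ∫ x, U t₀ x * (freeGroup (t - t₀) ψ x - ψ x - (t - t₀ : ℝ) *
        (Complex.I * schwartzDeriv (schwartzDeriv ψ) x)) =
        (∫ x, U t₀ x * freeGroup (t - t₀) ψ x) - (∫ x, U t₀ x * ψ x) -
          (t - t₀ : ℝ) * (Complex.I * ∫ x, U t₀ x * schwartzDeriv (schwartzDeriv ψ) x) := by
      rw [← integral_sub i1 i2, ← integral_const_mul, ← integral_const_mul,
        ← integral_sub (f := fun x => U t₀ x * freeGroup (t - t₀) ψ x - U t₀ x * ψ x)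
          (i1.sub i2) ((i3.const_mul _).const_mul _)]
      refine integral_congr_ae (Eventually.of_forall fun x => ?_)
      ring
    rw [e2]
    simp only [Complex.real_smul]
    ring
  rw [e]
  refine (norm_add_le _ _).trans ?_
  have b1 : ‖∫ x, U t₀ x * (freeGroup (t - t₀) ψ x - ψ x - (t - t₀ : ℝ) *
        (Complex.I * schwartzDeriv (schwartzDeriv ψ) x))‖ ≤ K * |t - t₀| ^ 2 := by
    refine (norm_integral_le_of_norm_le (integrable_decay.const_mul (M * (C₂ * |t - t₀| ^ 2)))
      (Eventually.of_forall fun x => ?_)).trans_eq ?_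
    · rw [norm_mul]
      calc _ ≤ M * (C₂ * |t - t₀| ^ 2 * decay x) :=
            mul_le_mul ((h.pair t₀ ht₀).norm_le x) (h₂ _ x ht2) (norm_nonneg _) hM0
        _ = _ := by ring
    · rw [integral_const_mul]; ring
  have b2 : ‖Complex.I * ∫ s in t₀..t, ((∫ x, forcing V (U s) x * freeGroup (t - s) ψ x) - L)‖ ≤
      ε / 2 * |t - t₀| := by
    rw [norm_mul, Complex.norm_I, one_mul]
    refine intervalIntegral.norm_integral_le_of_norm_le_const fun s hs => ?_
    have hs' := uIoc_subset_uIcc hs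
    refine (hF s ((abs_sub_left_of_mem_uIcc hs').trans_lt ht1)).2 _
      ((abs_sub_right_of_mem_uIcc hs').trans_lt ht1)
  have c1 : K * |t - t₀| ^ 2 ≤ ε / 2 * |t - t₀| := by
    calc K * |t - t₀| ^ 2 = K * |t - t₀| * |t - t₀| := by ring
      _ ≤ (K + 1) * (ε / (2 * (K + 1))) * |t - t₀| := by gcongr; linarith
      _ = ε / 2 * |t - t₀| := by field_simp
  rw [Real.norm_eq_abs]
  linarith

/-- With one derivative on each factor the right-hand side depends only on `ψ` and `ψ'`, so it
extends to `H¹` test functions. -/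
theorem hasDerivAt_testFunction (h : IsWeakFlow V J U G) {t₀ : ℝ} (ht₀ : t₀ ∈ J) {ψ : ℝ → ℂ}
    (hψ : ContDiff ℝ ∞ ψ) (hc : HasCompactSupport ψ) :
    HasDerivAt (fun t => ∫ x, U t x * ψ x)
      (Complex.I * (-(∫ x, G t₀ x * deriv ψ x) + ∫ x, forcing V (U t₀) x * ψ x)) t₀ := by
  have := h.hasDerivAt_schwartz ht₀ (hc.toSchwartzMap hψ)
  rw [← h.integral_mul_deriv_deriv ht₀ hψ hc]
  have e1 : ⇑(schwartzDeriv (hc.toSchwartzMap hψ)) = deriv ψ := by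
    ext x
    rw [SchwartzMap.derivCLM_apply]; rfl
  have e2 : ⇑(schwartzDeriv (schwartzDeriv (hc.toSchwartzMap hψ))) = deriv (deriv ψ) := by
    ext x
    rw [SchwartzMap.derivCLM_apply, e1]
  rw [e2] at this
  exact this

end IsWeakFlow

/-! ### Testing the equation against compactly supported `H¹` functions -/

/-- `χ` is an `H¹` function with derivative `χ'`, supported in `[-a, a]`. -/
structure IsTestPair (a : ℝ) (χ χ' : ℝ → ℂ) : Prop where
  prim : IsPrimitive χ χ'
  memLp : MemLp χ' 2
  zero : ∀ x, a ≤ |x| → χ x = 0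
  zero_deriv : ∀ x, a < |x| → χ' x = 0

theorem isTestPair_deriv {a : ℝ} {ψ : ℝ → ℂ} (hψ : ContDiff ℝ ∞ ψ) (h0 : ∀ x, a ≤ |x| → ψ x = 0) :
    IsTestPair a ψ (deriv ψ) := by
  have hc : HasCompactSupport ψ := HasCompactSupport.intro (isCompact_Icc (a := -a) (b := a))
    fun x hx => h0 x (by by_contra! hc; exact hx (abs_le.mp hc.le))
  exact ⟨isPrimitive_deriv hψ, (hψ.continuous_deriv (by simp)).memLp_of_hasCompactSupport hc.deriv,
    h0, fun x hx => deriv_eq_zero_of_abs_gt h0 hx⟩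

theorem IsTestPair.hasCompactSupport {a : ℝ} {χ χ' : ℝ → ℂ} (h : IsTestPair a χ χ') :
    HasCompactSupport χ :=
  HasCompactSupport.intro (isCompact_Icc (a := -a) (b := a))
    fun x hx => h.zero x (by by_contra! hc; exact hx (abs_le.mp hc.le))

theorem IsTestPair.mono {a b : ℝ} {χ χ' : ℝ → ℂ} (h : IsTestPair a χ χ') (hab : a ≤ b) :
    IsTestPair b χ χ' :=
  ⟨h.prim, h.memLp, fun x hx => h.zero x (hab.trans hx), fun x hx =>
    h.zero_deriv x (hab.trans_lt hx)⟩

theorem IsTestPair.sub {a : ℝ} {χ χ' ψ ψ' : ℝ → ℂ} (h : IsTestPair a χ χ')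
    (h' : IsTestPair a ψ ψ') : IsTestPair a (fun x => χ x - ψ x) (fun x => χ' x - ψ' x) :=
  ⟨h.prim.sub h'.prim, h.memLp.sub h'.memLp, fun x hx => by simp [h.zero x hx, h'.zero x hx],
    fun x hx => by simp [h.zero_deriv x hx, h'.zero_deriv x hx]⟩

/-- Size of a test pair. -/
structure IsTestBound (χ χ' : ℝ → ℂ) (A B : ℝ) : Prop where
  nonneg_deriv : 0 ≤ A
  nonneg : 0 ≤ B
  integral_le : ∫ x, ‖χ' x‖ ^ 2 ≤ A ^ 2
  norm_le : ∀ x, ‖χ x‖ ≤ B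

theorem IsTestPair.norm_le_mul_decay {a A B : ℝ} {χ χ' : ℝ → ℂ} (h : IsTestPair a χ χ')
    (hb : IsTestBound χ χ' A B) (x : ℝ) : ‖χ x‖ ≤ B * (1 + a ^ 2) ^ 2 * decay x := by
  rcases le_total |x| a with hx | hx
  · exact le_mul_decay (hb.norm_le x) hb.nonneg hx
  · rw [h.zero x hx, norm_zero]
    have := decay_pos x
    have := hb.nonneg
    positivity

theorem integral_norm_add_sq_le {f g : ℝ → ℂ} (hf : MemLp f 2) (hg : MemLp g 2) {A B : ℝ}
    (hA : 0 ≤ A) (hB : 0 ≤ B) (h1 : ∫ x, ‖f x‖ ^ 2 ≤ A ^ 2) (h2 : ∫ x, ‖g x‖ ^ 2 ≤ B ^ 2) :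
    ∫ x, ‖f x + g x‖ ^ 2 ≤ (A + B) ^ 2 := by
  have i1 := integrable_norm_sq hf
  have i2 := integrable_norm_sq hg
  have i3 : Integrable (fun x => 2 * (‖f x‖ * ‖g x‖)) := (hf.norm.integrable_mul hg.norm).const_mul 2
  have h3 := integral_norm_mul_norm_le hf hg hA hB h1 h2
  calc ∫ x, ‖f x + g x‖ ^ 2 ≤ ∫ x, (‖f x‖ ^ 2 + 2 * (‖f x‖ * ‖g x‖) + ‖g x‖ ^ 2) := by
        refine integral_mono (integrable_norm_sq (hf.add hg)) ((i1.add i3).add i2) fun x => ?_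
        have := norm_add_le (f x) (g x)
        dsimp only
        nlinarith [norm_nonneg (f x + g x)]
    _ = (∫ x, ‖f x‖ ^ 2) + 2 * (∫ x, ‖f x‖ * ‖g x‖) + ∫ x, ‖g x‖ ^ 2 := by
        rw [integral_add (f := fun x => ‖f x‖ ^ 2 + 2 * (‖f x‖ * ‖g x‖)) (i1.add i3) i2,
          integral_add i1 i3, integral_const_mul]
    _ ≤ (A + B) ^ 2 := by nlinarith

namespace IsWeakFlow

variable {V : ℝ → ℝ} {J : Set ℝ} {U G : ℝ → ℝ → ℂ}

/-- The right-hand side of the weak form of the equation at time `t`. -/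
noncomputable def rhs (V : ℝ → ℝ) (U G : ℝ → ℝ → ℂ) (t : ℝ) (χ χ' : ℝ → ℂ) : ℂ :=
  Complex.I * (-(∫ x, G t x * χ' x) + ∫ x, forcing V (U t) x * χ x)

theorem integrable_forcing_mul_test (h : IsWeakFlow V J U G) {s a A B : ℝ} (hs : s ∈ J)
    {χ χ' : ℝ → ℂ} (hχ : IsTestPair a χ χ') (hb : IsTestBound χ χ' A B) :
    Integrable (fun x => forcing V (U s) x * χ x) :=
  h.integrable_forcing_mul hs hχ.prim.continuous.aestronglyMeasurable (hχ.norm_le_mul_decay hb)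

theorem exists_norm_rhs_le (h : IsWeakFlow V J U G) (a : ℝ) : ∃ C, 0 ≤ C ∧
    ∀ (χ χ' : ℝ → ℂ) (A B : ℝ), IsTestPair a χ χ' → IsTestBound χ χ' A B →
      ‖rhs V U G 0 χ χ'‖ ≤ C * (A + B) := by
  set M := 2 * h1Norm (U 0) with hM
  have hM0 : 0 ≤ M := by have := h1Norm_nonneg (U 0); positivity
  have hW0 := weight_nonneg V
  set K := (M ^ 5 + M) * (1 + a ^ 2) ^ 2 * ∫ x, (1 + |V x|) * decay x with hK
  have hK0 : 0 ≤ K := by positivity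
  set N := √(∫ x, ‖G 0 x‖ ^ 2) with hN
  refine ⟨N + K, by positivity, fun χ χ' A B hχ hb => ?_⟩
  have hA := hb.nonneg_deriv
  have hB := hb.nonneg
  rw [rhs, norm_mul, Complex.norm_I, one_mul]
  refine (norm_add_le _ _).trans ?_
  rw [norm_neg]
  have b1 : ‖∫ x, G 0 x * χ' x‖ ≤ N * A := by
    refine norm_integral_mul_le (h.pair 0 h.zero_mem).memLp_deriv hχ.memLp (Real.sqrt_nonneg _) hA
      ?_ hb.integral_le
    rw [Real.sq_sqrt (integral_nonneg fun _ => by positivity)]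
  have b2 : ‖∫ x, forcing V (U 0) x * χ x‖ ≤ K * B := by
    refine (norm_integral_le_of_norm_le (h.integrable_weight.const_mul
      ((M ^ 5 + M) * (B * (1 + a ^ 2) ^ 2))) (Eventually.of_forall fun x => ?_)).trans_eq ?_
    · rw [norm_mul]
      calc _ ≤ (M ^ 5 + M) * (1 + |V x|) * (B * (1 + a ^ 2) ^ 2 * decay x) :=
            mul_le_mul (norm_forcing_le ((h.pair 0 h.zero_mem).norm_le x))
              (hχ.norm_le_mul_decay hb x) (norm_nonneg _) (by positivity)
        _ = _ := by ring
    · rw [integral_const_mul]; ring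
  have hNn : 0 ≤ N := Real.sqrt_nonneg _
  nlinarith [mul_nonneg hNn hB, mul_nonneg hK0 hA]

theorem rhs_sub (h : IsWeakFlow V J U G) {a A B A' B' : ℝ} {χ χ' ψ ψ' : ℝ → ℂ}
    (hχ : IsTestPair a χ χ') (hb : IsTestBound χ χ' A B) (hψ : IsTestPair a ψ ψ')
    (hb' : IsTestBound ψ ψ' A' B') :
    rhs V U G 0 (fun x => χ x - ψ x) (fun x => χ' x - ψ' x) =
      rhs V U G 0 χ χ' - rhs V U G 0 ψ ψ' := by
  have hG := (h.pair 0 h.zero_mem).memLp_deriv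
  simp only [rhs, mul_sub]
  rw [integral_sub (integrable_mul_of_memLp_two hG hχ.memLp)
      (integrable_mul_of_memLp_two hG hψ.memLp),
    integral_sub (h.integrable_forcing_mul_test h.zero_mem hχ hb)
      (h.integrable_forcing_mul_test h.zero_mem hψ hb')]
  ring

/-- The increment of the flow tested against `χ`, minus its linearization in time. -/
noncomputable def defect (V : ℝ → ℝ) (U G : ℝ → ℝ → ℂ) (t : ℝ) (χ χ' : ℝ → ℂ) : ℂ :=
  (∫ x, (U t x - U 0 x) * χ x) - t * rhs V U G 0 χ χ'

/-- Mean value inequality in time, with derivative `rhs` at `s` minus `rhs` at `0`, small because `U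
s → U 0` in `H¹`. The essential point is that `δ` does not depend on the test function, which later
is allowed to vary with `t`. -/
theorem norm_defect_smooth_le (h : IsWeakFlow V J U G) (a : ℝ) {ε : ℝ} (hε : 0 < ε) :
    ∃ δ > 0, ∀ t, |t| < δ → t ∈ J ∧ ∀ (ψ : ℝ → ℂ) (A B : ℝ), ContDiff ℝ ∞ ψ →
      (∀ x, a ≤ |x| → ψ x = 0) → IsTestBound ψ (deriv ψ) A B →
      ‖defect V U G t ψ (deriv ψ)‖ ≤ ε * |t| * (A + B) := by
  set M := 2 * h1Norm (U 0) + 1 with hM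
  have hM0 : 0 ≤ M := by have := h1Norm_nonneg (U 0); positivity
  have hW0 := weight_nonneg V
  set K := (5 * M ^ 4 + 1) * 2 * (1 + a ^ 2) ^ 2 * ∫ x, (1 + |V x|) * decay x with hK
  have hK0 : 0 ≤ K := by positivity
  obtain ⟨δ, hδ, hc⟩ := h.eventually_close h.zero_mem
    (show 0 < min (1 / 2) (ε / (K + 1)) by positivity)
  refine ⟨δ, hδ, fun t ht => ⟨(hc t (by simpa using ht)).1, fun ψ A B hψ h0 hb => ?_⟩⟩
  have hχ := isTestPair_deriv hψ h0
  have hA := hb.nonneg_deriv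
  have hB := hb.nonneg
  have hd (s : ℝ) (hs : s ∈ Icc (-|t|) |t|) :
      HasDerivAt (fun s : ℝ => (∫ x, U s x * ψ x) - s * rhs V U G 0 ψ (deriv ψ))
        (rhs V U G s ψ (deriv ψ) - rhs V U G 0 ψ (deriv ψ)) s := by
    have hsJ := (hc s (by rw [sub_zero]; exact (abs_le.mpr hs).trans_lt ht)).1
    have := (h.hasDerivAt_testFunction hsJ hψ hχ.hasCompactSupport).sub
      ((hasDerivAt_id s).ofReal_comp.mul_const (rhs V U G 0 ψ (deriv ψ)))
    convert! this using 1
    simp [rhs]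
  have hbd (s : ℝ) (hs : s ∈ Icc (-|t|) |t|) :
      ‖rhs V U G s ψ (deriv ψ) - rhs V U G 0 ψ (deriv ψ)‖ ≤ ε * (A + B) := by
    obtain ⟨hsJ, hsd⟩ := hc s (by rw [sub_zero]; exact (abs_le.mpr hs).trans_lt ht)
    set d := h1Norm (fun x => U s x - U 0 x) with hdd
    have hd0 : 0 ≤ d := h1Norm_nonneg _
    have hd1 : d ≤ 1 / 2 := hsd.trans (min_le_left _ _)
    have hd2 : d ≤ ε / (K + 1) := hsd.trans (min_le_right _ _)
    have p0 := h.pair 0 h.zero_mem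
    have ps := h.pair s hsJ
    have e : rhs V U G s ψ (deriv ψ) - rhs V U G 0 ψ (deriv ψ) =
        Complex.I * (-(∫ x, (G s x - G 0 x) * deriv ψ x) +
          ∫ x, (forcing V (U s) x - forcing V (U 0) x) * ψ x) := by
      simp only [sub_mul, rhs]
      rw [integral_sub (integrable_mul_of_memLp_two ps.memLp_deriv hχ.memLp)
        (integrable_mul_of_memLp_two p0.memLp_deriv hχ.memLp),
        integral_sub (h.integrable_forcing_mul_test hsJ hχ hb)
        (h.integrable_forcing_mul_test h.zero_mem hχ hb)]
      ring
    rw [e, norm_mul, Complex.norm_I, one_mul]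
    refine (norm_add_le _ _).trans ?_
    rw [norm_neg]
    have b1 : ‖∫ x, (G s x - G 0 x) * deriv ψ x‖ ≤ d * A := by
      refine norm_integral_mul_le (ps.memLp_deriv.sub p0.memLp_deriv) hχ.memLp hd0 hA ?_
        hb.integral_le
      rw [hdd, (ps.sub p0).h1Norm_sq]
      have : 0 ≤ ∫ x, ‖U s x - U 0 x‖ ^ 2 := integral_nonneg fun _ => by positivity
      simp only [Pi.sub_apply]
      linarith
    have b2 : ‖∫ x, (forcing V (U s) x - forcing V (U 0) x) * ψ x‖ ≤ K * d * B := by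
      refine (norm_integral_le_of_norm_le (h.integrable_weight.const_mul
        ((5 * M ^ 4 + 1) * (2 * d) * (B * (1 + a ^ 2) ^ 2)))
        (Eventually.of_forall fun x => ?_)).trans_eq ?_
      · rw [norm_mul]
        calc _ ≤ (5 * M ^ 4 + 1) * (2 * d) * (1 + |V x|) * (B * (1 + a ^ 2) ^ 2 * decay x) :=
              mul_le_mul (norm_forcing_sub_le (h.norm_le_add_one hsJ h.zero_mem hd1 x)
                (by linarith [p0.norm_le x]) (h.norm_sub_le hsJ h.zero_mem x))
                (hχ.norm_le_mul_decay hb x) (norm_nonneg _) (by positivity)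
          _ = _ := by ring
      · rw [integral_const_mul]; ring
    have hdK : (K + 1) * d ≤ ε := by
      rw [le_div_iff₀ (by positivity)] at hd2; linarith
    have hdA : d * A ≤ ε * A := by
      gcongr; nlinarith
    have hdB : K * d * B ≤ ε * B := by
      gcongr; nlinarith
    linarith
  have key := (convex_Icc (-|t|) |t|).norm_image_sub_le_of_norm_hasDerivWithin_le
    (fun s hs => (hd s hs).hasDerivWithinAt) hbd
    (show (0 : ℝ) ∈ Icc (-|t|) |t| by simp) (⟨neg_abs_le t, le_abs_self t⟩)
  have p0 := h.pair 0 h.zero_mem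
  have pt := h.pair t (hc t (by simpa using ht)).1
  have hcs := hχ.hasCompactSupport
  have e2 : defect V U G t ψ (deriv ψ) = (∫ x, U t x * ψ x) - t * rhs V U G 0 ψ (deriv ψ) -
      ((∫ x, U 0 x * ψ x) - (0 : ℝ) * rhs V U G 0 ψ (deriv ψ)) := by
    simp only [defect, sub_mul]
    rw [integral_sub (integrable_mul_of_memLp_two pt.memLp
        (hψ.continuous.memLp_of_hasCompactSupport hcs))
      (integrable_mul_of_memLp_two p0.memLp (hψ.continuous.memLp_of_hasCompactSupport hcs))]
    simp
    ring
  rw [e2]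
  refine key.trans_eq ?_
  rw [sub_zero, Real.norm_eq_abs]; ring

end IsWeakFlow

/-! ### Smooth approximation of compactly supported `H¹` functions -/

theorem integral_norm_sq_le_of_eLpNorm_le {f : ℝ → ℂ} (hf : MemLp f 2) {r : ℝ} (hr : 0 ≤ r)
    (h : eLpNorm f 2 ≤ ENNReal.ofReal r) : ∫ x, ‖f x‖ ^ 2 ≤ r ^ 2 := by
  rw [hf.eLpNorm_eq_integral_rpow_norm (by simp) (by simp), ENNReal.ofReal_le_ofReal_iff hr] at h
  simp only [ENNReal.toReal_ofNat, Real.rpow_ofNat, ← one_div, ← Real.sqrt_eq_rpow] at h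
  exact (Real.sqrt_le_left hr).mp h

theorem integral_Icc_norm_le {f : ℝ → ℂ} (hf : MemLp f 2) {A b : ℝ} (hA : 0 ≤ A) (hb : 0 ≤ b)
    (h : ∫ x, ‖f x‖ ^ 2 ≤ A ^ 2) : ∫ x in Icc (-b) b, ‖f x‖ ≤ √(2 * b) * A := by
  have hg : MemLp (indicator (Icc (-b) b) fun _ => (1 : ℂ)) 2 :=
    memLp_indicator_const 2 measurableSet_Icc 1 (Or.inr (by simp))
  have h2 : ∫ x, ‖indicator (Icc (-b) b) (fun _ => (1 : ℂ)) x‖ ^ 2 ≤ √(2 * b) ^ 2 := by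
    have : ∀ x, ‖indicator (Icc (-b) b) (fun _ => (1 : ℂ)) x‖ ^ 2 =
        indicator (Icc (-b) b) (fun _ => (1 : ℝ)) x := fun x => by
      by_cases hx : x ∈ Icc (-b) b <;> simp [hx]
    simp only [this]
    rw [integral_indicator measurableSet_Icc, Real.sq_sqrt (by positivity)]
    simp [hb]
    linarith
  have := integral_norm_mul_norm_le hg hf (Real.sqrt_nonneg _) hA h2 h
  rw [← integral_indicator measurableSet_Icc]
  refine le_of_eq_of_le (integral_congr_ae (Eventually.of_forall fun x => ?_)) this
  by_cases hx : x ∈ Icc (-b) b <;> simp [hx]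

/-- Smooth functions are dense among compactly supported `H¹` functions. -/
theorem IsTestPair.exists_contDiff {a : ℝ} (ha : 0 < a) {χ χ' : ℝ → ℂ} (hχ : IsTestPair a χ χ')
    {η : ℝ} (hη : 0 < η) : ∃ ψ : ℝ → ℂ, ContDiff ℝ ∞ ψ ∧ (∀ x, a + 1 ≤ |x| → ψ x = 0) ∧
      IsTestBound (fun x => χ x - ψ x) (fun x => χ' x - deriv ψ x) η η := by
  obtain ⟨β, hβ, hβc, hβ0, hβ1⟩ := exists_contDiff_integral_eq_one
  let θ : ContDiffBump (0 : ℝ) := ⟨a, a + 1, ha, by linarith⟩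
  set N := ∫ x, ‖β x‖ ^ 2 with hN
  have hN0 : 0 ≤ N := integral_nonneg fun _ => by positivity
  set S := √(2 * (a + 1)) with hS
  have hS0 : 0 ≤ S := Real.sqrt_nonneg _
  set Q := 1 + S * √N with hQ
  have hQ1 : 1 ≤ Q := by
    have : 0 ≤ S * √N := by positivity
    linarith
  -- `Q` pays for correcting the mean of the approximate derivative, and `1 + S` covers both the
  -- `L²` bound on the derivative and, through Cauchy–Schwarz on `[-(a+1), a+1]`, the sup bound on
  -- its primitive.
  set r := η / (Q * (1 + S)) with hr
  have hr0 : 0 < r := by positivity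
  obtain ⟨g, hgc, hg, hgn⟩ := hχ.memLp.exist_eLpNorm_sub_le (by simp) (by norm_num) hr0
  have hθ : ContDiff ℝ ∞ (θ : ℝ → ℝ) := θ.contDiff
  have hgm : MemLp g 2 := hg.continuous.memLp_of_hasCompactSupport hgc
  have hdiff : MemLp (fun x => χ' x - g x) 2 := hχ.memLp.sub hgm
  have hgr : ∫ x, ‖χ' x - g x‖ ^ 2 ≤ r ^ 2 :=
    integral_norm_sq_le_of_eLpNorm_le hdiff hr0.le hgn
  -- the truncated approximation of the derivative
  set k : ℝ → ℂ := fun x => (θ x : ℂ) * g x with hk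
  have hks : ContDiff ℝ ∞ k := (Complex.ofRealCLM.contDiff.comp hθ).mul hg
  have hk0 : ∀ x, a + 1 ≤ |x| → k x = 0 := fun x hx => by
    have : θ x = 0 := θ.zero_of_le_dist (by simpa using hx)
    simp [hk, this]
  have hkc : HasCompactSupport k := hgc.mul_left
  have hkm : MemLp k 2 := hks.continuous.memLp_of_hasCompactSupport hkc
  have hkr : ∀ x, ‖χ' x - k x‖ ≤ ‖χ' x - g x‖ := by
    intro x
    -- Since `θ = 1` where `χ'` may be nonzero, truncation does not increase the error.
    have e : χ' x - k x = (θ x : ℂ) * (χ' x - g x) := by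
      rcases le_or_gt |x| a with hx | hx
      · have : θ x = 1 := θ.one_of_mem_closedBall (by simpa using hx)
        simp [hk, this]
      · simp [hk, hχ.zero_deriv x hx]
    rw [e, norm_mul, Complex.norm_real, Real.norm_of_nonneg θ.nonneg]
    exact mul_le_of_le_one_left (norm_nonneg _) θ.le_one
  have hkdiff : MemLp (fun x => χ' x - k x) 2 := hχ.memLp.sub hkm
  have hkr2 : ∫ x, ‖χ' x - k x‖ ^ 2 ≤ r ^ 2 :=
    (integral_mono (integrable_norm_sq hkdiff) (integrable_norm_sq hdiff)
      fun x => by dsimp only; gcongr; exact hkr x).trans hgr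
  have hint0 : ∫ x in (-(a + 1))..(a + 1), χ' x = 0 := by
    rw [← hχ.prim.sub_eq, hχ.zero _ (by rw [abs_of_pos] <;> linarith),
      hχ.zero _ (by rw [abs_neg, abs_of_pos] <;> linarith), sub_zero]
  have hle : -(a + 1) ≤ a + 1 := by linarith
  have hbound : ∀ (f : ℝ → ℂ) (A : ℝ), MemLp f 2 → 0 ≤ A → ∫ x, ‖f x‖ ^ 2 ≤ A ^ 2 →
      ∀ x ∈ Icc (-(a + 1)) (a + 1), ‖∫ t in (-(a + 1))..x, f t‖ ≤ S * A := by
    intro f A hf hA hfA x hx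
    refine le_trans ?_ (integral_Icc_norm_le hf hA (by linarith) hfA)
    refine (intervalIntegral.norm_integral_le_integral_norm_uIoc).trans ?_
    rw [uIoc_of_le hx.1]
    refine setIntegral_mono_set ?_ (Eventually.of_forall fun _ => norm_nonneg _)
      (Eventually.of_forall fun y hy => ⟨hy.1.le, hy.2.trans hx.2⟩)
    exact ((hf.locallyIntegrable (by norm_num)).integrableOn_isCompact isCompact_Icc).norm
  set m := ∫ x, k x with hm
  have hmn : ‖m‖ ≤ S * r := by
    have e : m = -∫ x in (-(a + 1))..(a + 1), (χ' x - k x) := by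
      rw [intervalIntegral.integral_sub (hχ.prim.intervalIntegrable _ _)
        (hks.continuous.intervalIntegrable _ _), hint0, hm,
        integral_eq_intervalIntegral (a := a + 1) (by linarith) (fun x hx => hk0 x hx.le)]
      simp
    rw [e, norm_neg]
    exact hbound _ r hkdiff hr0.le hkr2 _ (right_mem_Icc.mpr hle)
  -- Zero mean makes the primitive compactly supported. The correction is small because `χ'` itself
  -- has zero mean, so `m` only sees `χ' - k`.
  set p : ℝ → ℂ := fun x => k x - m * β x with hp
  have hps : ContDiff ℝ ∞ p := hks.sub (contDiff_const.mul (Complex.ofRealCLM.contDiff.comp hβ))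
  have hp0 : ∀ x, a + 1 ≤ |x| → p x = 0 := fun x hx => by
    simp [hp, hk0 x hx, hβ0 x (by linarith)]
  have hβi : Integrable (fun x => (β x : ℂ)) :=
    (hβ.continuous.integrable_of_hasCompactSupport hβc).ofReal
  have hpi : ∫ x, p x = 0 := by
    rw [hp, integral_sub (hks.continuous.integrable_of_hasCompactSupport hkc) (hβi.const_mul m),
      integral_const_mul, integral_complex_ofReal, hβ1]
    simp [hm]
  obtain ⟨ψ, hψs, hψ0, hψd⟩ := exists_contDiff_primitive (by linarith) hps hp0 hpi
  have hψderiv : deriv ψ = p := funext fun x => (hψd x).deriv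
  have hβm : MemLp (fun x => m * (β x : ℂ)) 2 :=
    ((Complex.continuous_ofReal.comp hβ.continuous).memLp_of_hasCompactSupport
      (hβc.comp_left Complex.ofReal_zero)).const_mul m
  have hβn : ∫ x, ‖m * (β x : ℂ)‖ ^ 2 ≤ (S * r * √N) ^ 2 := by
    simp only [norm_mul, mul_pow, Complex.norm_real]
    rw [integral_const_mul, Real.sq_sqrt hN0, ← mul_pow]
    gcongr
  have hpd : MemLp (fun x => χ' x - p x) 2 := by
    have := hkdiff.add hβm
    refine this.ae_eq (Eventually.of_forall fun x => ?_)
    simp only [hp, Pi.add_apply]; ring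
  have hpn : ∫ x, ‖χ' x - p x‖ ^ 2 ≤ (r * Q) ^ 2 := by
    have := integral_norm_add_sq_le hkdiff hβm hr0.le (by positivity) hkr2 hβn
    refine le_trans (le_of_eq ?_) (this.trans_eq ?_)
    · refine integral_congr_ae (Eventually.of_forall fun x => ?_)
      simp only [hp]; congr 2; ring
    · rw [hQ]; ring
  have hη1 : r * Q * (1 + S) = η := by
    rw [hr]; field_simp
  have hrQ : 0 ≤ r * Q := by positivity
  refine ⟨ψ, hψs, hψ0, hη.le, hη.le, ?_, fun x => ?_⟩
  · rw [hψderiv]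
    refine hpn.trans ?_
    gcongr
    nlinarith
  · rcases le_total (a + 1) |x| with hx | hx
    · rw [hψ0 x hx, hχ.zero x (by linarith), sub_zero, norm_zero]; exact hη.le
    · have hprim := hχ.prim.sub (isPrimitive_of_hasDerivAt hψd hps.continuous)
      have h1 := hprim.sub_eq (-(a + 1)) x
      have h2 : a + 1 ≤ |(-(a + 1))| := by rw [abs_neg]; exact le_abs_self _
      rw [hψ0 _ h2, hχ.zero (-(a + 1)) (by linarith), sub_zero, sub_zero] at h1
      rw [h1]
      refine (hbound _ (r * Q) hpd hrQ hpn x (abs_le.mp hx)).trans ?_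
      nlinarith

namespace IsWeakFlow

variable {V : ℝ → ℝ} {J : Set ℝ} {U G : ℝ → ℝ → ℂ}

theorem norm_defect_le (h : IsWeakFlow V J U G) {a : ℝ} (ha : 0 < a) {ε : ℝ} (hε : 0 < ε) :
    ∃ δ > 0, ∀ t, |t| < δ → t ∈ J ∧ ∀ (χ χ' : ℝ → ℂ) (A B : ℝ), IsTestPair a χ χ' →
      IsTestBound χ χ' A B → ‖defect V U G t χ χ'‖ ≤ ε * |t| * (A + B) := by
  obtain ⟨δ, hδ, hs⟩ := h.norm_defect_smooth_le (a + 1) hε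
  obtain ⟨C, hC, hR⟩ := h.exists_norm_rhs_le (a + 1)
  refine ⟨δ, hδ, fun t ht => ⟨(hs t ht).1, fun χ χ' A B hχ hb => ?_⟩⟩
  obtain ⟨htJ, hst⟩ := hs t ht
  have hA := hb.nonneg_deriv
  have hB := hb.nonneg
  set d := h1Norm (fun x => U t x - U 0 x) with hd
  have hd0 : 0 ≤ d := h1Norm_nonneg _
  have hD0 : 0 ≤ ∫ x, decay x := integral_nonneg fun x => (decay_pos x).le
  -- `Z` collects the coefficients of the approximation error `η`. With `t` fixed, `η → 0` leaves
  -- the bound of the smooth case unchanged.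
  set Z := 2 * (ε * |t|) + 2 * d * (1 + (a + 1) ^ 2) ^ 2 * (∫ x, decay x) + |t| * (C * 2) with hZ
  have hZ0 : 0 ≤ Z := by positivity
  have hχ1 := hχ.mono (show a ≤ a + 1 by linarith)
  have hc : MemLp (fun x => U t x - U 0 x) 2 :=
    (h.pair t htJ).memLp.sub (h.pair 0 h.zero_mem).memLp
  refine le_of_forall_pos_le_add fun ε' hε' => ?_
  set η := ε' / (Z + 1) with hη
  have hη0 : 0 < η := by positivity
  obtain ⟨ψ, hψ, hψ0, hψb⟩ := hχ.exists_contDiff ha hη0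
  have hψt := isTestPair_deriv hψ hψ0
  have hψb' : IsTestBound ψ (deriv ψ) (A + η) (B + η) := by
    refine ⟨by positivity, by positivity, ?_, fun x => ?_⟩
    · have hm : MemLp (fun x => -(χ' x - deriv ψ x)) 2 := (hχ.memLp.sub hψt.memLp).neg
      have := integral_norm_add_sq_le hχ.memLp hm hA hη0.le hb.integral_le
        (by simpa only [norm_neg] using hψb.integral_le)
      simpa using this
    · have h1 := norm_sub_norm_le (ψ x) (χ x)
      rw [norm_sub_rev] at h1
      linarith [hb.norm_le x, hψb.norm_le x]
  have hdiff := hχ1.sub hψt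
  have m1 : MemLp χ 2 := hχ.prim.continuous.memLp_of_hasCompactSupport hχ.hasCompactSupport
  have m2 : MemLp ψ 2 := hψ.continuous.memLp_of_hasCompactSupport hψt.hasCompactSupport
  have e : defect V U G t χ χ' = defect V U G t ψ (deriv ψ) +
      ((∫ x, (U t x - U 0 x) * (χ x - ψ x)) -
        t * rhs V U G 0 (fun x => χ x - ψ x) (fun x => χ' x - deriv ψ x)) := by
    rw [h.rhs_sub hχ1 hb hψt hψb', defect, defect]
    simp only [mul_sub]
    rw [integral_sub (integrable_mul_of_memLp_two hc m1) (integrable_mul_of_memLp_two hc m2)]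
    ring
  have b1 := hst ψ _ _ hψ hψ0 hψb'
  have b2 : ‖∫ x, (U t x - U 0 x) * (χ x - ψ x)‖ ≤
      2 * d * (1 + (a + 1) ^ 2) ^ 2 * (∫ x, decay x) * η := by
    refine (norm_integral_le_of_norm_le (integrable_decay.const_mul
      (2 * d * (η * (1 + (a + 1) ^ 2) ^ 2))) (Eventually.of_forall fun x => ?_)).trans_eq ?_
    · rw [norm_mul]
      calc _ ≤ (2 * d) * (η * (1 + (a + 1) ^ 2) ^ 2 * decay x) :=
            mul_le_mul (h.norm_sub_le htJ h.zero_mem x) (hdiff.norm_le_mul_decay hψb x)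
              (norm_nonneg _) (by positivity)
        _ = _ := by ring
    · rw [integral_const_mul]; ring
  have b3 : ‖(t : ℂ) * rhs V U G 0 (fun x => χ x - ψ x) (fun x => χ' x - deriv ψ x)‖ ≤
      |t| * (C * (η + η)) := by
    rw [norm_mul, Complex.norm_real, Real.norm_eq_abs]
    gcongr
    exact hR _ _ _ _ hdiff hψb
  have hZη : Z * η ≤ ε' := by
    calc Z * η ≤ (Z + 1) * η := by gcongr; linarith
      _ = ε' := by rw [hη]; field_simp
  rw [e]
  refine (norm_add_le _ _).trans ((add_le_add b1 ((_root_.norm_sub_le _ _).trans (add_le_add b2 b3))).trans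
    ?_)
  rw [hZ] at hZη
  nlinarith

end IsWeakFlow

/-- `w` is a `C¹` function with derivative `φ`, supported in `[-a, a]`. -/
structure IsLocalWeight (a : ℝ) (w φ : ℝ → ℝ) : Prop where
  pos : 0 < a
  hasDerivAt : ∀ x, HasDerivAt w (φ x) x
  continuous_deriv : Continuous φ
  zero : ∀ x, a ≤ |x| → w x = 0

namespace IsLocalWeight

variable {a : ℝ} {w φ : ℝ → ℝ}

theorem zero_deriv (h : IsLocalWeight a w φ) {x : ℝ} (hx : a < |x|) : φ x = 0 := by
  rw [← (h.hasDerivAt x).deriv]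
  exact deriv_eq_zero_of_abs_gt h.zero hx

theorem continuous (h : IsLocalWeight a w φ) : Continuous w :=
  continuous_iff_continuousAt.mpr fun x => (h.hasDerivAt x).continuousAt

theorem exists_bound (h : IsLocalWeight a w φ) :
    ∃ P, 0 ≤ P ∧ (∀ x, |w x| ≤ P) ∧ ∀ x, |φ x| ≤ P := by
  obtain ⟨P₁, h₁⟩ := isCompact_Icc (a := -a) (b := a) |>.exists_bound_of_continuousOn
    h.continuous.continuousOn
  obtain ⟨P₂, h₂⟩ := isCompact_Icc (a := -a) (b := a) |>.exists_bound_of_continuousOn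
    h.continuous_deriv.continuousOn
  refine ⟨max 0 (max P₁ P₂), le_max_left _ _, fun x => ?_, fun x => ?_⟩
  · rcases le_or_gt |x| a with hx | hx
    · exact (h₁ x (abs_le.mp hx)).trans ((le_max_left _ _).trans (le_max_right _ _))
    · rw [h.zero x hx.le, abs_zero]; exact le_max_left _ _
  · rcases le_or_gt |x| a with hx | hx
    · exact (h₂ x (abs_le.mp hx)).trans ((le_max_right _ _).trans (le_max_right _ _))
    · rw [h.zero_deriv hx, abs_zero]; exact le_max_left _ _

theorem isTestPair (h : IsLocalWeight a w φ) {f g : ℝ → ℂ} (hf : IsH1Pair f g) :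
    IsTestPair a (fun x => w x * starRingEnd ℂ (f x))
      (fun x => w x * starRingEnd ℂ (g x) + φ x * starRingEnd ℂ (f x)) := by
  have hw := (isPrimitive_of_hasDerivAt h.hasDerivAt h.continuous_deriv).ofReal
  have hp := hw.mul hf.prim.conj
  obtain ⟨P, hP, hw', hφ'⟩ := h.exists_bound
  refine ⟨hp, ?_, fun x hx => by simp [h.zero x hx], fun x hx => by
    simp [h.zero x hx.le, h.zero_deriv hx]⟩
  have m1 : MemLp (fun x => (w x : ℂ) * starRingEnd ℂ (g x)) 2 := by
    refine MemLp.of_le_mul (c := P) hf.memLp_deriv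
      ((Complex.continuous_ofReal.comp h.continuous).aestronglyMeasurable.mul
        (Complex.continuous_conj.comp_aestronglyMeasurable hf.memLp_deriv.1))
      (Eventually.of_forall fun x => ?_)
    rw [norm_mul, RCLike.norm_conj, Complex.norm_real]
    gcongr; exact hw' x
  have m2 : MemLp (fun x => (φ x : ℂ) * starRingEnd ℂ (f x)) 2 := by
    refine MemLp.of_le_mul (c := P) hf.memLp
      ((Complex.continuous_ofReal.comp h.continuous_deriv).aestronglyMeasurable.mul
        (Complex.continuous_conj.comp_aestronglyMeasurable hf.memLp.1))
      (Eventually.of_forall fun x => ?_)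
    rw [norm_mul, RCLike.norm_conj, Complex.norm_real]
    gcongr; exact hφ' x
  exact m1.add m2

theorem isTestBound (h : IsLocalWeight a w φ) {P : ℝ} (hP : 0 ≤ P) (hw : ∀ x, |w x| ≤ P)
    (hφ : ∀ x, |φ x| ≤ P) {f g : ℝ → ℂ} (hf : IsH1Pair f g) :
    IsTestBound (fun x => w x * starRingEnd ℂ (f x))
      (fun x => w x * starRingEnd ℂ (g x) + φ x * starRingEnd ℂ (f x))
      (2 * P * h1Norm f) (2 * P * h1Norm f) := by
  have h0 := h1Norm_nonneg f
  refine ⟨by positivity, by positivity, ?_, fun x => ?_⟩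
  · have i1 := integrable_norm_sq hf.memLp
    have i2 := integrable_norm_sq hf.memLp_deriv
    rw [mul_pow, hf.h1Norm_sq, ← integral_add i1 i2, ← integral_const_mul]
    refine integral_mono (integrable_norm_sq (h.isTestPair hf).memLp)
      ((i1.add i2).const_mul _) fun x => ?_
    have b : ‖(w x : ℂ) * starRingEnd ℂ (g x) + φ x * starRingEnd ℂ (f x)‖ ≤
        P * ‖g x‖ + P * ‖f x‖ := by
      refine (norm_add_le _ _).trans ?_
      simp only [norm_mul, RCLike.norm_conj, Complex.norm_real, Real.norm_eq_abs]
      gcongr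
      · exact hw x
      · exact hφ x
    calc _ ≤ (P * ‖g x‖ + P * ‖f x‖) ^ 2 := by gcongr
      _ ≤ _ := by nlinarith [mul_nonneg (sq_nonneg P) (sq_nonneg (‖g x‖ - ‖f x‖)),
          mul_nonneg (sq_nonneg P) (sq_nonneg ‖g x‖), mul_nonneg (sq_nonneg P) (sq_nonneg ‖f x‖)]
  · rw [norm_mul, RCLike.norm_conj, Complex.norm_real, Real.norm_eq_abs]
    calc |w x| * ‖f x‖ ≤ P * (2 * h1Norm f) :=
          mul_le_mul (hw x) (hf.norm_le x) (norm_nonneg _) hP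
      _ = _ := by ring

theorem integrable_mul_norm_sq (h : IsLocalWeight a w φ) {f : ℝ → ℂ} (hf : Continuous f) :
    Integrable (fun x => w x * ‖f x‖ ^ 2) := by
  have hc : HasCompactSupport w := HasCompactSupport.intro (isCompact_Icc (a := -a) (b := a))
    fun x hx => h.zero x (by by_contra! hc; exact hx (abs_le.mp hc.le))
  exact (h.continuous.mul (by fun_prop)).integrable_of_hasCompactSupport hc.mul_right

end IsLocalWeight

/-! ### The derivative of a localized mass at the initial time -/

namespace IsWeakFlow

variable {V : ℝ → ℝ} {J : Set ℝ} {U G : ℝ → ℝ → ℂ}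

/-- Tested against `w ū`, the nonlinearity, the potential and `w|∂ₓu|²` all give real integrals,
which the factor `i` makes imaginary; only the term where the derivative falls on `w` survives. -/
theorem re_rhs_weight (h : IsWeakFlow V J U G) {a : ℝ} {w φ : ℝ → ℝ}
    (hw : IsLocalWeight a w φ) :
    (rhs V U G 0 (fun x => w x * starRingEnd ℂ (U 0 x))
      (fun x => w x * starRingEnd ℂ (G 0 x) + φ x * starRingEnd ℂ (U 0 x))).re =
      (∫ x, φ x * (G 0 x * starRingEnd ℂ (U 0 x))).im := by
  have p0 := h.pair 0 h.zero_mem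
  obtain ⟨P, hP, hwP, hφP⟩ := hw.exists_bound
  have hχ := hw.isTestPair p0
  have hb := hw.isTestBound hP hwP hφP p0
  have e1 : ((∫ x, forcing V (U 0) x * (w x * starRingEnd ℂ (U 0 x))).im) = 0 := by
    have hi := h.integrable_forcing_mul_test h.zero_mem hχ hb
    have := integral_im hi
    simp only [RCLike.im_to_complex] at this
    rw [← this]
    refine integral_eq_zero_of_ae (Eventually.of_forall fun x => ?_)
    have : forcing V (U 0) x * (w x * starRingEnd ℂ (U 0 x)) =
        (((‖U 0 x‖ ^ 4 - V x) * w x * ‖U 0 x‖ ^ 2 : ℝ) : ℂ) := by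
      have e2 : U 0 x * starRingEnd ℂ (U 0 x) = ((‖U 0 x‖ ^ 2 : ℝ) : ℂ) := by
        rw [Complex.mul_conj, Complex.normSq_eq_norm_sq]
      rw [forcing]
      push_cast at e2 ⊢
      linear_combination (((‖U 0 x‖ : ℂ) ^ 4 - V x) * w x) * e2
    dsimp only
    rw [this]
    exact Complex.ofReal_im _
  have e3 : (∫ x, G 0 x * (w x * starRingEnd ℂ (G 0 x) + φ x * starRingEnd ℂ (U 0 x))).im =
      (∫ x, φ x * (G 0 x * starRingEnd ℂ (U 0 x))).im := by
    have hi := integrable_mul_of_memLp_two p0.memLp_deriv hχ.memLp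
    have hi2 : Integrable (fun x => (φ x : ℂ) * (G 0 x * starRingEnd ℂ (U 0 x))) := by
      have m1 : MemLp (fun x => starRingEnd ℂ (U 0 x)) 2 := p0.memLp.star
      refine (integrable_mul_of_memLp_two p0.memLp_deriv m1).bdd_mul
        (Complex.continuous_ofReal.comp hw.continuous_deriv).aestronglyMeasurable (c := P)
        (Eventually.of_forall fun x => ?_)
      rw [Complex.norm_real]; exact hφP x
    have t1 := integral_im hi
    have t2 := integral_im hi2
    simp only [RCLike.im_to_complex] at t1 t2
    rw [← t1, ← t2]
    refine integral_congr_ae (Eventually.of_forall fun x => ?_)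
    simp
    ring
  rw [rhs]
  simp only [Complex.mul_re, Complex.I_re, Complex.I_im, Complex.add_im, Complex.neg_im, e1, e3]
  ring

/-- The time derivative of a localized mass. -/
theorem hasDerivAt_localMass (h : IsWeakFlow V J U G) {a : ℝ} {w φ : ℝ → ℝ}
    (hw : IsLocalWeight a w φ) :
    HasDerivAt (fun t => ∫ x, w x * ‖U t x‖ ^ 2)
      (2 * (∫ x, φ x * (G 0 x * starRingEnd ℂ (U 0 x))).im) 0 := by
  have p0 := h.pair 0 h.zero_mem
  obtain ⟨P, hP, hwP, hφP⟩ := hw.exists_bound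
  obtain ⟨C, hC, hR⟩ := h.exists_norm_rhs_le a
  set N := 2 * P * h1Norm (U 0) with hN
  have hN0 : 0 ≤ N := by have := h1Norm_nonneg (U 0); positivity
  rw [hasDerivAt_iff_isLittleO, Asymptotics.isLittleO_iff]
  intro ε hε
  set ε₁ := ε / (8 * (N + 1)) with hε₁
  have hε₁0 : 0 < ε₁ := by positivity
  obtain ⟨δ₁, hδ₁, hdef⟩ := h.norm_defect_le hw.pos hε₁0
  obtain ⟨δ₂, hδ₂, hclose⟩ := h.eventually_close h.zero_mem
    (show 0 < ε / (8 * ((ε₁ + C) * P + 1)) by positivity)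
  filter_upwards [Metric.ball_mem_nhds (0 : ℝ) (lt_min hδ₁ hδ₂)] with t ht
  rw [Metric.mem_ball, Real.dist_eq, sub_zero] at ht
  obtain ⟨htJ, hdt⟩ := hdef t (ht.trans_le (min_le_left _ _))
  have hd := (hclose t (by rw [sub_zero]; exact ht.trans_le (min_le_right _ _))).2
  set d := h1Norm (fun x => U t x - U 0 x) with hdd
  have hd0 : 0 ≤ d := h1Norm_nonneg _
  have pt := h.pair t htJ
  have pc := pt.sub p0
  have b1 := hdt _ _ _ _ (hw.isTestPair p0) (hw.isTestBound hP hwP hφP p0)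
  have b2 := hdt _ _ _ _ (hw.isTestPair pc) (hw.isTestBound hP hwP hφP pc)
  have b3 := hR _ _ _ _ (hw.isTestPair pc) (hw.isTestBound hP hwP hφP pc)
  have hre := h.re_rhs_weight hw
  set L₀ := rhs V U G 0 (fun x => w x * starRingEnd ℂ (U 0 x))
      (fun x => w x * starRingEnd ℂ (G 0 x) + φ x * starRingEnd ℂ (U 0 x)) with hL₀
  set L₁ := rhs V U G 0 (fun x => w x * starRingEnd ℂ (U t x - U 0 x))
      (fun x => w x * starRingEnd ℂ (G t x - G 0 x) + φ x * starRingEnd ℂ (U t x - U 0 x)) with hL₁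
  have i1 : Integrable (fun x => (U t x - U 0 x) * (w x * starRingEnd ℂ (U 0 x))) :=
    integrable_mul_of_memLp_two pc.memLp ((hw.isTestPair p0).prim.continuous.memLp_of_hasCompactSupport
      (hw.isTestPair p0).hasCompactSupport)
  have i2 : Integrable (fun x => (U t x - U 0 x) * (w x * starRingEnd ℂ (U t x - U 0 x))) :=
    integrable_mul_of_memLp_two pc.memLp ((hw.isTestPair pc).prim.continuous.memLp_of_hasCompactSupport
      (hw.isTestPair pc).hasCompactSupport)
  -- Based on `|U_t|² - |U_0|² = |U_t - U_0|² + 2 Re((U_t - U_0) conj U_0)`. The quadratic part is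
  -- treated as a pairing with the test function `w conj(U_t - U_0)`, whose size tends to `0` in
  -- `H¹`; the uniform defect bound therefore makes it `o(t)`.
  have e : (∫ x, w x * ‖U t x‖ ^ 2) - (∫ x, w x * ‖U 0 x‖ ^ 2) -
      (t - 0) • (2 * (∫ x, φ x * (G 0 x * starRingEnd ℂ (U 0 x))).im) =
      (defect V U G t (fun x => w x * starRingEnd ℂ (U t x - U 0 x))
        (fun x => w x * starRingEnd ℂ (G t x - G 0 x) + φ x * starRingEnd ℂ (U t x - U 0 x)) +
        t * L₁ + 2 * defect V U G t (fun x => w x * starRingEnd ℂ (U 0 x))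
        (fun x => w x * starRingEnd ℂ (G 0 x) + φ x * starRingEnd ℂ (U 0 x))).re := by
    rw [← hre, ← integral_sub (hw.integrable_mul_norm_sq pt.prim.continuous)
      (hw.integrable_mul_norm_sq p0.prim.continuous), defect, defect, ← hL₀, ← hL₁]
    have t1 := integral_re i1
    have t2 := integral_re i2
    simp only [RCLike.re_to_complex] at t1 t2
    have e2 : ∫ x, (w x * ‖U t x‖ ^ 2 - w x * ‖U 0 x‖ ^ 2) =
        (∫ x, (U t x - U 0 x) * (w x * starRingEnd ℂ (U t x - U 0 x))).re +
          2 * (∫ x, (U t x - U 0 x) * (w x * starRingEnd ℂ (U 0 x))).re := by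
      have j1 : Integrable (fun x => ((U t x - U 0 x) * (w x * starRingEnd ℂ (U 0 x))).re) := i1.re
      have j2 : Integrable (fun x =>
        ((U t x - U 0 x) * (w x * starRingEnd ℂ (U t x - U 0 x))).re) := i2.re
      rw [← t1, ← t2, ← integral_const_mul, ← integral_add j2 (j1.const_mul 2)]
      refine integral_congr_ae (Eventually.of_forall fun x => ?_)
      simp only [← Complex.normSq_eq_norm_sq, Complex.normSq_apply]
      simp
      ring
    rw [e2]
    simp only [sub_add_cancel, Complex.add_re, Complex.re_ofNat, Complex.im_ofNat, Complex.mul_re,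
      Complex.sub_re, Complex.ofReal_re, Complex.ofReal_im, smul_eq_mul]
    ring
  rw [e, Real.norm_eq_abs]
  refine (Complex.abs_re_le_norm _).trans ((norm_add_le _ _).trans (add_le_add (norm_add_le _ _)
    le_rfl |>.trans ?_))
  rw [norm_mul, norm_mul, Complex.norm_real, Complex.norm_ofNat, sub_zero, Real.norm_eq_abs]
  have c1 : ε₁ * (N + N) * 2 ≤ ε / 2 := by
    calc ε₁ * (N + N) * 2 ≤ ε₁ * (4 * (N + 1)) := by nlinarith
      _ = ε / 2 := by rw [hε₁]; field_simp; norm_num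
  have c2 : (ε₁ + C) * (2 * P * d + 2 * P * d) ≤ ε / 2 := by
    calc (ε₁ + C) * (2 * P * d + 2 * P * d) = 4 * ((ε₁ + C) * P) * d := by ring
      _ ≤ 4 * ((ε₁ + C) * P + 1) * (ε / (8 * ((ε₁ + C) * P + 1))) := by
          gcongr
          linarith
      _ = ε / 2 := by
          have : 0 < (ε₁ + C) * P + 1 := by positivity
          field_simp; norm_num
  have t0 := abs_nonneg t
  calc _ ≤ ε₁ * |t| * (2 * P * d + 2 * P * d) + |t| * (C * (2 * P * d + 2 * P * d)) +
        2 * (ε₁ * |t| * (N + N)) := by gcongr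
    _ = |t| * ((ε₁ + C) * (2 * P * d + 2 * P * d) + ε₁ * (N + N) * 2) := by ring
    _ ≤ |t| * (ε / 2 + ε / 2) := by gcongr
    _ = ε * |t| := by ring

end IsWeakFlow

/-! ### The localized virial estimate -/

theorem exists_ae_norm_le_of_memLp_top {f : ℝ → ℝ} (h : MemLp f ∞) :
    ∃ K, 0 ≤ K ∧ ∀ᵐ x, |f x| ≤ K := by
  refine ⟨(eLpNormEssSup f volume).toReal, ENNReal.toReal_nonneg, ?_⟩
  filter_upwards [enorm_ae_le_eLpNormEssSup f volume] with s hs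
  rw [← Real.norm_eq_abs, ← toReal_enorm]
  exact ENNReal.toReal_mono (by
    have := h.eLpNorm_ne_top; rwa [eLpNorm_exponent_top] at this) hs

theorem integrable_memLp_top_mul {f h : ℝ → ℝ} (hf : MemLp f ∞) (hh : Integrable h) :
    Integrable (fun x => f x * h x) := by
  obtain ⟨K, -, hK⟩ := exists_ae_norm_le_of_memLp_top hf
  exact hh.bdd_mul hf.1 hK

theorem LipschitzWith.isPrimitive {r : ℝ → ℝ} {K : NNReal} (hr : LipschitzWith K r) :
    IsPrimitive r (deriv r) := by
  refine isPrimitive_of_absolutelyContinuous ?_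
    (fun a b => (hr.lipschitzOnWith).absolutelyContinuousOnInterval) ?_
  · have : MemLp (deriv r) ∞ := memLp_top_of_bound (measurable_deriv r).aestronglyMeasurable K
      (Eventually.of_forall fun x => norm_deriv_le_of_lipschitz hr)
    exact this.locallyIntegrable (by simp)
  · filter_upwards [hr.ae_differentiableAt_real] with x hx using hx.hasDerivAt

theorem lipschitzWith_ramp_div {R : ℝ} (hR : 0 < R) :
    LipschitzWith (Real.toNNReal R⁻¹) (fun x => ramp (x / R)) := by
  refine LipschitzWith.of_dist_le_mul fun x y => ?_
  have h := lipschitzWith_ramp.dist_le_mul (x / R) (y / R)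
  rw [NNReal.coe_one, one_mul, Real.dist_eq (x / R), ← sub_div, abs_div, abs_of_pos hR] at h
  rw [Real.coe_toNNReal _ (by positivity), Real.dist_eq x]
  rw [inv_mul_eq_div]
  exact h

theorem ramp_div_eq_zero {R x : ℝ} (hR : 0 < R) (hx : |x| ≤ R) : ramp (x / R) = 0 :=
  ramp_eq_zero (by rw [abs_div, abs_of_pos hR]; exact (div_le_one hR).mpr hx)

theorem abs_deriv_ramp_div_le {R : ℝ} (hR : 0 < R) (x : ℝ) :
    |deriv (fun x => ramp (x / R)) x| ≤ R⁻¹ := by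
  have := norm_deriv_le_of_lipschitz (x₀ := x) (lipschitzWith_ramp_div hR)
  rwa [Real.norm_eq_abs, Real.coe_toNNReal _ (by positivity)] at this

theorem deriv_ramp_div_eq_zero {R x : ℝ} (hR : 0 < R) (hx : |x| < R) :
    deriv (fun x => ramp (x / R)) x = 0 := by
  have : (fun x => ramp (x / R)) =ᶠ[𝓝 x] fun _ => 0 := by
    filter_upwards [(isOpen_lt continuous_abs continuous_const).mem_nhds hx] with y hy
    exact ramp_div_eq_zero hR (le_of_lt hy)
  rw [this.deriv_eq]; simp

/-- The part of `f` outside of the ball of radius `R`. -/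
noncomputable def outer (R : ℝ) (f : ℝ → ℂ) : ℝ → ℂ := indicator {x | R ≤ |x|} f

theorem measurableSet_outer (R : ℝ) : MeasurableSet {x : ℝ | R ≤ |x|} :=
  (isClosed_le continuous_const continuous_abs).measurableSet

theorem memLp_outer {R : ℝ} {f : ℝ → ℂ} (hf : MemLp f 2) : MemLp (outer R f) 2 :=
  hf.indicator (measurableSet_outer R)

/-- The fundamental theorem of calculus for `ramp (x/R) |f|²` from `0`, where it vanishes. The
derivative of the ramp costs `1/R` and lives in `|x| ≥ R`; the other term is `2 (ramp |g|) |f|`,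
handled by Cauchy–Schwarz. -/
theorem ramp_mul_norm_sq_le {f g : ℝ → ℂ} (h : IsH1Pair f g) {R a S : ℝ} (hR : 0 < R)
    (ha : 0 ≤ a) (hS : 0 ≤ S) (h1 : ∫ x, ‖outer R f x‖ ^ 2 ≤ a ^ 2)
    (h2 : ∫ x, ramp (x / R) ^ 2 * ‖g x‖ ^ 2 ≤ S ^ 2) (x : ℝ) :
    ramp (x / R) * ‖f x‖ ^ 2 ≤ a ^ 2 / R + 2 * (S * a) := by
  have hrc : Continuous fun x => ramp (x / R) := (lipschitzWith_ramp_div hR).continuous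
  set g' : ℝ → ℂ := fun x => (ramp (x / R) : ℂ) * g x with hg'
  have hm1 := memLp_outer (R := R) h.memLp
  have hm2 : MemLp g' 2 := by
    refine h.memLp_deriv.of_le
      ((Complex.continuous_ofReal.comp hrc).aestronglyMeasurable.mul h.memLp_deriv.1)
      (Eventually.of_forall fun x => ?_)
    rw [hg', norm_mul, Complex.norm_real, Real.norm_of_nonneg (ramp_nonneg _)]
    exact mul_le_of_le_one_left (norm_nonneg _) (ramp_le_one _)
  have hn2 : ∫ x, ‖g' x‖ ^ 2 ≤ S ^ 2 := by
    refine le_of_eq_of_le (integral_congr_ae (Eventually.of_forall fun x => ?_)) h2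
    simp only [hg', norm_mul, Complex.norm_real, mul_pow, Real.norm_of_nonneg (ramp_nonneg _)]
  have hcs := integral_norm_mul_norm_le hm2 hm1 hS ha hn2 h1
  have hp := (LipschitzWith.isPrimitive (lipschitzWith_ramp_div hR)).smul (𝕂 := ℝ) h.prim.norm_sq
  have hx := hp.sub_eq 0 x
  simp only [zero_div, smul_eq_mul] at hx
  rw [ramp_eq_zero (by simp : |(0 : ℝ)| ≤ 1), zero_mul, sub_zero] at hx
  have i1 := integrable_norm_sq hm1
  have i2 : Integrable (fun x => ‖g' x‖ * ‖outer R f x‖) := hm2.norm.integrable_mul hm1.norm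
  have hi : Integrable (fun x => R⁻¹ * ‖outer R f x‖ ^ 2 + 2 * (‖g' x‖ * ‖outer R f x‖)) :=
    (i1.const_mul _).add (i2.const_mul 2)
  have hpt : ∀ x, ‖ramp (x / R) * (2 * (g x * starRingEnd ℂ (f x)).re) +
      deriv (fun x => ramp (x / R)) x * ‖f x‖ ^ 2‖ ≤
      R⁻¹ * ‖outer R f x‖ ^ 2 + 2 * (‖g' x‖ * ‖outer R f x‖) := by
    intro x
    -- The kink `|x| = R` belongs to the outer case, where only the Lipschitz bound on `deriv` is
    -- used.
    rcases lt_or_ge |x| R with hxR | hxR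
    · rw [ramp_div_eq_zero hR hxR.le, deriv_ramp_div_eq_zero hR hxR]
      simp only [zero_mul, add_zero, norm_zero]
      positivity
    · have e : outer R f x = f x := indicator_of_mem (by exact hxR) f
      rw [e, add_comm]
      refine (norm_add_le _ _).trans (add_le_add ?_ ?_)
      · rw [norm_mul, Real.norm_eq_abs, norm_pow, norm_norm]
        gcongr
        exact abs_deriv_ramp_div_le hR x
      · have h3 := Complex.abs_re_le_norm (g x * starRingEnd ℂ (f x))
        rw [norm_mul, RCLike.norm_conj] at h3
        simp only [hg', norm_mul, Real.norm_eq_abs, abs_two, Complex.norm_real]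
        calc |ramp (x / R)| * (2 * |(g x * starRingEnd ℂ (f x)).re|)
            ≤ |ramp (x / R)| * (2 * (‖g x‖ * ‖f x‖)) := by gcongr
          _ = _ := by ring
  rw [hx]
  refine (le_abs_self _).trans ?_
  rw [← Real.norm_eq_abs]
  refine intervalIntegral.norm_integral_le_integral_norm_uIoc.trans ?_
  have hle : ∫ x in uIoc 0 x, ‖ramp (x / R) * (2 * (g x * starRingEnd ℂ (f x)).re) +
      deriv (fun x => ramp (x / R)) x * ‖f x‖ ^ 2‖ ≤
      ∫ x in uIoc 0 x, (R⁻¹ * ‖outer R f x‖ ^ 2 + 2 * (‖g' x‖ * ‖outer R f x‖)) :=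
    integral_mono_of_nonneg (Eventually.of_forall fun _ => norm_nonneg _) hi.integrableOn
      (Eventually.of_forall hpt)
  refine hle.trans ((setIntegral_le_integral hi (Eventually.of_forall fun y => by
    simp only [Pi.zero_apply]; positivity)).trans ?_)
  rw [integral_add (i1.const_mul _) (i2.const_mul 2), integral_const_mul, integral_const_mul]
  have : R⁻¹ * ∫ x, ‖outer R f x‖ ^ 2 ≤ a ^ 2 / R := by
    rw [div_eq_inv_mul]; gcongr
  linarith

theorem IsH1Pair.integrable_norm_pow_six {f g : ℝ → ℂ} (h : IsH1Pair f g) :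
    Integrable (fun x => ‖f x‖ ^ 6) := by
  refine ((integrable_norm_sq h.memLp).const_mul ((2 * h1Norm f) ^ 4)).mono'
    (h.prim.continuous.norm.pow 6).aestronglyMeasurable (Eventually.of_forall fun x => ?_)
  rw [norm_pow, norm_norm]
  calc ‖f x‖ ^ 6 = ‖f x‖ ^ 4 * ‖f x‖ ^ 2 := by ring
    _ ≤ (2 * h1Norm f) ^ 4 * ‖f x‖ ^ 2 := by gcongr; exact h.norm_le x

/-- The localized Gagliardo–Nirenberg inequality. -/
theorem integral_mul_norm_pow_six_le {f g : ℝ → ℂ} (h : IsH1Pair f g) {ρ : ℝ → ℝ}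
    (hρ : MemLp ρ ∞) {R a B : ℝ} (hR : 0 < R) (ha : 0 ≤ a)
    (hρ1 : ∀ᵐ x, ramp (x / R) ^ 2 ≤ ρ x ∧ ρ x ≤ B * ramp (x / R) ^ 2) (hB : 0 ≤ B)
    (h1 : ∫ x, ‖outer R f x‖ ^ 2 ≤ a ^ 2) :
    ∫ x, ρ x * ‖f x‖ ^ 6 ≤ B * (2 * a ^ 4 / R ^ 2 + 8 * a ^ 2 * ∫ x, ρ x * ‖g x‖ ^ 2) * a ^ 2 := by
  have hm1 := memLp_outer (R := R) h.memLp
  set T := ∫ x, ρ x * ‖g x‖ ^ 2 with hT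
  have iT := integrable_memLp_top_mul hρ (integrable_norm_sq h.memLp_deriv)
  have hT1 : ∫ x, ramp (x / R) ^ 2 * ‖g x‖ ^ 2 ≤ T := by
    refine integral_mono_of_nonneg (Eventually.of_forall fun x => by
      simp only [Pi.zero_apply]; positivity) iT ?_
    filter_upwards [hρ1] with x hx
    gcongr
    exact hx.1
  have hT0 : 0 ≤ T := (integral_nonneg fun x => by positivity).trans hT1
  have hsup := ramp_mul_norm_sq_le h hR ha (Real.sqrt_nonneg T) h1 (by rwa [Real.sq_sqrt hT0])
  set K := a ^ 2 / R + 2 * (√T * a) with hK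
  have hK0 : 0 ≤ K := by positivity
  have hK2 : K ^ 2 ≤ 2 * a ^ 4 / R ^ 2 + 8 * a ^ 2 * T := by
    calc K ^ 2 ≤ 2 * (a ^ 2 / R) ^ 2 + 2 * (2 * (√T * a)) ^ 2 := by
          rw [hK]; nlinarith [sq_nonneg (a ^ 2 / R - 2 * (√T * a))]
      _ = 2 * a ^ 4 / R ^ 2 + 8 * a ^ 2 * T := by
          rw [mul_pow, mul_pow, Real.sq_sqrt hT0, div_pow]; ring
  calc ∫ x, ρ x * ‖f x‖ ^ 6 ≤ ∫ x, B * K ^ 2 * ‖outer R f x‖ ^ 2 := by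
        refine integral_mono_ae (integrable_memLp_top_mul hρ h.integrable_norm_pow_six)
          ((integrable_norm_sq hm1).const_mul _) ?_
        filter_upwards [hρ1] with x hx
        rcases lt_or_ge |x| R with hxR | hxR
        · rw [ramp_div_eq_zero hR hxR.le] at hx
          -- Both bounds on `ρ` degenerate inside the ball.
          have : ρ x = 0 := by linarith [hx.1, hx.2]
          rw [this, zero_mul]; positivity
        · have e : outer R f x = f x := indicator_of_mem (by exact hxR) f
          rw [e]
          calc ρ x * ‖f x‖ ^ 6 ≤ B * ramp (x / R) ^ 2 * ‖f x‖ ^ 6 := by gcongr; exact hx.2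
            _ = B * (ramp (x / R) * ‖f x‖ ^ 2) ^ 2 * ‖f x‖ ^ 2 := by ring
            _ ≤ B * K ^ 2 * ‖f x‖ ^ 2 := by
              have := ramp_nonneg (x / R)
              gcongr
              exact hsup x
    _ = B * K ^ 2 * ∫ x, ‖outer R f x‖ ^ 2 := integral_const_mul _ _
    _ ≤ B * (2 * a ^ 4 / R ^ 2 + 8 * a ^ 2 * T) * a ^ 2 := by
        gcongr

/-- The virial functional is controlled by the energy as long as the mass outside of the ball of
radius `R` is small. -/
theorem virial_rhs_le {f g : ℝ → ℂ} (h : IsH1Pair f g) {V φ φ₁ φ₃ : ℝ → ℝ} (hφ₁ : MemLp φ₁ ∞)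
    {R a B K : ℝ} (hR : 0 < R) (ha : 0 ≤ a) (hB : 0 ≤ B)
    (hρ1 : ∀ᵐ x, ramp (x / R) ^ 2 ≤ 2 - φ₁ x ∧ 2 - φ₁ x ≤ B * ramp (x / R) ^ 2)
    (hφ₃ : ∀ᵐ x, |φ₃ x| ≤ K)
    (h1 : ∫ x, ‖outer R f x‖ ^ 2 ≤ a ^ 2) (ha1 : a ≤ 1) (haB : 8 * B * a ^ 4 ≤ 3)
    (hV : Integrable (fun x => V x * ‖f x‖ ^ 2))
    (hV' : Integrable (fun x => φ x * deriv V x * ‖f x‖ ^ 2))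
    (hsign : ∀ᵐ x, -(φ x) * deriv V x - 4 * V x ≤ 0) :
    4 * (∫ x, φ₁ x * ‖g x‖ ^ 2) - 4 / 3 * (∫ x, φ₁ x * ‖f x‖ ^ 6) - (∫ x, φ₃ x * ‖f x‖ ^ 2)
      - 2 * ∫ x, φ x * deriv V x * ‖f x‖ ^ 2 ≤
    16 * (1 / 2 * (∫ x, ‖g x‖ ^ 2) + 1 / 2 * (∫ x, V x * ‖f x‖ ^ 2) - 1 / 6 * ∫ x, ‖f x‖ ^ 6) +
      (8 / 3 * B / R ^ 2 + K * ∫ x, ‖f x‖ ^ 2) := by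
  -- With `φ₁ = 2 - ρ`, the constant `2` yields `8 ∫ |g|² - 8/3 ∫ |f|⁶`, the kinetic and nonlinear
  -- parts of `16 E`; what remains is `-4 ∫ ρ|g|² + 4/3 ∫ ρ|f|⁶`.
  have hρ : MemLp (fun x => 2 - φ₁ x) ∞ := (memLp_top_const 2).sub hφ₁
  have hGN := integral_mul_norm_pow_six_le h hρ hR ha hρ1 hB h1
  have i2 := integrable_norm_sq h.memLp
  have ig := integrable_norm_sq h.memLp_deriv
  have i6 := h.integrable_norm_pow_six
  have e1 : ∫ x, (2 - φ₁ x) * ‖g x‖ ^ 2 = 2 * (∫ x, ‖g x‖ ^ 2) - ∫ x, φ₁ x * ‖g x‖ ^ 2 := by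
    simp only [sub_mul]
    rw [integral_sub (ig.const_mul 2) (integrable_memLp_top_mul hφ₁ ig), integral_const_mul]
  have e2 : ∫ x, (2 - φ₁ x) * ‖f x‖ ^ 6 = 2 * (∫ x, ‖f x‖ ^ 6) - ∫ x, φ₁ x * ‖f x‖ ^ 6 := by
    simp only [sub_mul]
    rw [integral_sub (i6.const_mul 2) (integrable_memLp_top_mul hφ₁ i6), integral_const_mul]
  have b3 : -∫ x, φ₃ x * ‖f x‖ ^ 2 ≤ K * ∫ x, ‖f x‖ ^ 2 := by
    refine (neg_le_abs _).trans ?_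
    rw [← Real.norm_eq_abs, ← integral_const_mul]
    refine norm_integral_le_of_norm_le (i2.const_mul K) ?_
    filter_upwards [hφ₃] with x hx
    rw [norm_mul, norm_pow, norm_norm, Real.norm_eq_abs]
    gcongr
  -- Twice this inequality bounds the potential term by `8 ∫ V|f|²`, its share of `16 E`.
  have b4 : -(∫ x, φ x * deriv V x * ‖f x‖ ^ 2) - 4 * ∫ x, V x * ‖f x‖ ^ 2 ≤ 0 := by
    rw [← integral_neg, ← integral_const_mul, 
      ← integral_sub (f := fun x => -(φ x * deriv V x * ‖f x‖ ^ 2)) hV'.neg (hV.const_mul 4)]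
    refine integral_nonpos_of_ae ?_
    filter_upwards [hsign] with x hx
    simp only [Pi.zero_apply]
    nlinarith [sq_nonneg ‖f x‖]
  set T := ∫ x, (2 - φ₁ x) * ‖g x‖ ^ 2 with hT
  have hT0 : 0 ≤ T := by
    refine integral_nonneg_of_ae ?_
    filter_upwards [hρ1] with x hx
    have := (sq_nonneg (ramp (x / R))).trans hx.1
    simp only [Pi.zero_apply]
    positivity
  -- Smallness `8 B a⁴ ≤ 3` is exactly what lets `-4 T` absorb the gradient term.
  have b5 : 4 / 3 * (∫ x, (2 - φ₁ x) * ‖f x‖ ^ 6) ≤ 4 * T + 8 / 3 * B / R ^ 2 := by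
    have ha6 : a ^ 6 ≤ 1 := pow_le_one₀ ha ha1
    have c1 : B * (2 * a ^ 4 / R ^ 2) * a ^ 2 ≤ 2 * B / R ^ 2 := by
      calc B * (2 * a ^ 4 / R ^ 2) * a ^ 2 = 2 * B / R ^ 2 * a ^ 6 := by ring
        _ ≤ 2 * B / R ^ 2 * 1 := by gcongr
        _ = _ := mul_one _
    have c2 : B * (8 * a ^ 2 * T) * a ^ 2 ≤ 3 * T := by
      calc B * (8 * a ^ 2 * T) * a ^ 2 = 8 * B * a ^ 4 * T := by ring
        _ ≤ 3 * T := by gcongr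
    have c3 : 8 / 3 * B / R ^ 2 = 4 / 3 * (2 * B / R ^ 2) := by ring
    rw [c3]
    nlinarith
  linarith

/-! ### From solutions to weak flows -/

theorem ae_eq_of_integral_mul_schwartz {f f' : ℝ → ℂ} (hf : LocallyIntegrable f)
    (hf' : LocallyIntegrable f')
    (h : ∀ ψ : 𝓢(ℝ, ℂ), ∫ x, f x * ψ x = ∫ x, f' x * ψ x) : f =ᵐ[volume] f' := by
  refine ae_eq_of_integral_contDiff_smul_eq hf hf' fun g hg hgc => ?_
  have hc : HasCompactSupport (fun x => (g x : ℂ)) := hgc.comp_left Complex.ofReal_zero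
  have : ∫ x, f x * (g x : ℂ) = ∫ x, f' x * (g x : ℂ) :=
    h (hc.toSchwartzMap (Complex.ofRealCLM.contDiff.comp hg))
  simpa only [Complex.real_smul, mul_comm] using this

theorem IsSolution.zero_ae_eq {V : ℝ → ℝ} {u₀ : ℝ → ℂ} {J : Set ℝ} {u : ℝ → ℝ → ℂ}
    (h : IsSolution V u₀ J u) (h₀ : MemLp u₀ 2) : u 0 =ᵐ[volume] u₀ := by
  refine ae_eq_of_integral_mul_schwartz
    ((h.memH1 0 h.zero_mem).1.locallyIntegrable (by norm_num))
    (h₀.locallyIntegrable (by norm_num)) fun ψ => ?_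
  have := h.duhamel 0 h.zero_mem ψ
  simpa [freeGroup_zero] using this

theorem integral_forcing_congr {V : ℝ → ℝ} {f f' : ℝ → ℂ} (h : f =ᵐ[volume] f') (k : ℝ → ℂ) :
    ∫ x, forcing V f x * k x = ∫ x, forcing V f' x * k x :=
  integral_congr_ae (h.mono fun x hx => by simp [forcing, hx])

theorem integral_mul_congr {f f' : ℝ → ℂ} (h : f =ᵐ[volume] f') (k : ℝ → ℂ) :
    ∫ x, f x * k x = ∫ x, f' x * k x :=
  integral_congr_ae (h.mono fun x hx => by simp [hx])

/-- A solution on an open time interval has a weak flow of continuous representatives. -/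
theorem IsSolution.exists_isWeakFlow {V : ℝ → ℝ} {u₀ : ℝ → ℂ} {J : Set ℝ} {u : ℝ → ℝ → ℂ}
    (h : IsSolution V u₀ J u) (h₀ : MemLp u₀ 2) (hJ : IsOpen J)
    (hV : Integrable (fun x => V x * decay x)) :
    ∃ U, IsWeakFlow V J U (fun t => weakDeriv (u t)) ∧ ∀ t ∈ J, u t =ᵐ[volume] U t := by
  have h1 : ∀ t, ∃ F, t ∈ J → IsH1Pair F (weakDeriv (u t)) ∧ u t =ᵐ[volume] F := by
    intro t
    by_cases ht : t ∈ J
    · obtain ⟨F, hF⟩ := (h.memH1 t ht).exists_isH1Pair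
      exact ⟨F, fun _ => hF⟩
    · exact ⟨0, fun ht' => absurd ht' ht⟩
  choose U hU using h1
  have hae : ∀ t ∈ J, u t =ᵐ[volume] U t := fun t ht => (hU t ht).2
  refine ⟨U, ⟨hJ, h.ordConnected, h.zero_mem, fun t ht => (hU t ht).1, fun t₀ ht₀ => ?_, hV,
    fun t ht ψ => ?_, fun t ht ψ => ?_⟩, hae⟩
  · have := h.continuous t₀ ht₀
    rw [hJ.nhdsWithin_eq ht₀] at this
    refine this.congr' ?_
    filter_upwards [hJ.mem_nhds ht₀] with t ht
    exact h1Norm_congr ((hae t ht).sub (hae t₀ ht₀))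
  · refine (h.intervalIntegrable_forcing t ht ψ).congr fun s hs => ?_
    exact integral_forcing_congr
      (hae s (h.ordConnected.uIcc_subset h.zero_mem ht (uIoc_subset_uIcc hs))) _
  · rw [← integral_mul_congr (hae t ht), h.duhamel t ht ψ,
      integral_mul_congr ((h.zero_ae_eq h₀).symm.trans (hae 0 h.zero_mem))]
    congr 2
    refine intervalIntegral.integral_congr fun s hs => ?_
    exact integral_forcing_congr (hae s (h.ordConnected.uIcc_subset h.zero_mem ht hs)) _

theorem hasDerivAt_inv_one_add_sq (x : ℝ) :
    HasDerivAt (fun x : ℝ => (1 + x ^ 2)⁻¹) (-(2 * x) * decay x) x := by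
  have h : HasDerivAt (fun x : ℝ => 1 + x ^ 2) (2 * x) x := by
    simpa using (hasDerivAt_pow 2 x).const_add 1
  exact (h.inv (by positivity)).congr_deriv (by rw [decay, div_eq_mul_inv])

theorem isH1Pair_inv_one_add_sq :
    IsH1Pair (fun x => (((1 + x ^ 2)⁻¹ : ℝ) : ℂ)) (fun x => ((-(2 * x) * decay x : ℝ) : ℂ)) := by
  have hc : Continuous fun x : ℝ => -(2 * x) * decay x := by
    have := continuous_decay
    fun_prop
  have hp : IsPrimitive (fun x : ℝ => (1 + x ^ 2)⁻¹) (fun x => -(2 * x) * decay x) :=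
    isPrimitive_of_hasDerivAt hasDerivAt_inv_one_add_sq hc
  have hm : MemLp (fun x : ℝ => (((1 + x ^ 2)⁻¹ : ℝ) : ℂ)) 2 := by
    refine (memLp_two_iff_integrable_sq_norm
      (Complex.continuous_ofReal.comp hp.continuous).aestronglyMeasurable).mpr ?_
    refine integrable_decay.congr (Eventually.of_forall fun x => ?_)
    simp only [Function.comp_apply, Complex.norm_real, Real.norm_eq_abs, sq_abs, decay, inv_pow]
  refine ⟨hp.ofReal, hm, hm.of_le (Complex.continuous_ofReal.comp hc).aestronglyMeasurable
    (Eventually.of_forall fun x => ?_)⟩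
  rw [Complex.norm_real, Complex.norm_real, Real.norm_eq_abs, Real.norm_eq_abs, abs_mul,
    abs_of_pos (decay_pos x), abs_of_pos (by positivity : (0 : ℝ) < (1 + x ^ 2)⁻¹), abs_neg, decay,
    pow_two (1 + x ^ 2), mul_inv, ← mul_assoc]
  refine mul_le_of_le_one_left (by positivity) ?_
  rw [← div_eq_mul_inv, div_le_one (by positivity), abs_le]
  constructor <;> nlinarith [sq_nonneg (x - 1), sq_nonneg (x + 1)]

/-- Well-posedness makes `V|v|²` integrable for every datum `v`; the datum `(1 + x²)⁻¹` has square
`decay`. -/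
theorem LocallyWellPosed.integrable_mul_decay {V : ℝ → ℝ} (h : LocallyWellPosed V) :
    Integrable (fun x => V x * decay x) := by
  have hp := isH1Pair_inv_one_add_sq
  obtain ⟨Tmin, Tmax, u, hu, -, -, -, hc⟩ := h _ hp.memH1
  refine (hc 0 hu.isSolution.zero_mem).2.1.congr ?_
  filter_upwards [hu.isSolution.zero_ae_eq hp.memLp] with x hx
  rw [hx, Complex.norm_real, Real.norm_eq_abs, sq_abs, decay, inv_pow]

theorem isOpen_timeInterval (Tmin Tmax : EReal) : IsOpen (timeInterval Tmin Tmax) :=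
  (isOpen_Ioo (a := Tmin) (b := Tmax)).preimage continuous_coe_real_ereal

/-! ### Transfer of the well-posedness properties to a given maximal solution -/

theorem le_of_timeInterval_subset {Smin Smax Tmin Tmax : EReal}
    (h0 : (0 : ℝ) ∈ timeInterval Smin Smax)
    (h : timeInterval Smin Smax ⊆ timeInterval Tmin Tmax) : Tmin ≤ Smin ∧ Smax ≤ Tmax := by
  refine ⟨le_of_not_gt fun hlt => ?_, le_of_not_gt fun hlt => ?_⟩
  -- The minimum with `0` keeps `r` below `Smax`.
  · obtain ⟨r, h1, h2⟩ := EReal.lt_iff_exists_real_btwn.mp (lt_min hlt h0.1)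
    have h3 : r ∈ timeInterval Smin Smax :=
      ⟨h1, (h2.trans_le (min_le_right _ _)).trans h0.2⟩
    exact absurd (h h3).1 (not_lt.mpr (h2.le.trans (min_le_left _ _)))
  · obtain ⟨r, h1, h2⟩ := EReal.lt_iff_exists_real_btwn.mp (max_lt hlt h0.2)
    have h3 : r ∈ timeInterval Smin Smax :=
      ⟨h0.1.trans ((le_max_right _ _).trans_lt h1), h2⟩
    exact absurd (h h3).2 (not_lt.mpr ((le_max_left _ _).trans h1.le))

/-- Two maximal solutions with the same datum restrict each other, so they share the life span and
agree almost everywhere at each time. -/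
theorem IsMaximalSolution.blowUp_and_conservation {V : ℝ → ℝ} {u₀ : ℝ → ℂ} {Tmin Tmax : EReal}
    {u : ℝ → ℝ → ℂ} (hu : IsMaximalSolution V u₀ Tmin Tmax u) (hu₀ : MemH1 u₀)
    (h : LocallyWellPosed V) :
    (Tmin ≠ ⊥ → NormBlowsUpAtMin Tmin u) ∧ (Tmax ≠ ⊤ → NormBlowsUpAtMax Tmax u) ∧
      ∀ t ∈ timeInterval Tmin Tmax, mass (u t) = mass u₀ ∧
        Integrable (fun x => V x * ‖u t x‖ ^ 2) ∧ energy V (u t) = energy V u₀ := by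
  obtain ⟨Smin, Smax, v, hv, -, hmin, hmax, hc⟩ := h u₀ hu₀
  obtain ⟨hs1, hae⟩ := hv.unique _ _ hu.isSolution
  obtain ⟨hs2, -⟩ := hu.unique _ _ hv.isSolution
  have h0 := hu.isSolution.zero_mem
  obtain ⟨l1, l2⟩ := le_of_timeInterval_subset h0 hs1
  obtain ⟨l3, l4⟩ := le_of_timeInterval_subset hv.isSolution.zero_mem hs2
  obtain rfl := le_antisymm l1 l3
  obtain rfl := le_antisymm l2 l4
  refine ⟨fun hb => ?_, fun ht => ?_, fun t ht => ?_⟩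
  · refine (hmin hb).congr' ?_
    have hreal : ((Smin.toReal : ℝ) : EReal) = Smin :=
      EReal.coe_toReal (h0.1.trans (EReal.coe_lt_top 0)).ne hb
    have h0' : Smin.toReal < 0 := by rw [← EReal.coe_lt_coe_iff, hreal]; exact h0.1
    filter_upwards [Ioo_mem_nhdsGT h0'] with t ht
    refine (h1Norm_congr (hae t ⟨?_, ?_⟩)).symm
    · rw [← hreal]; exact EReal.coe_lt_coe_iff.mpr ht.1
    · exact (EReal.coe_lt_coe_iff.mpr ht.2).trans h0.2
  · refine (hmax ht).congr' ?_
    have hreal : ((Tmax.toReal : ℝ) : EReal) = Tmax :=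
      EReal.coe_toReal ht ((EReal.bot_lt_coe 0).trans h0.2).ne'
    have h0' : 0 < Tmax.toReal := by rw [← EReal.coe_lt_coe_iff, hreal]; exact h0.2
    filter_upwards [Ioo_mem_nhdsLT h0'] with t ht
    refine (h1Norm_congr (hae t ⟨?_, ?_⟩)).symm
    · exact h0.1.trans (EReal.coe_lt_coe_iff.mpr ht.1)
    · rw [← hreal]; exact EReal.coe_lt_coe_iff.mpr ht.2
  · obtain ⟨c1, c2, c3⟩ := hc t ht
    have e := hae t ht
    refine ⟨?_, ?_, ?_⟩
    · rw [← c1]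
      exact integral_congr_ae (e.mono fun x hx => by simp [hx])
    · exact c2.congr (e.mono fun x hx => by simp [hx])
    · rw [← c3, energy, energy]
      congr 1
      · congr 2
        · exact integral_congr_ae ((weakDeriv_congr e).mono fun x hx => by simp [hx])
        · exact integral_congr_ae (e.mono fun x hx => by simp [hx])
      · congr 1
        exact integral_congr_ae (e.mono fun x hx => by simp [hx])

/-! ### A differential inequality without global solutions -/

theorem le_quadratic_of_deriv_deriv_le {I I₁ I₂ : ℝ → ℝ} {c T : ℝ} (hT : 0 ≤ T)
    (h1 : ∀ t ∈ Icc 0 T, HasDerivAt I (I₁ t) t) (h2 : ∀ t ∈ Icc 0 T, HasDerivAt I₁ (I₂ t) t)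
    (hc : ∀ t ∈ Ioo 0 T, I₂ t ≤ -c) : I T ≤ I 0 + I₁ 0 * T - c / 2 * T ^ 2 := by
  have a1 : AntitoneOn (fun t => I₁ t + c * t) (Icc 0 T) := by
    have hd : ∀ t ∈ Icc 0 T, HasDerivAt (fun t => I₁ t + c * t) (I₂ t + c) t := fun t ht =>
      ((h2 t ht).add ((hasDerivAt_id t).const_mul c)).congr_deriv (by rw [mul_one])
    refine antitoneOn_of_deriv_nonpos (convex_Icc 0 T)
      (fun t ht => (hd t ht).continuousAt.continuousWithinAt)
      (fun t ht => (hd t (interior_subset ht)).differentiableAt.differentiableWithinAt)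
      fun t ht => ?_
    rw [(hd t (interior_subset ht)).deriv]
    rw [interior_Icc] at ht
    linarith [hc t ht]
  have a2 : AntitoneOn (fun t => I t - (I₁ 0 * t - c / 2 * t ^ 2)) (Icc 0 T) := by
    have hd : ∀ t ∈ Icc 0 T, HasDerivAt (fun t => I t - (I₁ 0 * t - c / 2 * t ^ 2))
        (I₁ t - (I₁ 0 - c * t)) t := fun t ht => by
      refine ((h1 t ht).sub (((hasDerivAt_id t).const_mul (I₁ 0)).sub
        ((hasDerivAt_pow 2 t).const_mul (c / 2)))).congr_deriv ?_
      norm_num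
      ring
    refine antitoneOn_of_deriv_nonpos (convex_Icc 0 T)
      (fun t ht => (hd t ht).continuousAt.continuousWithinAt)
      (fun t ht => (hd t (interior_subset ht)).differentiableAt.differentiableWithinAt)
      fun t ht => ?_
    have ht' := interior_subset ht
    rw [(hd t ht').deriv]
    have := a1 (left_mem_Icc.mpr hT) ht' ht'.1
    simp only [mul_zero, add_zero] at this
    linarith
  have := a2 (left_mem_Icc.mpr hT) (right_mem_Icc.mpr hT) hT
  norm_num at this
  linarith

/-- A nonnegative function on `[0, ∞)` which is uniformly concave as long as it is below a certain
level cannot start far enough below that level. -/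
theorem false_of_deriv_deriv_le {I I₁ I₂ : ℝ → ℝ} {A c : ℝ} (hc : 0 < c)
    (h0 : ∀ t, 0 ≤ t → 0 ≤ I t) (h1 : ∀ t, 0 ≤ t → HasDerivAt I (I₁ t) t)
    (h2 : ∀ t, 0 ≤ t → HasDerivAt I₁ (I₂ t) t) (hI : ∀ t, 0 ≤ t → I t ≤ A → I₂ t ≤ -c)
    (hA : I 0 + I₁ 0 ^ 2 / (2 * c) < A) : False := by
  -- The comparison parabola has maximum `I(0) + I₁(0)²/(2c)`, below `A` by assumption.
  have hq : ∀ t, I 0 + I₁ 0 * t - c / 2 * t ^ 2 < A := fun t => by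
    have : I₁ 0 * t - c / 2 * t ^ 2 ≤ I₁ 0 ^ 2 / (2 * c) := by
      rw [le_div_iff₀ (by positivity)]
      nlinarith [sq_nonneg (I₁ 0 - c * t)]
    linarith
  have hb : ∀ t, 0 ≤ t → I t < A := by
    intro T hT
    by_contra! hlt
    -- Before the first time in `K` the concavity holds, so at that time `I` is still under the
    -- parabola, a contradiction.
    set K := {t ∈ Icc 0 T | A ≤ I t} with hK
    have hcont : ContinuousOn I (Icc 0 T) := fun t ht =>
      (h1 t ht.1).continuousAt.continuousWithinAt
    have hKc : IsCompact K :=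
      isCompact_Icc.of_isClosed_subset
        (hcont.preimage_isClosed_of_isClosed isClosed_Icc isClosed_Ici) (sep_subset _ _)
    obtain ⟨s, ⟨hs, hAs⟩, hmin⟩ := hKc.exists_isLeast ⟨T, right_mem_Icc.mpr hT, hlt⟩
    have hle := le_quadratic_of_deriv_deriv_le (c := c) hs.1 (fun t ht => h1 t ht.1)
      (fun t ht => h2 t ht.1) fun t ht => hI t ht.1.le (le_of_not_ge fun hAt =>
        absurd (hmin ⟨⟨ht.1.le, ht.2.le.trans hs.2⟩, hAt⟩) (not_le.mpr ht.2))
    linarith [hq s]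
  set m := |I₁ 0| + I 0 + 1 with hm
  have hI0 := h0 0 le_rfl
  have hm1 : 1 ≤ m := by have := abs_nonneg (I₁ 0); linarith
  -- Chosen so that `c T²/2 = (m + c/2) T` exceeds `I(0) + I₁(0) T`, which makes `I(T)` negative.
  set T := 2 * m / c + 1 with hT
  have hT1 : 1 ≤ T := by have : 0 ≤ 2 * m / c := by positivity
                         linarith
  have hcT : c * T = 2 * m + c := by rw [hT]; field_simp
  have hle := le_quadratic_of_deriv_deriv_le (c := c) (by linarith : 0 ≤ T) (fun t ht => h1 t ht.1)
    (fun t ht => h2 t ht.1) fun t ht => hI t ht.1.le (hb t ht.1.le).le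
  have e : c / 2 * T ^ 2 = (m + c / 2) * T := by
    have : c / 2 * T ^ 2 = (c * T) * T / 2 := by ring
    rw [this, hcT]; ring
  have h3 := h0 T (by linarith)
  rw [e] at hle
  have h4 : I₁ 0 * T ≤ |I₁ 0| * T := by gcongr; exact le_abs_self _
  have h5 : (I 0 + 1) * 1 ≤ (I 0 + 1) * T := by gcongr
  have h6 : 0 ≤ c / 2 * T := by positivity
  rw [hm] at hle
  nlinarith

/-! ### The rescaled cut-off weights -/

/-- Dominated convergence. It is applied with `k = 𝒳` to the initial mass density and with `k = ζ`
to the initial momentum density. -/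
theorem tendsto_integral_comp_div_smul {E : Type*} [NormedAddCommGroup E] [NormedSpace ℝ E]
    {k : ℝ → ℝ} {h : ℝ → E} {C : ℝ} (hk : Continuous k) (hC : ∀ x, |k x| ≤ C) (h0 : k 0 = 0)
    (hh : Integrable h) :
    Tendsto (fun R : ℝ => ∫ x, k (x / R) • h x) atTop (𝓝 0) := by
  have : Tendsto (fun R : ℝ => ∫ x, k (x / R) • h x) atTop (𝓝 (∫ _ : ℝ, (0 : E))) := by
    refine tendsto_integral_filter_of_dominated_convergence (fun x => C * ‖h x‖)
      (Eventually.of_forall fun R => ?_) (Eventually.of_forall fun R => ?_) (hh.norm.const_mul C)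
      (Eventually.of_forall fun x => ?_)
    · exact (hk.comp (continuous_id.div_const R)).aestronglyMeasurable.smul hh.1
    · refine Eventually.of_forall fun x => ?_
      rw [norm_smul, Real.norm_eq_abs]
      gcongr
      exact hC _
    · have h1 : Tendsto (fun R : ℝ => k (x / R)) atTop (𝓝 (k 0)) :=
        (hk.tendsto 0).comp (tendsto_const_nhds.div_atTop tendsto_id)
      simpa [h0] using h1.smul_const (h x)
  simpa using this

theorem intervalIntegral_comp_div (ζ : ℝ → ℝ) {R : ℝ} (hR : 0 < R) (x : ℝ) :
    ∫ s in (0 : ℝ)..x, R * ζ (s / R) = R ^ 2 * cutoffWeight ζ (x / R) := by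
  rw [intervalIntegral.integral_const_mul, intervalIntegral.integral_comp_div _ hR.ne', zero_div,
    cutoffWeight, smul_eq_mul]
  ring

namespace IsCutoffProfile

variable {ζ : ℝ → ℝ}

theorem continuous_cutoffWeight (hζ : IsCutoffProfile ζ) : Continuous (cutoffWeight ζ) :=
  continuous_iff_continuousAt.mpr fun x => (hζ.hasDerivAt_cutoffWeight x).continuousAt

/-- `𝒳` is constant for `|x| ≥ 2` rather than zero; subtracting `𝒳(2)` gives compact support without
changing the derivative. -/
theorem isLocalWeight (hζ : IsCutoffProfile ζ) {R : ℝ} (hR : 0 < R) :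
    IsLocalWeight (2 * R) (fun x => R ^ 2 * (cutoffWeight ζ (x / R) - cutoffWeight ζ 2))
      (fun x => R * ζ (x / R)) where
  pos := by positivity
  hasDerivAt x := by
    have h := (hζ.hasDerivAt_cutoffWeight (x / R)).comp x ((hasDerivAt_id x).div_const R)
    refine ((h.sub_const (cutoffWeight ζ 2)).const_mul (R ^ 2)).congr_deriv ?_
    field_simp
  continuous_deriv := by
    have := hζ.continuous
    fun_prop
  zero x hx := by
    rw [hζ.cutoffWeight_eq, sub_self, mul_zero]
    rwa [abs_div, abs_of_pos hR, le_div_iff₀ hR]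

theorem hasCompactSupport_comp_div (hζ : IsCutoffProfile ζ) {R : ℝ} (hR : 0 < R) :
    HasCompactSupport (fun x => R * ζ (x / R)) := by
  refine HasCompactSupport.of_support_subset_isCompact (isCompact_Icc (a := -(2 * R)) (b := 2 * R))
    fun x hx => ?_
  refine abs_le.mp ?_
  by_contra! hlt
  exact hx ((hζ.isLocalWeight hR).zero_deriv hlt)

theorem integrable_cutoffWeight_mul (hζ : IsCutoffProfile ζ) {f : ℝ → ℂ} (hf : MemLp f 2)
    (R : ℝ) : Integrable (fun x => cutoffWeight ζ (x / R) * ‖f x‖ ^ 2) := by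
  refine (integrable_norm_sq hf).bdd_mul (c := cutoffWeight ζ 2)
    (hζ.continuous_cutoffWeight.comp (continuous_id.div_const R)).aestronglyMeasurable
    (Eventually.of_forall fun x => ?_)
  rw [Real.norm_of_nonneg (hζ.cutoffWeight_nonneg _)]
  exact hζ.cutoffWeight_le _

/-- Holds because `𝒳 ≥ 1` off the unit ball and `𝒳 ≥ 0`. A bound on the virial quantity thereby
becomes a bound on the outer mass. -/
theorem integral_outer_le (hζ : IsCutoffProfile ζ) {f : ℝ → ℂ} (hf : MemLp f 2) {R : ℝ}
    (hR : 0 < R) :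
    ∫ x, ‖outer R f x‖ ^ 2 ≤ ∫ x, cutoffWeight ζ (x / R) * ‖f x‖ ^ 2 := by
  refine integral_mono (integrable_norm_sq (memLp_outer hf))
    (hζ.integrable_cutoffWeight_mul hf R) fun x => ?_
  rcases lt_or_ge |x| R with hx | hx
  · have e : outer R f x = 0 := indicator_of_notMem (by simpa using hx) f
    have := hζ.cutoffWeight_nonneg (x / R)
    rw [e, norm_zero, zero_pow two_ne_zero]
    positivity
  · have e : outer R f x = f x := indicator_of_mem (by exact hx) f
    simp only [e]
    refine le_mul_of_one_le_left (by positivity) (hζ.one_le_cutoffWeight ?_)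
    rwa [abs_div, abs_of_pos hR, one_le_div hR]

end IsCutoffProfile

/-! ### Initial slope of the virial quantity and choice of the radius -/

theorem virial_comp_div (ζ : ℝ → ℝ) {R : ℝ} (hR : 0 < R) (u : ℝ → ℝ → ℂ) (t : ℝ) :
    virial (fun x => R * ζ (x / R)) u t =
      R ^ 2 * ∫ x, cutoffWeight ζ (x / R) * ‖u t x‖ ^ 2 := by
  rw [virial, ← integral_const_mul]
  simp only [intervalIntegral_comp_div ζ hR, mul_assoc]

/-- The derivative of the localized virial quantity at the initial time. -/
theorem deriv_virial_zero {V : ℝ → ℝ} {J : Set ℝ} {U G u : ℝ → ℝ → ℂ} (h : IsWeakFlow V J U G)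
    (hae : ∀ t ∈ J, u t =ᵐ[volume] U t) (hM : ∀ t ∈ J, mass (u t) = mass (u 0))
    {ζ : ℝ → ℝ} (hζ : IsCutoffProfile ζ) {R : ℝ} (hR : 0 < R) :
    deriv (virial (fun x => R * ζ (x / R)) u) 0 =
      2 * R * (∫ x, ζ (x / R) • (G 0 x * starRingEnd ℂ (U 0 x))).im := by
  have hw := hζ.isLocalWeight hR
  have hd := (h.hasDerivAt_localMass hw).const_add (R ^ 2 * cutoffWeight ζ 2 * mass (u 0))
  -- By conservation of mass, the subtracted constant `𝒳(2)` contributes nothing to the derivative.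
  have e : virial (fun x => R * ζ (x / R)) u =ᶠ[𝓝 0] fun t =>
      R ^ 2 * cutoffWeight ζ 2 * mass (u 0) +
        ∫ x, R ^ 2 * (cutoffWeight ζ (x / R) - cutoffWeight ζ 2) * ‖U t x‖ ^ 2 := by
    filter_upwards [h.isOpen.mem_nhds h.zero_mem] with t ht
    have hp := h.pair t ht
    have e1 : mass (u t) = ∫ x, ‖U t x‖ ^ 2 :=
      integral_congr_ae ((hae t ht).mono fun x hx => by simp [hx])
    have e2 : ∫ x, cutoffWeight ζ (x / R) * ‖u t x‖ ^ 2 =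
        ∫ x, cutoffWeight ζ (x / R) * ‖U t x‖ ^ 2 :=
      integral_congr_ae ((hae t ht).mono fun x hx => by simp [hx])
    rw [virial_comp_div ζ hR, e2, ← hM t ht, e1]
    simp only [mul_assoc, sub_mul]
    rw [integral_const_mul, integral_sub (hζ.integrable_cutoffWeight_mul hp.memLp R)
      ((integrable_norm_sq hp.memLp).const_mul _), integral_const_mul]
    ring
  rw [e.deriv_eq, hd.deriv]
  have e3 : ∫ x, ((R * ζ (x / R) : ℝ) : ℂ) * (G 0 x * starRingEnd ℂ (U 0 x)) =
      R • ∫ x, ζ (x / R) • (G 0 x * starRingEnd ℂ (U 0 x)) := by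
    rw [← integral_smul]
    refine integral_congr_ae (Eventually.of_forall fun x => ?_)
    simp only [Complex.real_smul, Complex.ofReal_mul, mul_assoc]
  rw [e3, Complex.smul_im, smul_eq_mul]
  ring

/-- For a solution of negative energy, some localized virial quantity stays in the regime in which
it is uniformly concave. -/
theorem exists_concave_virial {V : ℝ → ℝ} {J : Set ℝ} {U u : ℝ → ℝ → ℂ} {u₀ : ℝ → ℂ}
    (h : IsWeakFlow V J U fun t => weakDeriv (u t)) (hae : ∀ t ∈ J, u t =ᵐ[volume] U t)
    {ζ : ℝ → ℝ} (hζ : IsCutoffProfile ζ)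
    (hcons : ∀ t ∈ J, mass (u t) = mass u₀ ∧ Integrable (fun x => V x * ‖u t x‖ ^ 2) ∧
      energy V (u t) = energy V u₀)
    (hVirial : LocalizedVirialIdentity V J u)
    (hSign : ∀ R : ℝ, 0 < R → ∀ᵐ x,
      -R * deriv (cutoffWeight ζ) (x / R) * deriv V x - 4 * V x ≤ 0)
    (hE : energy V u₀ < 0) :
    ∃ (I I₁ I₂ : ℝ → ℝ) (A c : ℝ), 0 < c ∧ (∀ t, 0 ≤ I t) ∧
      (∀ t ∈ J, HasDerivAt I (I₁ t) t ∧ HasDerivAt I₁ (I₂ t) t ∧ (I t ≤ A → I₂ t ≤ -c)) ∧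
      I 0 + I₁ 0 ^ 2 / (2 * c) < A := by
  obtain ⟨ζ₁, ζ₂, ζ₃, hW⟩ := hζ.memW3Inf
  obtain ⟨B, hB, hramp⟩ := hζ.exists_ramp_sq_le hW.deriv₁ hW.memLp₁
  obtain ⟨K, hK, hζ₃⟩ := exists_ae_norm_le_of_memLp_top hW.memLp₃
  obtain ⟨C, hC⟩ := hζ.exists_norm_le
  -- Any `a` in `(0, 1]` with `8 B a⁴ ≤ 3` would do; here `a⁴ ≤ a` gives it.
  set a : ℝ := 3 / (8 * B + 3) with ha
  have ha0 : 0 < a := by positivity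
  have ha1 : a ≤ 1 := by rw [ha, div_le_one (by positivity)]; linarith
  have haB : 8 * B * a ^ 4 ≤ 3 := by
    have h1 : a ^ 4 ≤ a := pow_le_of_le_one ha0.le ha1 (by norm_num)
    have h2 : (8 * B + 3) * a = 3 := by rw [ha]; field_simp
    nlinarith
  -- Half of `-16 E`; the other half is left to absorb the `O(R⁻²)` errors.
  set c : ℝ := -8 * energy V u₀ with hc
  have hc0 : 0 < c := by linarith
  have hp0 := h.pair 0 h.zero_mem
  have hζ0 : ζ 0 = 0 := by simpa using hζ.eq_linear 0 (by simp)
  have hm := tendsto_integral_comp_div_smul (C := cutoffWeight ζ 2) hζ.continuous_cutoffWeight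
    (fun x => by rw [abs_of_nonneg (hζ.cutoffWeight_nonneg x)]; exact hζ.cutoffWeight_le x)
    (cutoffWeight_zero ζ) (integrable_norm_sq hp0.memLp)
  have hn := tendsto_integral_comp_div_smul hζ.continuous hC hζ0
    (integrable_mul_of_memLp_two hp0.memLp_deriv
      (g := fun x => starRingEnd ℂ (U 0 x)) hp0.memLp.star)
  -- This is `(I(0) + I'(0)²/(2c)) / R²` as a function of `R`.
  have hmn := hm.add ((((Complex.continuous_im.tendsto _).comp hn).const_mul 2).pow 2 |>.div_const
    (2 * c))
  simp only [Complex.zero_im, mul_zero, zero_pow two_ne_zero, zero_div, add_zero] at hmn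
  have hr : Tendsto (fun R : ℝ => (8 / 3 * B + K * mass u₀) / R ^ 2) atTop (𝓝 0) :=
    tendsto_const_nhds.div_atTop (tendsto_pow_atTop two_ne_zero)
  obtain ⟨R, hR, hR1, hR2⟩ := ((eventually_gt_atTop 0).and
    ((hmn.eventually_lt_const (pow_pos ha0 2)).and (hr.eventually_lt_const hc0))).exists
  have hW' := hW.comp_div hR.ne'
  have hv := hVirial _ _ _ _ hW' (hζ.hasCompactSupport_comp_div hR)
  refine ⟨virial (fun x => R * ζ (x / R)) u, deriv (virial (fun x => R * ζ (x / R)) u), _,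
    a ^ 2 * R ^ 2, c, hc0, fun t => ?_, fun t ht =>
      ⟨(hv t ht).2.1.hasDerivAt, (hv t ht).2.2, fun hA => ?_⟩, ?_⟩
  · rw [virial_comp_div ζ hR]
    exact mul_nonneg (by positivity) (integral_nonneg fun x =>
      mul_nonneg (hζ.cutoffWeight_nonneg _) (by positivity))
  · have hp := h.pair t ht
    obtain ⟨c1, c2, c3⟩ := hcons t ht
    have e : ∀ (k : ℝ → ℝ) (n : ℕ), ∫ x, k x * ‖u t x‖ ^ n = ∫ x, k x * ‖U t x‖ ^ n :=
      fun k n => integral_congr_ae ((hae t ht).mono fun x hx => by simp [hx])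
    have e1 : ∀ n : ℕ, ∫ x, ‖u t x‖ ^ n = ∫ x, ‖U t x‖ ^ n := fun n =>
      integral_congr_ae ((hae t ht).mono fun x hx => by simp [hx])
    have hout : ∫ x, ‖outer R (U t) x‖ ^ 2 ≤ a ^ 2 := by
      refine (hζ.integral_outer_le hp.memLp hR).trans ?_
      rw [virial_comp_div ζ hR, e, mul_comm (a ^ 2)] at hA
      exact le_of_mul_le_mul_left hA (by positivity)
    have key := virial_rhs_le hp (V := V) (φ := fun x => R * ζ (x / R)) hW'.memLp₁ hR ha0.le hB.le
      ((quasiMeasurePreserving_div hR.ne').ae hramp) (φ₃ := fun x => (R ^ 2)⁻¹ * ζ₃ (x / R))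
      (K := (R ^ 2)⁻¹ * K) (by
        filter_upwards [(quasiMeasurePreserving_div hR.ne').ae hζ₃] with x hx
        rw [abs_mul, abs_of_pos (by positivity : 0 < (R ^ 2)⁻¹)]
        gcongr) hout ha1 haB
      (c2.congr ((hae t ht).mono fun x hx => by simp [hx]))
      ((hv t ht).1.congr ((hae t ht).mono fun x hx => by simp [hx]))
      (by
        filter_upwards [hSign R hR] with x hx
        rw [(hζ.hasDerivAt_cutoffWeight _).deriv] at hx
        linarith)
    have eE : energy V (u t) = 1 / 2 * (∫ x, ‖weakDeriv (u t) x‖ ^ 2) +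
        1 / 2 * (∫ x, V x * ‖U t x‖ ^ 2) - 1 / 6 * ∫ x, ‖U t x‖ ^ 6 := by
      rw [energy, e, e1]
    have eM : mass u₀ = ∫ x, ‖U t x‖ ^ 2 := by rw [← c1, mass, e1]
    rw [← eE, ← eM, c3] at key
    rw [e, e, e]
    have : 8 / 3 * B / R ^ 2 + (R ^ 2)⁻¹ * K * mass u₀ = (8 / 3 * B + K * mass u₀) / R ^ 2 := by
      field_simp
    linarith
  · have hM : ∀ t ∈ J, mass (u t) = mass (u 0) := fun t ht => by
      rw [(hcons t ht).1, (hcons 0 h.zero_mem).1]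
    rw [deriv_virial_zero h hae hM hζ hR, virial_comp_div ζ hR]
    have e : ∫ x, cutoffWeight ζ (x / R) * ‖u 0 x‖ ^ 2 =
        ∫ x, cutoffWeight ζ (x / R) • ‖U 0 x‖ ^ 2 :=
      integral_congr_ae ((hae 0 h.zero_mem).mono fun x hx => by simp [hx])
    rw [e]
    simp only [Function.comp_apply] at hR1
    calc _ = ((∫ x, cutoffWeight ζ (x / R) • ‖U 0 x‖ ^ 2) +
          (2 * (∫ x, ζ (x / R) • (weakDeriv (u 0) x * starRingEnd ℂ (U 0 x))).im) ^ 2 / (2 * c)) *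
            R ^ 2 := by ring
      _ < a ^ 2 * R ^ 2 := by gcongr

end NLS

theorem mainTheorem4
    (V : ℝ → ℝ) (hV : ∀ᵐ x, DifferentiableAt ℝ V x)
    (ζ : ℝ → ℝ) (hζ : NLS.IsCutoffProfile ζ)
    (u₀ : ℝ → ℂ) (hu₀ : NLS.MemH1 u₀)
    (hLWP : NLS.LocallyWellPosed V)
    (Tmin Tmax : EReal) (u : ℝ → ℝ → ℂ)
    (hu : NLS.IsMaximalSolution V u₀ Tmin Tmax u)
    (hVirial : NLS.LocalizedVirialIdentity V (NLS.timeInterval Tmin Tmax) u)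
    (hSign : ∀ R : ℝ, 0 < R → ∀ᵐ x,
      -R * deriv (NLS.cutoffWeight ζ) (x / R) * deriv V x - 4 * V x ≤ 0)
    (hE : NLS.energy V u₀ < 0) :
    NLS.BlowsUp Tmin Tmax u := by
  obtain ⟨hmin, hmax, hcons⟩ := hu.blowUp_and_conservation hu₀ hLWP
  obtain ⟨U, hflow, hae⟩ := hu.isSolution.exists_isWeakFlow hu₀.1
    (NLS.isOpen_timeInterval Tmin Tmax) hLWP.integrable_mul_decay
  obtain ⟨I, I₁, I₂, A, c, hc, h0, hd, hA⟩ :=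
    NLS.exists_concave_virial hflow hae hζ hcons hVirial hSign hE
  have hzero := hu.isSolution.zero_mem
  have h1 : Tmin ≠ ⊥ := by
    rintro rfl
    have hmem : ∀ t : ℝ, 0 ≤ t → -t ∈ NLS.timeInterval ⊥ Tmax := fun t ht =>
      ⟨EReal.bot_lt_coe _, (EReal.coe_le_coe_iff.mpr (by linarith)).trans_lt hzero.2⟩
    -- Time reversal: the first derivative changes sign, but only its square enters the smallness
    -- condition at `0`.
    refine NLS.false_of_deriv_deriv_le (I := fun t => I (-t)) (I₁ := fun t => -I₁ (-t))
      (I₂ := fun t => I₂ (-t)) hc (fun t _ => h0 _) (fun t ht => ?_) (fun t ht => ?_)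
      (fun t ht => (hd _ (hmem t ht)).2.2) (by simpa using hA)
    · exact ((hd _ (hmem t ht)).1.comp t (hasDerivAt_neg t)).congr_deriv (by ring)
    · exact ((hd _ (hmem t ht)).2.1.comp t (hasDerivAt_neg t)).neg.congr_deriv (by ring)
  have h2 : Tmax ≠ ⊤ := by
    rintro rfl
    have hmem : ∀ t : ℝ, 0 ≤ t → t ∈ NLS.timeInterval Tmin ⊤ := fun t ht =>
      ⟨hzero.1.trans_le (EReal.coe_le_coe_iff.mpr ht), EReal.coe_lt_top _⟩
    exact NLS.false_of_deriv_deriv_le hc (fun t _ => h0 t) (fun t ht => (hd t (hmem t ht)).1)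
      (fun t ht => (hd t (hmem t ht)).2.1) (fun t ht => (hd t (hmem t ht)).2.2) hA
  exact ⟨⟨h1, hmin h1⟩, h2, hmax h2⟩
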